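/- For $n\ge 1$ and $\mu\in(-1,1)^n$ let $D_\mu$ be the product distribution on $\{-1,1\}^n$ with $\mathbf{E}[x_i]=\mu_i$ for every $i$; it is called $c$-bounded if $\mu\in[-1+c,1-c]^n$. A monotone DNF expression with $s$ terms is a disjunction of at most $s$ conjunctions of unnegated variables, viewed as a function $f:\{-1,1\}^n\to\{-1,1\}$ (where $1$ means true). Theorem. For every constant $c\in(0,1]$ there are an algorithm $\mathcal{A}$ and constants $a,K,k$ (all depending only on $c$) such that the following holds for all integers $n,s\ge 1$, all $\epsilon\in(0,1)$ and all functions $f$ given by an $s$-term monotone DNF expression over $n$ variables. Put $$\ell=\max\{1,\log_2(s/\epsilon)\},\qquad B=n\cdot (s\,\ell)^{K\ell},\qquad T=a\cdot B\cdot(1+\log_2 B)^{k},$$ so that $T=\tilde O\big(n\cdot (s\log(s/\epsilon))^{O(\log(s/\epsilon))}\big)$. Given $n$, $s$, $\lceil 1/\epsilon\rceil$, access to examples $(x,f(x))$, and fair random bits, $\mathcal{A}$ always halts within time $T$ and outputs a representation of a hypothesis $h:\{-1,1\}^n\to\{-1,1\}$ that can be evaluated at any point in time $T$ (by an evaluation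 program that is part of $\mathcal{A}$). If the points $x$ of the examples are drawn independently from $D_\mu$, for any $c$-bounded $D_\mu$ (unknown to $\mathcal{A}$), then with probability at least $1/2$ over the examples and the random bits, $\mathbf{Pr}_{x\sim D_\mu}[h(x)=f(x)]\ge 1-\epsilon$. Here algorithms are programs for a random access machine on natural numbers, with logarithmic cost (an operation costs the binary lengths of its operands, multiplication and division cost the product of these lengths, and requesting an example costs $n+1$). -/

import Mathlib

open MeasureTheory

noncomputable section

namespace PACLearning

/-! ### The Boolean cube, concepts, product distributions

The cube `{-1,1}^n` is `Fin n → Bool`, where `true` stands for `1` and `false` for `-1`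
(both for coordinates and for values of concepts). -/

/-- Points of the cube. -/
abbrev Cube (n : ℕ) : Type := Fin n → Bool

/-- Concepts: Boolean functions on the cube. -/
abbrev Concept (n : ℕ) : Type := Cube n → Bool

/-- A single `±1` bit with expectation `m`: it is `1` with probability `(1 + m) / 2`. -/
def biasedBit (m : Set.Ioo (-1 : ℝ) 1) : Measure Bool :=
  ENNReal.ofReal ((1 + (m : ℝ)) / 2) • Measure.dirac true +
    ENNReal.ofReal ((1 - (m : ℝ)) / 2) • Measure.dirac false

instance biasedBit_isProbabilityMeasure (m : Set.Ioo (-1 : ℝ) 1) :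
    IsProbabilityMeasure (biasedBit m) := by
  constructor
  have h1 := m.2.1
  have h2 := m.2.2
  simp only [biasedBit, Measure.coe_add, Measure.coe_smul, Pi.add_apply, Pi.smul_apply,
    measure_univ, smul_eq_mul, mul_one]
  rw [← ENNReal.ofReal_add (by linarith) (by linarith), ← ENNReal.ofReal_one]
  congr 1
  ring

/-- The product distribution `D_μ` on the cube with mean vector `μ ∈ (-1,1)^n`. -/
def productDist {n : ℕ} (μ : Fin n → Set.Ioo (-1 : ℝ) 1) : ProbabilityMeasure (Cube n) :=
  ⟨Measure.pi fun i => biasedBit (μ i), inferInstance⟩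

/-- The `c`-bounded product distributions: `D_μ` with `μ ∈ [-1+c, 1-c]^n`. -/
def boundedProductDists (c : ℝ) (n : ℕ) : Set (ProbabilityMeasure (Cube n)) :=
  {D | ∃ μ : Fin n → Set.Ioo (-1 : ℝ) 1,
    (∀ i, (μ i : ℝ) ∈ Set.Icc (-1 + c) (1 - c)) ∧ D = productDist μ}

/-- Functions computed by a monotone DNF expression with at most `s` terms.  A monotone term is
the conjunction of a set `t` of (unnegated) variables. -/
def monotoneDNF (n s : ℕ) : Set (Concept n) :=
  {f | ∃ T : Finset (Finset (Fin n)), T.card ≤ s ∧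
    ∀ x, f x = true ↔ ∃ t ∈ T, ∀ i ∈ t, x i = true}

/-- `h` is `ε`-close to `f` relative to `D`. -/
def IsClose {n : ℕ} (D : ProbabilityMeasure (Cube n)) (ε : ℝ) (h f : Concept n) : Prop :=
  ENNReal.ofReal (1 - ε) ≤ (D : Measure (Cube n)) {x | f x = h x}

/-! ### Random access machines with logarithmic cost

A program uses registers (addressed directly) and arrays (the name of an array is fixed in the
program, the index is the content of a register).  Registers and array cells hold natural
numbers.  The machine is connected to an example oracle and to a source of fair coins. -/

/-- Structured RAM programs. -/
inductive Prog : Type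
  /-- do nothing -/
  | skip : Prog
  /-- `R[d] := k` -/
  | const (d k : ℕ) : Prog
  /-- `R[d] := R[a] + R[b]` -/
  | add (d a b : ℕ) : Prog
  /-- `R[d] := R[a] - R[b]` (truncated at `0`) -/
  | sub (d a b : ℕ) : Prog
  /-- `R[d] := R[a] * R[b]` -/
  | mul (d a b : ℕ) : Prog
  /-- `R[d] := ⌊R[a] / R[b]⌋` (`0` if `R[b] = 0`) -/
  | div (d a b : ℕ) : Prog
  /-- `R[d] := A[R[i]]` -/
  | load (d A i : ℕ) : Prog
  /-- `A[R[i]] := R[b]` -/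
  | store (A i b : ℕ) : Prog
  /-- request a labelled example `(x, f x)`; it becomes the current example -/
  | draw : Prog
  /-- `R[d] :=` the bit with index `R[i]` of the current example (`0` if out of range) -/
  | bit (d i : ℕ) : Prog
  /-- `R[d] :=` the label of the current example -/
  | label (d : ℕ) : Prog
  /-- `R[d] :=` a fresh random bit -/
  | flip (d : ℕ) : Prog
  /-- sequential composition -/
  | seq (p q : Prog) : Prog
  /-- if `R[r] ≠ 0` then `p` else `q` -/
  | ite (r : ℕ) (p q : Prog) : Prog
  /-- while `R[r] ≠ 0` do `p` -/
  | loop (r : ℕ) (p : Prog) : Prog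

/-- Everything the machine may receive from outside: the successive answers of the example
oracle and the successive coin tosses. -/
structure Source (n : ℕ) where
  ex : ℕ → Cube n × Bool
  coin : ℕ → Bool

/-- Machine states: registers, arrays, current example with its label, and the numbers of
examples and of coins consumed so far. -/
structure State (n : ℕ) where
  reg : ℕ → ℕ
  arr : ℕ → ℕ → ℕ
  cur : Cube n
  lab : Bool
  nEx : ℕ
  nCoin : ℕ

/-- Assign the value `v` to register `d`. -/
def State.setReg {n : ℕ} (σ : State n) (d v : ℕ) : State n :=
  { σ with reg := Function.update σ.reg d v }

/-- Assign the value `v` to the cell with index `j` of the array `A`. -/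
def State.setArr {n : ℕ} (σ : State n) (A j v : ℕ) : State n :=
  { σ with arr := Function.update σ.arr A (Function.update (σ.arr A) j v) }

/-- The bit with index `j` of a point, as a number; `0` if `j` is out of range. -/
def bitAt {n : ℕ} (x : Cube n) (j : ℕ) : ℕ :=
  if h : j < n then (x ⟨j, h⟩).toNat else 0

/-- `Exec ω p σ t τ`: with outside source `ω`, the program `p` started in state `σ` halts in
state `τ` after time `t`.  The cost is logarithmic: an operation is charged the binary lengths
of the numbers and indices it handles (multiplication and division the product of the lengths),
and a request for an example is charged the length `n` of the example. -/
inductive Exec {n : ℕ} (ω : Source n) : Prog → State n → ℕ → State n → Prop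
  | skip (σ : State n) : Exec ω .skip σ 1 σ
  | const (σ : State n) (d k : ℕ) :
      Exec ω (.const d k) σ (1 + k.size) (σ.setReg d k)
  | add (σ : State n) (d a b : ℕ) :
      Exec ω (.add d a b) σ (1 + (σ.reg a).size + (σ.reg b).size)
        (σ.setReg d (σ.reg a + σ.reg b))
  | sub (σ : State n) (d a b : ℕ) :
      Exec ω (.sub d a b) σ (1 + (σ.reg a).size + (σ.reg b).size)
        (σ.setReg d (σ.reg a - σ.reg b))
  | mul (σ : State n) (d a b : ℕ) :
      Exec ω (.mul d a b) σ ((1 + (σ.reg a).size) * (1 + (σ.reg b).size))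
        (σ.setReg d (σ.reg a * σ.reg b))
  | div (σ : State n) (d a b : ℕ) :
      Exec ω (.div d a b) σ ((1 + (σ.reg a).size) * (1 + (σ.reg b).size))
        (σ.setReg d (σ.reg a / σ.reg b))
  | load (σ : State n) (d A i : ℕ) :
      Exec ω (.load d A i) σ (1 + (σ.reg i).size + (σ.arr A (σ.reg i)).size)
        (σ.setReg d (σ.arr A (σ.reg i)))
  | store (σ : State n) (A i b : ℕ) :
      Exec ω (.store A i b) σ (1 + (σ.reg i).size + (σ.reg b).size)
        (σ.setArr A (σ.reg i) (σ.reg b))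
  | draw (σ : State n) :
      Exec ω .draw σ (1 + n)
        { σ with cur := (ω.ex σ.nEx).1, lab := (ω.ex σ.nEx).2, nEx := σ.nEx + 1 }
  | bit (σ : State n) (d i : ℕ) :
      Exec ω (.bit d i) σ (1 + (σ.reg i).size) (σ.setReg d (bitAt σ.cur (σ.reg i)))
  | label (σ : State n) (d : ℕ) :
      Exec ω (.label d) σ 1 (σ.setReg d σ.lab.toNat)
  | flip (σ : State n) (d : ℕ) :
      Exec ω (.flip d) σ 1
        { σ.setReg d (ω.coin σ.nCoin).toNat with nCoin := σ.nCoin + 1 }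
  | seq {p q : Prog} {σ ρ τ : State n} {t u : ℕ} :
      Exec ω p σ t ρ → Exec ω q ρ u τ → Exec ω (.seq p q) σ (t + u) τ
  | ite_true {r : ℕ} {p q : Prog} {σ τ : State n} {t : ℕ} :
      σ.reg r ≠ 0 → Exec ω p σ t τ → Exec ω (.ite r p q) σ (1 + (σ.reg r).size + t) τ
  | ite_false {r : ℕ} {p q : Prog} {σ τ : State n} {t : ℕ} :
      σ.reg r = 0 → Exec ω q σ t τ → Exec ω (.ite r p q) σ (1 + (σ.reg r).size + t) τ
  | loop_done {r : ℕ} {p : Prog} {σ : State n} :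
      σ.reg r = 0 → Exec ω (.loop r p) σ (1 + (σ.reg r).size) σ
  | loop_step {r : ℕ} {p : Prog} {σ ρ τ : State n} {t u : ℕ} :
      σ.reg r ≠ 0 → Exec ω p σ t ρ → Exec ω (.loop r p) ρ u τ →
        Exec ω (.loop r p) σ (1 + (σ.reg r).size + t + u) τ

/-- The machine is deterministic once the outside source is fixed: the running time and the
final state are unique. -/
theorem Exec.unique {n : ℕ} {ω : Source n} {p : Prog} {σ τ : State n} {t : ℕ}
    (h : Exec ω p σ t τ) : ∀ {t' : ℕ} {τ' : State n}, Exec ω p σ t' τ' → t = t' ∧ τ = τ' := by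
  induction h with
  | seq _ _ ih1 ih2 =>
    intro t' τ' h'
    cases h' with
    | seq k1 k2 =>
      obtain ⟨rfl, rfl⟩ := ih1 k1
      obtain ⟨rfl, rfl⟩ := ih2 k2
      exact ⟨rfl, rfl⟩
  | ite_true hr _ ih =>
    intro t' τ' h'
    cases h' with
    | ite_true _ k =>
      obtain ⟨rfl, rfl⟩ := ih k
      exact ⟨rfl, rfl⟩
    | ite_false k0 _ => exact absurd k0 hr
  | ite_false hr _ ih =>
    intro t' τ' h'
    cases h' with
    | ite_true k0 _ => exact absurd hr k0
    | ite_false _ k =>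
      obtain ⟨rfl, rfl⟩ := ih k
      exact ⟨rfl, rfl⟩
  | loop_done hr =>
    intro t' τ' h'
    cases h' with
    | loop_done _ => exact ⟨rfl, rfl⟩
    | loop_step k0 _ _ => exact absurd hr k0
  | loop_step hr _ _ ih1 ih2 =>
    intro t' τ' h'
    cases h' with
    | loop_done k0 => exact absurd k0 hr
    | loop_step _ k1 k2 =>
      obtain ⟨rfl, rfl⟩ := ih1 k1
      obtain ⟨rfl, rfl⟩ := ih2 k2
      exact ⟨rfl, rfl⟩
  | _ =>
    intro t' τ' h'
    cases h'
    exact ⟨rfl, rfl⟩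

/-- `p` started in `σ` halts in state `τ` within time `T`. -/
def HaltsWithin {n : ℕ} (ω : Source n) (p : Prog) (σ : State n) (T : ℝ) (τ : State n) : Prop :=
  ∃ t : ℕ, Exec ω p σ t τ ∧ (t : ℝ) ≤ T

/-! ### Learning algorithms -/

/-- A learning algorithm.  The program `learn` draws examples and leaves (a representation of) a
hypothesis in memory; the program `eval` evaluates represented hypotheses at given points. -/
structure Learner where
  learn : Prog
  eval : Prog

/-- Initial state: registers `0`, `1`, `2` hold the dimension `n`, the size parameter `s` and the
accuracy parameter `k` (the accuracy is `1 / k`); everything else is zero. -/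
def initState (n s k : ℕ) : State n where
  reg := fun r => if r = 0 then n else if r = 1 then s else if r = 2 then k else 0
  arr := fun _ _ => 0
  cur := fun _ => false
  lab := false
  nEx := 0
  nCoin := 0

/-- The source available to `eval`: it carries no information. -/
def blankSource (n : ℕ) : Source n where
  ex := fun _ => (fun _ => false, false)
  coin := fun _ => false

/-- The source seen by a learner of `f`: the points `xs`, labelled by `f`, and the coins `b`. -/
def exampleSource {n : ℕ} (f : Concept n) (xs : ℕ → Cube n) (b : ℕ → Bool) : Source n where
  ex := fun i => (xs i, f (xs i))
  coin := b

/-- `L.Outputs s k ω T h`: on parameters `n`, `s`, `k` and source `ω`, the learner halts within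
time `T`, and the memory content that it leaves represents the hypothesis `h`, in the sense that
`eval`, started on this memory with the point `x`, halts within time `T` and returns `h x` (that
is, leaves a nonzero number in register `0` exactly if `h x` is true). -/
def Learner.Outputs {n : ℕ} (L : Learner) (s k : ℕ) (ω : Source n) (T : ℝ) (h : Concept n) :
    Prop :=
  ∃ τ : State n, HaltsWithin ω L.learn (initState n s k) T τ ∧
    ∀ x : Cube n, ∃ ρ : State n,
      HaltsWithin (blankSource n) L.eval { τ with cur := x, lab := false, nEx := 0, nCoin := 0 }
        T ρ ∧
      (h x = true ↔ ρ.reg 0 ≠ 0)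

/-- Independent draws from `D`, together with independent fair coins. -/
def sampleMeasure {n : ℕ} (D : ProbabilityMeasure (Cube n)) :
    Measure ((ℕ → Cube n) × (ℕ → Bool)) :=
  (Measure.infinitePi fun _ : ℕ => (D : Measure (Cube n))).prod
    (Measure.infinitePi fun _ : ℕ => biasedBit ⟨0, by norm_num⟩)

/-- `L` PAC learns the concept classes `C n s` over the distributions in `𝒟 n` in time
`T n s ε`: it always halts in this time with a hypothesis that can be evaluated in this time, and
with probability at least `1/2` over the examples and the coins the hypothesis is `ε`-close to the
target.  The learner is given `n`, `s` and `ε` (in the form `⌈1/ε⌉`), but not the distribution. -/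
def Learner.PACLearns (L : Learner) (C : (n s : ℕ) → Set (Concept n))
    (𝒟 : (n : ℕ) → Set (ProbabilityMeasure (Cube n))) (T : ℕ → ℕ → ℝ → ℝ) : Prop :=
  ∀ (n s : ℕ) (ε : ℝ), 1 ≤ n → 1 ≤ s → 0 < ε → ε < 1 → ∀ f ∈ C n s,
    (∀ (xs : ℕ → Cube n) (b : ℕ → Bool),
      ∃ h, L.Outputs s ⌈1 / ε⌉₊ (exampleSource f xs b) (T n s ε) h) ∧
    ∀ D ∈ 𝒟 n,
      1 / 2 ≤ sampleMeasure D
        {w | ∃ h, L.Outputs s ⌈1 / ε⌉₊ (exampleSource f w.1 w.2) (T n s ε) h ∧ IsClose D ε h f}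

/-! ### The time bound -/

/-- `log₂ (s / ε)`, replaced by `1` in the degenerate case where it is smaller than `1`. -/
def logRatio (s : ℕ) (ε : ℝ) : ℝ := max 1 (Real.logb 2 (s / ε))

/-- `n · (s · log (s/ε)) ^ (K · log (s/ε))` -/
def baseBound (K n s : ℕ) (ε : ℝ) : ℝ :=
  n * (s * logRatio s ε) ^ (K * logRatio s ε)

/-- The bound `Õ(n · (s · log (s/ε)) ^ O(log (s/ε)))` with explicit constants: `a · B · (1 + log B)^k`
where `B = n · (s · log (s/ε)) ^ (K · log (s/ε))`. -/
def timeBound (a K k n s : ℕ) (ε : ℝ) : ℝ :=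
  a * baseBound K n s ε * (1 + Real.logb 2 (baseBound K n s ε)) ^ k

end PACLearning

end

/-! Let ν be the product measure, A the set where the target is true, p_i = Pr[x_i = 1] ≤ ρ = 1 -
c/2, and choose g with ρ^g ≤ 1/2. A monotone term with at least gJ variables then has probability at
most 2^-J, so long terms can be dropped cheaply, and the remaining ones involve at most r = sgJ
variables.

The structural core is that a variable with small covariance with a monotone DNF can be replaced by
a constant. With Δ = Pr[A | x_i = 1] - Pr[A | x_i = 0] the covariance is p_i(1-p_i)Δ, while
substituting true or false changes the function with probability (1-p_i)Δ or p_iΔ. A constant drawn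
with bias p_i thus costs twice the covariance on average and preserves the other covariances on
average, so some constant is no worse than the average (`exists_restriction`). Hence the target is
1/E-close to a DNF over the variables of large covariance, of which there are at most r, and its
terms may be cut off at d variables (`exists_short_dnf`).

The algorithm estimates all covariances on m examples, lists the variables that look relevant,
enumerates the N = (r+1)^d codes of terms of at most d listed variables, and keeps the terms that
are rarely true on negative examples of a second batch. The terms of the approximating DNF survive,
and any surviving term has error at most 3/E. With E = 16Nk the union of all survivors is still
accurate (`measureReal_ne_hypothesis_le`). The estimates come from Hoeffding's inequality and a
union bound over all (n+1)^d sequences of literal codes, so the dependence of the list on the first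
batch is harmless and n enters m only logarithmically.

The covariance threshold 1/q must exceed 4s·2^-J, although q depends on J through r and N. Since log
q is only about log(sk)·log r, the choice J = 2^a(sL)², with L the length of sk, closes the circle
(`four_mul_q_lt`). All parameters are then bounded by fixed powers of (sL)^O(L), apart from factors
in n, which yields the time bound (`mkParams_bounds`, `time_le_timeBound`).

The programs are verified in a Hoare logic with running times, for every source (`learner_outputs`);
probability enters only through the accuracy of the frequencies. -/

namespace PACLearning

/-! ### A program logic with running times -/

/-- `p` started in `σ` halts within `T` steps in a state that satisfies `Q`. -/
def Run {n : ℕ} (ω : Source n) (p : Prog) (σ : State n) (T : ℕ) (Q : State n → Prop) : Prop :=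
  ∃ t τ, Exec ω p σ t τ ∧ t ≤ T ∧ Q τ

/-- A bound on the cost of an elementary operation on numbers that are at most `X`. -/
def opCost (X : ℕ) : ℕ := (1 + X.size) ^ 2

@[simp] theorem State.setReg_reg {n : ℕ} (σ : State n) (d v r : ℕ) :
    (σ.setReg d v).reg r = if r = d then v else σ.reg r := by
  simp [State.setReg, Function.update_apply]

@[simp] theorem State.setReg_arr {n : ℕ} (σ : State n) (d v : ℕ) :
    (σ.setReg d v).arr = σ.arr := rfl

@[simp] theorem State.setReg_cur {n : ℕ} (σ : State n) (d v : ℕ) :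
    (σ.setReg d v).cur = σ.cur := rfl

@[simp] theorem State.setReg_lab {n : ℕ} (σ : State n) (d v : ℕ) :
    (σ.setReg d v).lab = σ.lab := rfl

@[simp] theorem State.setReg_nEx {n : ℕ} (σ : State n) (d v : ℕ) :
    (σ.setReg d v).nEx = σ.nEx := rfl

@[simp] theorem State.setArr_arr {n : ℕ} (σ : State n) (A j v B i : ℕ) :
    (σ.setArr A j v).arr B i = if B = A then (if i = j then v else σ.arr A i) else σ.arr B i := by
  by_cases h : B = A
  · subst h
    simp [State.setArr, Function.update_apply]
  · simp [State.setArr, h]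

@[simp] theorem State.setArr_reg {n : ℕ} (σ : State n) (A j v : ℕ) :
    (σ.setArr A j v).reg = σ.reg := rfl

@[simp] theorem State.setArr_cur {n : ℕ} (σ : State n) (A j v : ℕ) :
    (σ.setArr A j v).cur = σ.cur := rfl

@[simp] theorem State.setArr_lab {n : ℕ} (σ : State n) (A j v : ℕ) :
    (σ.setArr A j v).lab = σ.lab := rfl

@[simp] theorem State.setArr_nEx {n : ℕ} (σ : State n) (A j v : ℕ) :
    (σ.setArr A j v).nEx = σ.nEx := rfl

section Rules

variable {n : ℕ} {ω : Source n} {σ : State n} {X : ℕ} {Q : State n → Prop}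

theorem one_le_opCost : 1 ≤ opCost X := Nat.one_le_pow _ _ (by omega)

theorem one_add_size_le_opCost {a : ℕ} (ha : a ≤ X) : 1 + a.size ≤ opCost X := by
  have := Nat.size_le_size ha
  unfold opCost
  nlinarith

theorem one_add_size_add_size_le_opCost {a b : ℕ} (ha : a ≤ X) (hb : b ≤ X) :
    1 + a.size + b.size ≤ opCost X := by
  have := Nat.size_le_size ha
  have := Nat.size_le_size hb
  unfold opCost
  nlinarith

theorem size_mul_size_le_opCost {a b : ℕ} (ha : a ≤ X) (hb : b ≤ X) :
    (1 + a.size) * (1 + b.size) ≤ opCost X := by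
  have := Nat.size_le_size ha
  have := Nat.size_le_size hb
  unfold opCost
  nlinarith

theorem Run.le {p : Prog} {T T' : ℕ} (h : Run ω p σ T Q) (hT : T ≤ T') : Run ω p σ T' Q := by
  obtain ⟨t, τ, h1, h2, h3⟩ := h
  exact ⟨t, τ, h1, h2.trans hT, h3⟩

theorem Run.imp {p : Prog} {T : ℕ} {Q' : State n → Prop} (h : Run ω p σ T Q)
    (hQ : ∀ τ, Q τ → Q' τ) : Run ω p σ T Q' := by
  obtain ⟨t, τ, h1, h2, h3⟩ := h
  exact ⟨t, τ, h1, h2, hQ τ h3⟩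

theorem Run.skip (h : Q σ) : Run ω .skip σ (opCost X) Q :=
  ⟨_, _, .skip σ, one_le_opCost, h⟩

theorem Run.const {d k : ℕ} (hk : k ≤ X) (h : Q (σ.setReg d k)) :
    Run ω (.const d k) σ (opCost X) Q :=
  ⟨_, _, .const σ d k, one_add_size_le_opCost hk, h⟩

theorem Run.add {d a b : ℕ} (ha : σ.reg a ≤ X) (hb : σ.reg b ≤ X)
    (h : Q (σ.setReg d (σ.reg a + σ.reg b))) : Run ω (.add d a b) σ (opCost X) Q :=
  ⟨_, _, .add σ d a b, one_add_size_add_size_le_opCost ha hb, h⟩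

theorem Run.sub {d a b : ℕ} (ha : σ.reg a ≤ X) (hb : σ.reg b ≤ X)
    (h : Q (σ.setReg d (σ.reg a - σ.reg b))) : Run ω (.sub d a b) σ (opCost X) Q :=
  ⟨_, _, .sub σ d a b, one_add_size_add_size_le_opCost ha hb, h⟩

theorem Run.mul {d a b : ℕ} (ha : σ.reg a ≤ X) (hb : σ.reg b ≤ X)
    (h : Q (σ.setReg d (σ.reg a * σ.reg b))) : Run ω (.mul d a b) σ (opCost X) Q :=
  ⟨_, _, .mul σ d a b, size_mul_size_le_opCost ha hb, h⟩

theorem Run.div {d a b : ℕ} (ha : σ.reg a ≤ X) (hb : σ.reg b ≤ X)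
    (h : Q (σ.setReg d (σ.reg a / σ.reg b))) : Run ω (.div d a b) σ (opCost X) Q :=
  ⟨_, _, .div σ d a b, size_mul_size_le_opCost ha hb, h⟩

theorem Run.load {d A i : ℕ} (ha : σ.reg i ≤ X) (hb : σ.arr A (σ.reg i) ≤ X)
    (h : Q (σ.setReg d (σ.arr A (σ.reg i)))) : Run ω (.load d A i) σ (opCost X) Q :=
  ⟨_, _, .load σ d A i, one_add_size_add_size_le_opCost ha hb, h⟩

theorem Run.store {A i b : ℕ} (ha : σ.reg i ≤ X) (hb : σ.reg b ≤ X)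
    (h : Q (σ.setArr A (σ.reg i) (σ.reg b))) : Run ω (.store A i b) σ (opCost X) Q :=
  ⟨_, _, .store σ A i b, one_add_size_add_size_le_opCost ha hb, h⟩

theorem Run.bit {d i : ℕ} (ha : σ.reg i ≤ X) (h : Q (σ.setReg d (bitAt σ.cur (σ.reg i)))) :
    Run ω (.bit d i) σ (opCost X) Q :=
  ⟨_, _, .bit σ d i, one_add_size_le_opCost ha, h⟩

theorem Run.label {d : ℕ} (h : Q (σ.setReg d σ.lab.toNat)) :
    Run ω (.label d) σ (opCost X) Q :=
  ⟨_, _, .label σ d, one_le_opCost, h⟩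

theorem Run.draw
    (h : Q { σ with cur := (ω.ex σ.nEx).1, lab := (ω.ex σ.nEx).2, nEx := σ.nEx + 1 }) :
    Run ω .draw σ (1 + n) Q :=
  ⟨_, _, .draw σ, le_rfl, h⟩

/-- Placing the second run in the postcondition of the first lets a straight-line program be
verified by one nested term, with the state computed symbolically. -/
theorem Run.seq {p q : Prog} {T₁ T₂ : ℕ} (h : Run ω p σ T₁ fun ρ => Run ω q ρ T₂ Q) :
    Run ω (.seq p q) σ (T₁ + T₂) Q := by
  obtain ⟨t, ρ, h1, h2, u, τ, h3, h4, h5⟩ := h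
  exact ⟨_, _, .seq h1 h3, by omega, h5⟩

theorem Run.ite {r : ℕ} {p q : Prog} {T₁ T₂ : ℕ} (hr : σ.reg r ≤ X)
    (hp : σ.reg r ≠ 0 → Run ω p σ T₁ Q) (hq : σ.reg r = 0 → Run ω q σ T₂ Q) :
    Run ω (.ite r p q) σ (opCost X + (T₁ + T₂)) Q := by
  have hs := one_add_size_le_opCost hr
  by_cases h0 : σ.reg r = 0
  · obtain ⟨t, τ, h1, h2, h3⟩ := hq h0
    exact ⟨_, _, .ite_false h0 h1, by omega, h3⟩
  · obtain ⟨t, τ, h1, h2, h3⟩ := hp h0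
    exact ⟨_, _, .ite_true h0 h1, by omega, h3⟩

/-- A loop whose body decreases a natural number attached to the state. -/
theorem Run.loop {r : ℕ} {p : Prog} {T : ℕ} (I : ℕ → State n → Prop) (N : ℕ)
    (hI : I N σ) (hX : ∀ j ≤ N, ∀ ρ, I j ρ → ρ.reg r ≤ X ∧ (ρ.reg r = 0 ↔ j = 0))
    (hbody : ∀ j < N, ∀ ρ, I (j + 1) ρ → Run ω p ρ T (I j)) (hQ : ∀ ρ, I 0 ρ → Q ρ) :
    Run ω (.loop r p) σ (N * (T + opCost X) + opCost X) Q := by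
  induction N generalizing σ with
  | zero =>
    obtain ⟨h1, h2⟩ := hX 0 le_rfl σ hI
    have hs := one_add_size_le_opCost h1
    exact ⟨_, _, .loop_done (h2.2 rfl), by omega, hQ σ hI⟩
  | succ N ih =>
    obtain ⟨h1, h2⟩ := hX (N + 1) le_rfl σ hI
    have hs := one_add_size_le_opCost h1
    obtain ⟨t, ρ, h3, h4, h5⟩ := hbody N (by omega) σ hI
    obtain ⟨u, τ, h6, h7, h8⟩ := ih h5 (fun j hj => hX j (by omega)) (fun j hj => hbody j (by omega))
    refine ⟨_, _, .loop_step (fun h => by simp [h] at h2) h3 h6, ?_, h8⟩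
    have : (N + 1) * (T + opCost X) = N * (T + opCost X) + (T + opCost X) := by ring
    omega

/-- `for R[r] := R[r] - 1, ..., 0 do p`, provided that register `3` holds `1`. -/
def forDown (r : ℕ) (p : Prog) : Prog := .loop r (.seq (.sub r r 3) p)

/-- The counter is decremented before the body runs, so the body sees N-1, ..., 0, and `I j`
describes the state once the indices j, ..., N-1 have been treated. -/
theorem Run.forDown {r : ℕ} {p : Prog} {T : ℕ} (I : ℕ → State n → Prop) (N : ℕ) (hN : N ≤ X)
    (h1X : 1 ≤ X) (hI : I N σ) (hr : σ.reg r = N)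
    (hone : ∀ j < N, ∀ ρ, I (j + 1) ρ → ρ.reg 3 = 1)
    (hbody : ∀ j < N, ∀ ρ, I (j + 1) ρ → ρ.reg r = j + 1 →
      Run ω p (ρ.setReg r j) T fun τ => I j τ ∧ τ.reg r = j) (hQ : ∀ ρ, I 0 ρ → Q ρ) :
    Run ω (forDown r p) σ (N * (T + 2 * opCost X) + opCost X) Q := by
  refine (Run.loop (X := X) (T := opCost X + T) (fun j ρ => I j ρ ∧ ρ.reg r = j) N ⟨hI, hr⟩ ?_ ?_
    fun ρ h => hQ ρ h.1).le (by apply le_of_eq; ring)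
  · rintro j hj ρ ⟨-, h⟩
    exact ⟨by omega, by omega⟩
  · rintro j hj ρ ⟨h, h'⟩
    have h3 := hone j hj ρ h
    refine Run.seq (Run.sub (by omega) (by omega) ?_)
    rw [h3, h', Nat.add_sub_cancel]
    exact hbody j hj ρ h h'

end Rules

/-! ### Evaluation of monotone terms -/

/-- The parameters that the programs keep in their registers. -/
structure Params where
  (n d R N q m r E : ℕ)

/-- The parameters are stored in the registers of `σ`. -/
structure Params.Stored (P : Params) {n : ℕ} (σ : State n) : Prop where
  n : σ.reg 0 = P.n
  one : σ.reg 3 = 1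
  zero : σ.reg 4 = 0
  d : σ.reg 5 = P.d
  R : σ.reg 6 = P.R
  N : σ.reg 7 = P.N
  q : σ.reg 8 = P.q
  m : σ.reg 9 = P.m
  r : σ.reg 10 = P.r
  E : σ.reg 11 = P.E

theorem Params.Stored.congr {P : Params} {n : ℕ} {σ τ : State n} (h : P.Stored σ)
    (hr : ∀ r < 12, τ.reg r = σ.reg r) : P.Stored τ := by
  constructor
  · rw [hr _ (by omega), h.n]
  · rw [hr _ (by omega), h.one]
  · rw [hr _ (by omega), h.zero]
  · rw [hr _ (by omega), h.d]
  · rw [hr _ (by omega), h.R]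
  · rw [hr _ (by omega), h.N]
  · rw [hr _ (by omega), h.q]
  · rw [hr _ (by omega), h.m]
  · rw [hr _ (by omega), h.r]
  · rw [hr _ (by omega), h.E]

theorem Params.Stored.setReg {P : Params} {n : ℕ} {σ : State n} (h : P.Stored σ) {r v : ℕ}
    (hr : 12 ≤ r) : P.Stored (σ.setReg r v) :=
  h.congr fun r' hr' => by simp; omega

/-- All numbers that occur in a computation with the parameters `P` are at most `X`. -/
structure Params.Bounded (P : Params) (X : ℕ) : Prop where
  n : P.n ≤ X
  d : P.d ≤ X
  R : P.R ≤ X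
  N : P.N ≤ X
  q : 2 * P.q ≤ X
  m : 2 * P.m ≤ X
  r : P.r < P.R
  E : P.E ≤ X
  Em : P.E * P.m ≤ X
  qmm : 3 * P.q * P.m * P.m ≤ X
  qm : 2 * P.q * P.m ≤ X
  q_pos : 1 ≤ P.q
  two : 2 ≤ X

/-- The value at `x` of the literal with code `w`: the code `0` stands for a missing literal, and
`i + 1` for the variable `i`. -/
def litVal {n : ℕ} (x : Cube n) (w : ℕ) : ℕ := if w = 0 then 1 else bitAt x (w - 1)

/-- The value at `x` of the term whose literals have the codes that the table `S` assigns to the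
`d` digits of `u` in base `R`. -/
def termVal {n : ℕ} (S : ℕ → ℕ) (R d u : ℕ) (x : Cube n) : ℕ :=
  ∏ j ∈ Finset.range d, litVal x (S (u / R ^ j % R))

theorem bitAt_le_one {n : ℕ} (x : Cube n) (j : ℕ) : bitAt x j ≤ 1 := by
  unfold bitAt
  split
  · exact Bool.toNat_le _
  · omega

theorem litVal_le_one {n : ℕ} (x : Cube n) (w : ℕ) : litVal x w ≤ 1 := by
  unfold litVal
  split
  · omega
  · exact bitAt_le_one _ _

theorem termVal_le_one {n : ℕ} (S : ℕ → ℕ) (R d u : ℕ) (x : Cube n) : termVal S R d u x ≤ 1 :=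
  Finset.prod_le_one' fun _ _ => litVal_le_one _ _

/-- `R[15] :=` the value at the current example of the term with number `R[14]`; the table of
literals is the array `2`. -/
def termProg : Prog :=
  .seq (.const 15 1) <| .seq (.add 16 14 4) <| .seq (.add 17 5 4) <|
  forDown 17 <|
    .seq (.div 18 16 6) <| .seq (.mul 23 18 6) <| .seq (.sub 23 16 23) <| .seq (.add 16 18 4) <|
    .seq (.load 23 2 23) <|
    .ite 23 (.seq (.sub 23 23 3) <| .seq (.bit 23 23) <| .mul 15 15 23) .skip

/-- `τ` differs from `σ` only in registers with numbers `≥ b`. -/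
structure AgreeBelow {n : ℕ} (b : ℕ) (σ τ : State n) : Prop where
  reg : ∀ r < b, τ.reg r = σ.reg r
  arr : τ.arr = σ.arr
  cur : τ.cur = σ.cur
  lab : τ.lab = σ.lab
  nEx : τ.nEx = σ.nEx

theorem AgreeBelow.refl {n : ℕ} (b : ℕ) (σ : State n) : AgreeBelow b σ σ :=
  ⟨fun _ _ => rfl, rfl, rfl, rfl, rfl⟩

theorem AgreeBelow.setReg {n : ℕ} {b : ℕ} {σ τ : State n} (h : AgreeBelow b σ τ) {r v : ℕ}
    (hr : b ≤ r) : AgreeBelow b σ (τ.setReg r v) :=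
  ⟨fun r' hr' => by simp [h.reg r' hr']; omega, h.arr, h.cur, h.lab, h.nEx⟩

theorem run_termProg {n : ℕ} {ω : Source n} {P : Params} {X : ℕ} {σ : State n}
    (hP : P.Bounded X) (hσ : P.Stored σ) (hS : ∀ v, σ.arr 2 v ≤ X) (hu : σ.reg 14 ≤ X) :
    Run ω termProg σ ((13 * P.d + 4) * opCost X) fun τ =>
      AgreeBelow 15 σ τ ∧ τ.reg 15 = termVal (σ.arr 2) P.R P.d (σ.reg 14) σ.cur := by
  have hb := hP
  obtain ⟨hn, hd, hR, hN, hq, hm, hr, hE, hEm, hqmm, hqm, hq1, h2⟩ := hb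
  have s4 := hσ.zero
  have s5 := hσ.d
  have s3 := hσ.one
  refine Run.le (Run.seq (Run.const (X := X) (by omega) <| Run.seq <| Run.add (X := X) (by simp; omega)
    (by simp; omega) <| Run.seq (T₂ := P.d * (11 * opCost X + 2 * opCost X) + opCost X) <|
    Run.add (X := X) (by simp; omega) (by simp; omega) ?_)) ?_
  -- Digits are read from the lowest upwards: register 16 holds the quotient still to be read,
  -- register 15 the product over the digits read so far. Register 4 holds 0, so adding it copies a
  -- register.
  · refine Run.forDown (X := X) (T := 11 * opCost X) (fun j ρ => AgreeBelow 15 σ ρ ∧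
      ρ.reg 16 = σ.reg 14 / P.R ^ (P.d - j) ∧
      ρ.reg 15 = ∏ i ∈ Finset.range (P.d - j), litVal σ.cur (σ.arr 2 (σ.reg 14 / P.R ^ i % P.R)))
      P.d hd (by omega) ?_ (by simp [s5, s4]) ?_ ?_ ?_
    · refine ⟨?_, by simp [s4], by simp⟩
      exact (((AgreeBelow.refl _ _).setReg (by omega)).setReg (by omega)).setReg (by omega)
    · rintro j - ρ ⟨h, -⟩
      rw [h.reg 3 (by omega), s3]
    · rintro j hj ρ ⟨hA, h16, h15⟩ h17
      have r4 : ρ.reg 4 = 0 := by rw [hA.reg 4 (by omega), s4]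
      have r3 : ρ.reg 3 = 1 := by rw [hA.reg 3 (by omega), s3]
      have r6 : ρ.reg 6 = P.R := by rw [hA.reg 6 (by omega), hσ.R]
      have e1 : P.d - j = P.d - (j + 1) + 1 := by omega
      have h16' : ρ.reg 16 ≤ X := by rw [h16]; exact (Nat.div_le_self _ _).trans hu
      have hw1 : ρ.reg 16 / P.R ≤ X := (Nat.div_le_self _ _).trans h16'
      have hw2 : ρ.reg 16 / P.R * P.R ≤ X := (Nat.div_mul_le_self _ _).trans h16'
      have hmod : ρ.reg 16 - ρ.reg 16 / P.R * P.R = ρ.reg 16 % P.R := by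
        rw [Nat.mod_eq_sub_div_mul]
      have hdiv : ρ.reg 16 / P.R = σ.reg 14 / P.R ^ (P.d - j) := by
        rw [h16, Nat.div_div_eq_div_mul, e1, pow_succ]
      have h15' : ρ.reg 15 ≤ X := by
        rw [h15]
        exact (Finset.prod_le_one' fun _ _ => litVal_le_one _ _).trans (by omega)
      have hSρ : ∀ v, ρ.arr 2 v ≤ X := by rw [hA.arr]; exact hS
      refine Run.le (Run.seq <| Run.div (X := X) (by simp; omega) (by simp; omega) <| Run.seq <|
        Run.mul (X := X) (by simp; rw [r6]; omega) (by simp; omega) <| Run.seq <|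
        Run.sub (X := X) (by simp; omega) (by simp; rw [r6]; omega) <| Run.seq <|
        Run.add (X := X) (by simp; rw [r6]; omega) (by simp; omega) <| Run.seq <|
        Run.load (X := X) (by simp; omega) (by simpa using hSρ _) <|
        Run.ite (X := X) (by simpa using hSρ _) (fun h0 => Run.seq <|
        Run.sub (X := X) (by simpa using hSρ _) (by simp; omega) <| Run.seq <|
        Run.bit (X := X) ?_ <| Run.mul (X := X) ?_ ?_ ?_) (fun h0 => Run.skip (X := X) ?_)) ?_
      · simp only [State.setReg_reg, State.setReg_arr]
        simpa using (Nat.sub_le _ _).trans (hSρ _)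
      · simp; omega
      · simpa using (bitAt_le_one _ _).trans (by omega : 1 ≤ X)
      · refine ⟨⟨?_, ?_, ?_⟩, by simp⟩
        · repeat' apply AgreeBelow.setReg _ (by omega)
          exact hA
        · simp [r4, r6, hdiv]
        · simp [r6, hmod, hA.arr] at h0
          rw [e1, Finset.prod_range_succ, ← h15]
          simp only [State.setReg_reg, State.setReg_arr, State.setReg_cur]
          simp [r6, r3, hmod, hA.arr, hA.cur, ← h16, litVal, h0]
      · simp [r6, hmod, hA.arr] at h0
        refine ⟨⟨?_, ?_, ?_⟩, by simp⟩
        · repeat' apply AgreeBelow.setReg _ (by omega)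
          exact hA
        · simp [r4, r6, hdiv]
        · rw [e1, Finset.prod_range_succ, ← h15]
          simp [← h16, litVal, h0]
      · omega
    · rintro ρ ⟨h1, -, h2⟩
      exact ⟨h1, by simpa [termVal] using h2⟩
  · apply le_of_eq
    ring

/-! ### Collecting statistics about the variables -/

/-- Add the current example, with label `R[13]`, to the counters `A[0]` of the variables and
`A[1]` of the conjunctions of a variable with the label. -/
def tally : Prog :=
  .seq (.add 14 0 4) <| forDown 14 <|
    .seq (.bit 15 14) <| .seq (.load 16 0 14) <| .seq (.add 16 16 15) <| .seq (.store 0 14 16) <|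
    .seq (.mul 15 15 13) <| .seq (.load 16 1 14) <| .seq (.add 16 16 15) <| .store 1 14 16

theorem bitAt_of_le {n : ℕ} (x : Cube n) {j : ℕ} (h : n ≤ j) : bitAt x j = 0 := by
  simp [bitAt, h.not_gt]

theorem run_tally {n : ℕ} {ω : Source n} {P : Params} {X : ℕ} {σ : State n}
    (hP : P.Bounded X) (hn : P.n = n) (hσ : P.Stored σ) (h0 : ∀ i, σ.arr 0 i ≤ P.m)
    (h1 : ∀ i, σ.arr 1 i ≤ P.m) (h13 : σ.reg 13 ≤ 1) :
    Run ω tally σ ((10 * P.n + 2) * opCost X) fun τ =>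
      (∀ r, r < 14 ∨ 17 ≤ r → τ.reg r = σ.reg r) ∧
      (∀ i, τ.arr 0 i = σ.arr 0 i + bitAt σ.cur i) ∧
      (∀ i, τ.arr 1 i = σ.arr 1 i + bitAt σ.cur i * σ.reg 13) ∧
      (∀ A, 2 ≤ A → τ.arr A = σ.arr A) ∧ τ.nEx = σ.nEx := by
  have s0 := hσ.n
  have s3 := hσ.one
  have s4 := hσ.zero
  obtain ⟨hnX, hd, hR, hN, hq, hm, hr, hE, hEm, hqmm, hqm, hq1, h2⟩ := hP
  refine Run.le (Run.seq (T₂ := P.n * (8 * opCost X + 2 * opCost X) + opCost X) <|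
    Run.add (X := X) (by omega) (by omega) ?_) (by apply le_of_eq; ring)
  refine Run.forDown (X := X) (fun j ρ =>
    (∀ r, r < 14 ∨ 17 ≤ r → ρ.reg r = σ.reg r) ∧
    (∀ i, ρ.arr 0 i = σ.arr 0 i + if j ≤ i then bitAt σ.cur i else 0) ∧
    (∀ i, ρ.arr 1 i = σ.arr 1 i + if j ≤ i then bitAt σ.cur i * σ.reg 13 else 0) ∧
    (∀ A, 2 ≤ A → ρ.arr A = σ.arr A) ∧ ρ.nEx = σ.nEx ∧ ρ.cur = σ.cur) P.n hnX (by omega)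
    ?_ (by simp [s0, s4]) ?_ ?_ ?_
  · refine ⟨fun r hr => ?_, fun i => ?_, fun i => ?_, fun A _ => rfl, rfl, rfl⟩
    · simp; omega
    -- Cells with index at least `n` count as treated from the start, which is harmless because
    -- out-of-range bits are 0.
    · simp only [State.setReg_arr]
      split
      · rw [bitAt_of_le _ (by omega), add_zero]
      · rfl
    · simp only [State.setReg_arr]
      split
      · rw [bitAt_of_le _ (by omega), Nat.zero_mul, add_zero]
      · rfl
  · rintro j - ρ ⟨h, -⟩
    rw [h 3 (by omega), s3]
  · rintro j hj ρ ⟨hr, ha0, ha1, hA, hE, hc⟩ h14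
    have hb := bitAt_le_one ρ.cur j
    have r13 := hr 13 (by omega)
    have e0 := ha0 j
    have e1 := ha1 j
    rw [if_neg (by omega), add_zero] at e0 e1
    have := h0 j
    have := h1 j
    have hbl : bitAt ρ.cur j * ρ.reg 13 ≤ 1 := by
      rw [r13]
      exact (Nat.mul_le_mul hb h13).trans (by omega)
    refine Run.le (Run.seq <| Run.bit (X := X) (by simp; omega) <|
      Run.seq <| Run.load (X := X) (by simp; omega) (by simp; omega) <|
      Run.seq <| Run.add (X := X) (by simp; omega) (by simp; omega) <|
      Run.seq <| Run.store (X := X) (by simp; omega) (by simp; omega) <|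
      Run.seq <| Run.mul (X := X) (by simp; omega) (by simp; omega) <|
      Run.seq <| Run.load (X := X) (by simp; omega) (by simp; omega) <|
      Run.seq <| Run.add (X := X) (by simp; omega) (by simp; omega) <|
      Run.store (X := X) (by simp; omega) (by simp; omega) ?_) (by omega)
    refine ⟨⟨fun r hr' => ?_, fun i => ?_, fun i => ?_, fun A hA' => ?_, hE, hc⟩, by simp⟩
    · rw [← hr r hr']
      simp
      grind
    · by_cases hi : i = j
      · subst hi
        simp [e0, hc]
      · have : (j + 1 ≤ i) = (j ≤ i) := by grind
        simp [hi, ha0, this]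
    · by_cases hi : i = j
      · subst hi
        simp [e1, hc, r13]
      · have : (j + 1 ≤ i) = (j ≤ i) := by grind
        simp [hi, ha1, this]
    · rw [← hA A hA']
      funext i
      have h0 : A ≠ 0 := by omega
      have h1 : A ≠ 1 := by omega
      simp [h0, h1]
  · rintro ρ ⟨hr, ha0, ha1, hA, hE, hc⟩
    exact ⟨hr, by simpa using ha0, by simpa using ha1, hA, hE⟩

/-- The number of examples with numbers in `[a, b)` whose label is true. -/
def countLabel {n : ℕ} (ω : Source n) (a b : ℕ) : ℕ :=
  ∑ t ∈ Finset.Ico a b, (ω.ex t).2.toNat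

/-- The number of examples with numbers in `[a, b)` in which the variable `i` is true. -/
def countVar {n : ℕ} (ω : Source n) (a b i : ℕ) : ℕ :=
  ∑ t ∈ Finset.Ico a b, bitAt (ω.ex t).1 i

/-- The number of examples with numbers in `[a, b)` in which the variable `i` and the label are
true. -/
def countVarLabel {n : ℕ} (ω : Source n) (a b i : ℕ) : ℕ :=
  ∑ t ∈ Finset.Ico a b, bitAt (ω.ex t).1 i * (ω.ex t).2.toNat

theorem sum_Ico_le {f : ℕ → ℕ} (hf : ∀ t, f t ≤ 1) (a b : ℕ) :
    ∑ t ∈ Finset.Ico a b, f t ≤ b - a := by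
  simpa using Finset.sum_le_card_nsmul (Finset.Ico a b) f 1 fun t _ => hf t

theorem countLabel_le {n : ℕ} (ω : Source n) (b : ℕ) : countLabel ω 0 b ≤ b :=
  sum_Ico_le (fun _ => Bool.toNat_le _) 0 b

theorem countVar_le {n : ℕ} (ω : Source n) (b i : ℕ) : countVar ω 0 b i ≤ b :=
  sum_Ico_le (fun _ => bitAt_le_one _ _) 0 b

theorem countVarLabel_le {n : ℕ} (ω : Source n) (b i : ℕ) : countVarLabel ω 0 b i ≤ b :=
  sum_Ico_le (fun _ => (Nat.mul_le_mul (bitAt_le_one _ _) (Bool.toNat_le _)).trans (by simp)) 0 b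

/-- Draw `m` examples and count the occurrences of true labels, true variables, and both. -/
def collect : Prog :=
  .seq (.add 12 9 4) <| forDown 12 <|
    .seq .draw <| .seq (.label 13) <| .seq (.add 20 20 13) tally

theorem run_collect {n : ℕ} {ω : Source n} {P : Params} {X : ℕ} {σ : State n}
    (hP : P.Bounded X) (hn : P.n = n) (hσ : P.Stored σ) (harr : ∀ A i, σ.arr A i = 0)
    (h20 : σ.reg 20 = 0) (hE : σ.nEx = 0) :
    Run ω collect σ (P.m * (1 + n + (10 * P.n + 6) * opCost X) + 2 * opCost X) fun τ =>
      (∀ r < 12, τ.reg r = σ.reg r) ∧ τ.nEx = P.m ∧ τ.reg 20 = countLabel ω 0 P.m ∧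
      (∀ i, τ.arr 0 i = countVar ω 0 P.m i) ∧ (∀ i, τ.arr 1 i = countVarLabel ω 0 P.m i) ∧
      ∀ A, 2 ≤ A → ∀ i, τ.arr A i = 0 := by
  have s4 := hσ.zero
  have s9 := hσ.m
  have hb := hP
  obtain ⟨hnX, hd, hR, hN, hq, hm, hr, hEX, hEm, hqmm, hqm, hq1, h2⟩ := hb
  refine Run.le (Run.seq (T₂ := P.m * ((1 + n + (10 * P.n + 4) * opCost X) + 2 * opCost X) +
    opCost X) <| Run.add (X := X) (by omega) (by omega) ?_) (by apply le_of_eq; ring)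
  refine Run.forDown (X := X) (fun j ρ =>
    (∀ r < 12, ρ.reg r = σ.reg r) ∧ ρ.nEx = P.m - j ∧ ρ.reg 20 = countLabel ω 0 (P.m - j) ∧
    (∀ i, ρ.arr 0 i = countVar ω 0 (P.m - j) i) ∧
    (∀ i, ρ.arr 1 i = countVarLabel ω 0 (P.m - j) i) ∧ ∀ A, 2 ≤ A → ∀ i, ρ.arr A i = 0)
    P.m (by omega) (by omega) ?_ (by simp [s9, s4]) ?_ ?_ ?_
  · refine ⟨fun r hr => ?_, ?_, ?_, fun i => ?_, fun i => ?_, fun A _ => by simp [harr]⟩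
    · simp; omega
    · simp [hE]
    · simp [h20, countLabel]
    · simp [harr, countVar]
    · simp [harr, countVarLabel]
  · rintro j - ρ ⟨h, -⟩
    rw [h 3 (by omega), hσ.one]
  · rintro j hj ρ ⟨hr, hx, r20, ha0, ha1, hA⟩ h12
    have hlab : ∀ t, (ω.ex t).2.toNat ≤ 1 := fun t => Bool.toNat_le _
    have h20' := countLabel_le ω (P.m - (j + 1))
    have e : P.m - j = P.m - (j + 1) + 1 := by omega
    refine Run.le (Run.seq <| Run.draw <| Run.seq <| Run.label (X := X) <| Run.seq <|
      Run.add (X := X) (by simp; omega) (by simpa using (hlab _).trans (by omega)) <|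
      Run.imp (run_tally hP hn ?_ ?_ ?_ ?_) ?_) (by apply le_of_eq; ring)
    · refine hσ.congr fun r hr' => ?_
      simp only [State.setReg_reg]
      grind
    · exact fun i => by simpa [ha0] using (countVar_le ω _ i).trans (by omega)
    · exact fun i => by simpa [ha1] using (countVarLabel_le ω _ i).trans (by omega)
    · simpa using hlab _
    · rintro τ ⟨t1, t2, t3, t4, t5⟩
      refine ⟨⟨fun r hr' => ?_, ?_, ?_, fun i => ?_, fun i => ?_, fun A hA' i => ?_⟩, ?_⟩
      · rw [t1 r (by omega), ← hr r hr']
        simp only [State.setReg_reg]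
        grind
      · simp [t5, hx, e]
      · rw [t1 20 (by omega), e, countLabel, Finset.sum_Ico_succ_top (by omega)]
        simp [r20, hx, countLabel]
      · rw [t2, e, countVar, Finset.sum_Ico_succ_top (by omega)]
        simp [ha0, hx, countVar]
      · rw [t3, e, countVarLabel, Finset.sum_Ico_succ_top (by omega)]
        simp [ha1, hx, countVarLabel]
      · rw [t4 A hA']
        simpa using hA A hA' i
      · rw [t1 12 (by omega)]
        simp
  · rintro ρ ⟨hr, hx, r20, ha0, ha1, hA⟩
    exact ⟨hr, hx, r20, ha0, ha1, hA⟩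

/-! ### Selecting the relevant variables -/

/-- Given the number `F` of true labels and the numbers `A₀` and `A₁` of examples with a true
variable, and a true variable and a true label, among `m` examples, the test whether the empirical
covariance of the variable with the label is larger than `1 / (2 q)`. -/
def CovTest (P : Params) (F A₀ A₁ : ℕ) : Prop :=
  2 * P.q * F * A₀ + P.m * P.m < 2 * P.q * P.m * A₁

instance (P : Params) (F A₀ A₁ : ℕ) : Decidable (CovTest P F A₀ A₁) := by
  unfold CovTest
  infer_instance

/-- `R[15] :=` a number that is nonzero if and only if the variable `R[14]` passes the test. -/
def covDiff : Prog :=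
  .seq (.load 15 1 14) <| .seq (.mul 15 15 9) <| .seq (.mul 15 15 8) <| .seq (.add 15 15 15) <|
  .seq (.load 16 0 14) <| .seq (.mul 16 16 20) <| .seq (.mul 16 16 8) <|
  .seq (.add 16 16 16) <| .seq (.mul 17 9 9) <| .seq (.add 16 16 17) <| .sub 15 15 16

theorem run_covDiff {n : ℕ} {ω : Source n} {P : Params} {X : ℕ} {σ : State n}
    (hP : P.Bounded X) (hσ : P.Stored σ) (h14 : σ.reg 14 ≤ P.n)
    (h0 : σ.arr 0 (σ.reg 14) ≤ P.m) (h1 : σ.arr 1 (σ.reg 14) ≤ P.m) (h20 : σ.reg 20 ≤ P.m) :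
    Run ω covDiff σ (11 * opCost X) fun τ =>
      (∀ r, r < 15 ∨ 18 ≤ r → τ.reg r = σ.reg r) ∧ τ.nEx = σ.nEx ∧ τ.arr = σ.arr ∧ τ.reg 15 ≤ X ∧
      (τ.reg 15 ≠ 0 ↔ CovTest P (σ.reg 20) (σ.arr 0 (σ.reg 14)) (σ.arr 1 (σ.reg 14))) := by
  have s8 := hσ.q
  have s9 := hσ.m
  obtain ⟨hnX, hd, hR, hN, hq, hm, hr, hE, hEm, hqmm, hqm, hq1, h2⟩ := hP
  -- Both sides of the test stay below 3qm²: the counts are at most m, and m² ≤ qm². This is the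
  -- origin of the factor 3 in the bound for the numbers.
  have hmm : P.m * P.m ≤ P.q * P.m * P.m := by
    rw [mul_assoc]; exact Nat.le_mul_of_pos_left _ (by omega)
  have hqmm' : 3 * (P.q * P.m * P.m) ≤ X := by
    refine le_trans (le_of_eq ?_) hqmm
    ring
  generalize ha0 : σ.arr 0 (σ.reg 14) = a₀ at *
  generalize ha1 : σ.arr 1 (σ.reg 14) = a₁ at *
  generalize hF : σ.reg 20 = F at *
  have c1 : a₁ * P.m ≤ P.m * P.m := Nat.mul_le_mul_right _ h1
  have c2 : a₁ * P.m * P.q ≤ P.q * P.m * P.m := by nlinarith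
  have c3 : a₀ * F ≤ P.m * P.m := Nat.mul_le_mul h0 h20
  have c4 : a₀ * F * P.q ≤ P.q * P.m * P.m := by nlinarith
  clear hqmm hEm hqm
  generalize P.q * P.m * P.m = Z at *
  refine Run.le (Run.seq <| Run.load (X := X) (by omega) (by omega) <|
    Run.seq <| Run.mul (X := X) (by simp; omega) (by simp; omega) <|
    Run.seq <| Run.mul (X := X) (by simp [ha1, s9]; omega) (by simp; omega) <|
    Run.seq <| Run.add (X := X) (by simp [ha1, s9, s8]; omega) (by simp [ha1, s9, s8]; omega) <|
    Run.seq <| Run.load (X := X) (by simp; omega) (by simp; omega) <|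
    Run.seq <| Run.mul (X := X) (by simp; omega) (by simp; omega) <|
    Run.seq <| Run.mul (X := X) (by simp [ha0, hF]; omega) (by simp; omega) <|
    Run.seq <| Run.add (X := X) (by simp [ha0, hF, s8]; omega) (by simp [ha0, hF, s8]; omega) <|
    Run.seq <| Run.mul (X := X) (by simp; omega) (by simp; omega) <|
    Run.seq <| Run.add (X := X) (by simp [ha0, hF, s8]; omega) (by simp [s9]; omega) <|
    Run.sub (X := X) (by simp [ha1, s9, s8]; omega) (by simp [ha0, hF, s8, s9]; omega) ?_)
    (by omega)
  refine ⟨fun r hr' => ?_, rfl, rfl, ?_, ?_⟩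
  · simp only [State.setReg_reg]
    grind
  · simp [ha1, s8, s9]
    omega
  · have f1 : 2 * P.q * F * a₀ = a₀ * F * P.q + a₀ * F * P.q := by ring
    have f2 : 2 * P.q * P.m * a₁ = a₁ * P.m * P.q + a₁ * P.m * P.q := by ring
    simp only [CovTest, f1, f2]
    simp [ha0, ha1, hF, s8, s9]
    omega

/-- Store the codes of (at most `r`) variables that pass the test in the array `2`. -/
def select : Prog :=
  .seq (.add 22 10 4) <| .seq (.add 14 0 4) <| forDown 14 <| .seq covDiff <|
    .ite 15 (.ite 22 (.seq (.sub 22 22 3) <| .seq (.add 17 14 3) <| .store 2 22 17) .skip) .skip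

/-- The table `S` lists variables below `n` that satisfy `p`, in cells below `r`, and all of them
if there are at most `r`. -/
structure Lists (S : ℕ → ℕ) (n r : ℕ) (p : ℕ → Prop) [DecidablePred p] : Prop where
  sound : ∀ v, S v ≠ 0 → v < r ∧ S v - 1 < n ∧ p (S v - 1)
  complete : ((Finset.range n).filter p).card ≤ r → ∀ i < n, p i → ∃ v < r, S v = i + 1

theorem card_filter_Ico_pred {p : ℕ → Prop} [DecidablePred p] {j n : ℕ} (hj : j < n) :
    ((Finset.Ico j n).filter p).card =
      ((Finset.Ico (j + 1) n).filter p).card + if p j then 1 else 0 := by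
  rw [← Finset.insert_Ico_add_one_left_eq_Ico hj, Finset.filter_insert]
  split
  · rw [Finset.card_insert_of_notMem (by simp)]
  · rfl

/-- Register 22 counts the free cells, and the table is filled from cell r-1 downwards. Cell r is
never written, so the digit r can stand for a missing literal. -/
theorem run_select {n : ℕ} {ω : Source n} {P : Params} {X : ℕ} {σ : State n}
    (hP : P.Bounded X) (hσ : P.Stored σ) (h0 : ∀ i, σ.arr 0 i ≤ P.m)
    (h1 : ∀ i, σ.arr 1 i ≤ P.m) (h20 : σ.reg 20 ≤ P.m) (h2S : ∀ i, σ.arr 2 i = 0) :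
    Run ω select σ ((20 * P.n + 3) * opCost X) fun τ =>
      (∀ r < 12, τ.reg r = σ.reg r) ∧ τ.nEx = σ.nEx ∧ (∀ A, A ≠ 2 → τ.arr A = σ.arr A) ∧
      Lists (τ.arr 2) P.n P.r fun i => CovTest P (σ.reg 20) (σ.arr 0 i) (σ.arr 1 i) := by
  have s0 := hσ.n
  have s3 := hσ.one
  have s4 := hσ.zero
  have s8 := hσ.q
  have s9 := hσ.m
  have s10 := hσ.r
  have hPb := hP
  obtain ⟨hnX, hd, hR, hN, hq, hm, hr, hE, hEm, hqmm, hqm, hq1, h2⟩ := hP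
  set p : ℕ → Prop := fun i => CovTest P (σ.reg 20) (σ.arr 0 i) (σ.arr 1 i) with hp
  refine Run.le (Run.seq <| Run.add (X := X) (by omega) (by omega) <|
    Run.seq (T₂ := P.n * (18 * opCost X + 2 * opCost X) + opCost X) <|
    Run.add (X := X) (by simp; omega) (by simp; omega) ?_) (by apply le_of_eq; ring)
  refine Run.forDown (X := X) (fun j ρ =>
    (∀ r, r < 12 ∨ r = 20 → ρ.reg r = σ.reg r) ∧ ρ.nEx = σ.nEx ∧
    (∀ A, A ≠ 2 → ρ.arr A = σ.arr A) ∧ ρ.reg 22 ≤ P.r ∧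
    (∀ v, ρ.arr 2 v ≠ 0 → v < P.r ∧ ρ.reg 22 ≤ v ∧ ρ.arr 2 v - 1 < P.n ∧ p (ρ.arr 2 v - 1)) ∧
    -- If no cell is free, at least r variables have passed already. One more passing variable then
    -- contradicts the assumption that at most r pass, so the completeness claim survives an
    -- overflow.
    P.r ≤ ρ.reg 22 + ((Finset.Ico j P.n).filter p).card ∧
    (((Finset.range P.n).filter p).card ≤ P.r →
      ∀ i, j ≤ i → i < P.n → p i → ∃ v < P.r, ρ.arr 2 v = i + 1)) P.n hnX (by omega)
    ?_ (by simp [s0, s4]) ?_ ?_ ?_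
  · refine ⟨fun r hr => ?_, rfl, fun A _ => rfl, ?_, ?_, ?_, ?_⟩
    · simp only [State.setReg_reg]
      grind
    · simp [s10, s4]
    · simp [h2S]
    · simp [s10, s4]
    · intro _ i h3 h4
      omega
  · rintro j - ρ ⟨h, -⟩
    rw [h 3 (by omega), s3]
  · rintro j hj ρ ⟨hr, hx, hA, h22, hs, hcard, hcomp⟩ h14
    have hcj := card_filter_Ico_pred (p := p) hj
    have e0 : ρ.arr 0 = σ.arr 0 := hA 0 (by omega)
    have e1 : ρ.arr 1 = σ.arr 1 := hA 1 (by omega)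
    have e20 := hr 20 (by omega)
    refine Run.le (Run.seq <| Run.imp (run_covDiff hPb ?_ (by simp; omega) (by simpa [e0] using h0 j)
      (by simpa [e1] using h1 j) (by simpa [e20] using h20)) ?_)
      (by omega : 11 * opCost X + 7 * opCost X ≤ 18 * opCost X)
    · refine hσ.congr fun r hr' => ?_
      simp only [State.setReg_reg]
      grind
    rintro τ ⟨t1, t2, t3, t5, t4⟩
    simp only [State.setReg_reg, State.setReg_arr, e0, e1, if_true, e20] at t1 t3 t4
    rw [if_neg (by omega)] at t4
    change _ ↔ p j at t4
    have r3 : τ.reg 3 = 1 := by rw [t1 3 (by omega), if_neg (by omega), hr 3 (by omega), s3]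
    have r14 : τ.reg 14 = j := by rw [t1 14 (by omega), if_pos rfl]
    have r22 : τ.reg 22 = ρ.reg 22 := by rw [t1 22 (by omega), if_neg (by omega)]
    have hreg : ∀ r, r < 12 ∨ r = 20 → τ.reg r = σ.reg r := fun r hr' => by
      rw [t1 r (by omega), if_neg (by omega), hr r hr']
    have hx' : τ.nEx = σ.nEx := by rw [t2]; simpa using hx
    have hA' : ∀ A, A ≠ 2 → τ.arr A = σ.arr A := fun A h => by rw [t3]; exact hA A h
    rw [← r22] at h22 hs hcard
    rw [← t3] at hs hcomp
    clear hr hx hA t1 t2 t3 e20 e0 e1 r22 h14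
    refine Run.le (Run.ite (X := X) t5 (fun g => Run.ite (X := X) (by omega)
        (fun g2 => Run.seq <| Run.sub (X := X) (by omega) (by omega) <|
          Run.seq <| Run.add (X := X) (by simp; omega) (by simp; omega) <|
          Run.store (X := X) (by simp; omega) (by simp; omega) ?_)
        fun g2 => Run.skip (X := X) ?_)
      fun g => Run.skip (X := X) ?_) (by omega)
    · rw [if_pos (t4.1 g)] at hcj
      refine ⟨⟨fun r hr' => ?_, hx', fun A hA2 => ?_, ?_, fun v hv => ?_, ?_,
        fun hc i hi1 hi2 hi3 => ?_⟩, ?_⟩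
      · rw [← hreg r hr']
        simp only [State.setReg_reg, State.setArr_reg]
        grind
      · rw [← hA' A hA2]
        funext i
        simp [hA2]
      · simp; omega
      · by_cases hv' : v = τ.reg 22 - 1
        · subst hv'
          simp [r3, r14, t4.1 g, hj]
          omega
        · simp [r3, hv'] at hv ⊢
          obtain ⟨a1, a2, a3, a4⟩ := hs v hv
          exact ⟨a1, by omega, a3, a4⟩
      · simp [r3]
        omega
      · by_cases hij : i = j
        · subst hij
          exact ⟨τ.reg 22 - 1, by omega, by simp [r3, r14]⟩
        · obtain ⟨v, hv1, hv2⟩ := hcomp hc i (by omega) hi2 hi3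
          refine ⟨v, hv1, ?_⟩
          have := (hs v (by omega)).2.1
          have hne : v ≠ τ.reg 22 - 1 := by omega
          simp [r3, hne, hv2]
      · simp [r14]
    · rw [if_pos (t4.1 g)] at hcj
      refine ⟨⟨hreg, hx', hA', h22, hs, by omega, fun hc => ?_⟩, r14⟩
      have : ((Finset.Ico j P.n).filter p).card ≤ ((Finset.range P.n).filter p).card :=
        Finset.card_le_card (Finset.filter_subset_filter _ fun i hi => by simp at hi ⊢; omega)
      omega
    · have g' : ¬ p j := fun h => t4.2 h g
      rw [if_neg g'] at hcj
      refine ⟨⟨hreg, hx', hA', h22, hs, by omega, fun hc i hi1 hi2 hi3 => ?_⟩, r14⟩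
      have hij : i ≠ j := by rintro rfl; exact g' hi3
      exact hcomp hc i (by omega) hi2 hi3
  · rintro ρ ⟨hr, hx, hA, h22, hs, hcard, hcomp⟩
    refine ⟨fun r hr' => hr r (by omega), hx, hA, fun v hv => ?_, fun hc i hi hpi => ?_⟩
    · obtain ⟨a1, -, a3, a4⟩ := hs v hv
      exact ⟨a1, a3, a4⟩
    · exact hcomp hc i (by omega) hi hpi

/-! ### Estimating the error probabilities of terms -/

/-- The number of examples with numbers in `[a, b)` that satisfy the term `u` but have a false
label. -/
def errCount {n : ℕ} (ω : Source n) (S : ℕ → ℕ) (R d a b u : ℕ) : ℕ :=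
  ∑ t ∈ Finset.Ico a b, if (ω.ex t).2 then 0 else termVal S R d u (ω.ex t).1

theorem errCount_le {n : ℕ} (ω : Source n) (S : ℕ → ℕ) (R d a b u : ℕ) :
    errCount ω S R d a b u ≤ b - a := by
  refine sum_Ico_le (fun t => ?_) a b
  split
  · omega
  · exact termVal_le_one _ _ _ _ _

/-- Add the values of all terms at the current example to the counters `A[3]`. -/
def tallyTerms : Prog :=
  .seq (.add 14 7 4) <| forDown 14 <| .seq termProg <|
    .seq (.load 16 3 14) <| .seq (.add 16 16 15) <| .store 3 14 16

theorem run_tallyTerms {n : ℕ} {ω : Source n} {P : Params} {X : ℕ} {σ : State n}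
    (hP : P.Bounded X) (hσ : P.Stored σ) (hS : ∀ v, σ.arr 2 v ≤ X) (h3 : ∀ u < P.N, σ.arr 3 u ≤ P.m) :
    Run ω tallyTerms σ ((P.N * (13 * P.d + 9) + 2) * opCost X) fun τ =>
      (∀ r < 14, τ.reg r = σ.reg r) ∧ τ.nEx = σ.nEx ∧ (∀ A, A ≠ 3 → τ.arr A = σ.arr A) ∧
      ∀ u < P.N, τ.arr 3 u = σ.arr 3 u + termVal (σ.arr 2) P.R P.d u σ.cur := by
  have hPb := hP
  have s3 := hσ.one
  have s4 := hσ.zero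
  have s7 := hσ.N
  obtain ⟨hnX, hd, hR, hN, hq, hm, hr, hE, hEm, hqmm, hqm, hq1, h2⟩ := hP
  refine Run.le (Run.seq (T₂ := P.N * (((13 * P.d + 4) * opCost X + 3 * opCost X) +
    2 * opCost X) + opCost X) <|
    Run.add (X := X) (by omega) (by omega) ?_) (by apply le_of_eq; ring)
  refine Run.forDown (X := X) (fun j ρ =>
    (∀ r < 14, ρ.reg r = σ.reg r) ∧ ρ.nEx = σ.nEx ∧ ρ.cur = σ.cur ∧
    (∀ A, A ≠ 3 → ρ.arr A = σ.arr A) ∧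
    ∀ u < P.N, ρ.arr 3 u = σ.arr 3 u +
      if j ≤ u then termVal (σ.arr 2) P.R P.d u σ.cur else 0) P.N hN (by omega)
    ?_ (by simp [s7, s4]) ?_ ?_ ?_
  · refine ⟨fun r hr => ?_, rfl, rfl, fun A _ => rfl, fun u hu => ?_⟩
    · simp only [State.setReg_reg]
      grind
    · rw [if_neg (by omega)]
      rfl
  · rintro j - ρ ⟨h, -⟩
    rw [h 3 (by omega), s3]
  · rintro j hj ρ ⟨hr, hx, hc, hA, hu⟩ h14
    have e2 : ρ.arr 2 = σ.arr 2 := hA 2 (by omega)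
    refine Run.le (Run.seq <| Run.imp (run_termProg hPb ?_ (by simpa [e2] using hS)
      (by simp; omega)) ?_) (le_refl ((13 * P.d + 4) * opCost X + 3 * opCost X))
    · refine hσ.congr fun r hr' => ?_
      simp only [State.setReg_reg]
      grind
    rintro τ ⟨t1, t2⟩
    have r14 : τ.reg 14 = j := by rw [t1.reg 14 (by omega)]; simp
    have hl := termVal_le_one (σ.arr 2) P.R P.d j σ.cur
    simp [e2, hc] at t2
    have e3 := hu j hj
    rw [if_neg (by omega), add_zero] at e3
    have := h3 j hj
    have a3 : τ.arr = ρ.arr := t1.arr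
    refine Run.le (Run.seq <| Run.load (X := X) (by omega) (by rw [r14, a3]; omega) <|
      Run.seq <| Run.add (X := X) (by simp [r14, a3]; omega) (by simp; omega) <|
      Run.store (X := X) (by simp; omega) (by simp [r14, a3]; omega) ?_) (by omega)
    refine ⟨⟨fun r hr' => ?_, ?_, ?_, fun A hA3 => ?_, fun u hu' => ?_⟩, by simp [r14]⟩
    · rw [← hr r hr']
      simp only [State.setReg_reg, State.setArr_reg]
      rw [if_neg (by omega), if_neg (by omega), t1.reg r (by omega)]
      simp
      omega
    · simp [t1.nEx, hx]
    · simp [t1.cur, hc]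
    · rw [← hA A hA3, ← a3]
      funext i
      simp [hA3]
    · by_cases huj : u = j
      · subst huj
        simp [r14, a3, t2, e3]
      · have : (j + 1 ≤ u) = (j ≤ u) := by grind
        simp [r14, huj, a3, hu u hu', this]
  · rintro ρ ⟨hr, hx, hc, hA, hu⟩
    exact ⟨hr, hx, hA, by simpa using hu⟩

/-- Draw `m` examples and count the errors of all terms. -/
def countErrors : Prog :=
  .seq (.add 12 9 4) <| forDown 12 <| .seq .draw <| .seq (.label 13) <| .ite 13 .skip tallyTerms

/-- The run starts with m examples consumed, so the errors are measured on the second batch [m, 2m),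
after the table of variables has been fixed. -/
theorem run_countErrors {n : ℕ} {ω : Source n} {P : Params} {X : ℕ} {σ : State n}
    (hP : P.Bounded X) (hσ : P.Stored σ) (hS : ∀ v, σ.arr 2 v ≤ X) (h3 : ∀ u, σ.arr 3 u = 0)
    (hE : σ.nEx = P.m) :
    Run ω countErrors σ
      (P.m * (1 + n + (P.N * (13 * P.d + 9) + 7) * opCost X) + 2 * opCost X) fun τ =>
      (∀ r < 12, τ.reg r = σ.reg r) ∧ (∀ A, A ≠ 3 → τ.arr A = σ.arr A) ∧
      ∀ u < P.N, τ.arr 3 u = errCount ω (σ.arr 2) P.R P.d P.m (2 * P.m) u := by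
  have hPb := hP
  have s4 := hσ.zero
  have s9 := hσ.m
  obtain ⟨hnX, hd, hR, hN, hq, hm, hr, hEX, hEm, hqmm, hqm, hq1, h2⟩ := hP
  refine Run.le (Run.seq (T₂ := P.m * ((1 + n + (P.N * (13 * P.d + 9) + 5) * opCost X) +
    2 * opCost X) + opCost X) <| Run.add (X := X) (by omega) (by omega) ?_)
    (by apply le_of_eq; ring)
  refine Run.forDown (X := X) (fun j ρ =>
    (∀ r < 12, ρ.reg r = σ.reg r) ∧ ρ.nEx = P.m + (P.m - j) ∧
    (∀ A, A ≠ 3 → ρ.arr A = σ.arr A) ∧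
    ∀ u < P.N, ρ.arr 3 u = errCount ω (σ.arr 2) P.R P.d P.m (P.m + (P.m - j)) u)
    P.m (by omega) (by omega) ?_ (by simp [s9, s4]) ?_ ?_ ?_
  · refine ⟨fun r hr => ?_, ?_, fun A _ => rfl, fun u _ => ?_⟩
    · simp only [State.setReg_reg]
      grind
    · simp [hE]
    · simp [h3, errCount]
  · rintro j - ρ ⟨h, -⟩
    rw [h 3 (by omega), hσ.one]
  · rintro j hj ρ ⟨hr, hx, hA, hu⟩ h12
    have e2 : ρ.arr 2 = σ.arr 2 := hA 2 (by omega)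
    have hlab : ∀ t, (ω.ex t).2.toNat ≤ 1 := fun t => Bool.toNat_le _
    have e : P.m + (P.m - j) = P.m + (P.m - (j + 1)) + 1 := by omega
    refine Run.le (Run.seq <| Run.draw <| Run.seq <| Run.label (X := X) <|
      Run.ite (X := X) (T₁ := opCost X) (T₂ := (P.N * (13 * P.d + 9) + 2) * opCost X)
      (by simpa using (hlab _).trans (by omega)) (fun g => Run.skip (X := X) ?_)
      fun g => Run.imp (run_tallyTerms hPb ?_ ?_ ?_) ?_) (by apply le_of_eq; ring)
    · simp only [State.setReg_reg, if_true] at g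
      have g' : (ω.ex ρ.nEx).2 = true := by
        by_contra h
        simp [h] at g
      refine ⟨⟨fun r hr' => ?_, ?_, hA, fun u hu' => ?_⟩, by simp⟩
      · rw [← hr r hr']
        simp only [State.setReg_reg]
        grind
      · simp [hx, e]
      · rw [e, errCount, Finset.sum_Ico_succ_top (by omega), ← hx, g', if_pos rfl]
        simp [hu u hu', errCount, hx]
    · refine hσ.congr fun r hr' => ?_
      simp only [State.setReg_reg]
      grind
    · simpa [e2] using hS
    · intro u hu'
      simpa [hu u hu'] using (errCount_le _ _ _ _ _ _ _).trans (by omega)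
    · simp only [State.setReg_reg, if_true] at g
      have g' : (ω.ex ρ.nEx).2 = false := by
        by_contra h
        simp [h] at g
      rintro τ ⟨t1, t2, t3, t4⟩
      refine ⟨⟨fun r hr' => ?_, ?_, fun A hA3 => ?_, fun u hu' => ?_⟩, ?_⟩
      · rw [← hr r hr', t1 r (by omega)]
        simp only [State.setReg_reg]
        grind
      · simp [t2, hx, e]
      · rw [t3 A hA3, ← hA A hA3]
        rfl
      · rw [e, errCount, Finset.sum_Ico_succ_top (by omega), ← hx, g', t4 u hu']
        simp [hu u hu', errCount, hx, e2]
      · rw [t1 12 (by omega)]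
        simp
  · rintro ρ ⟨hr, hx, hA, hu⟩
    exact ⟨hr, hA, fun u h => by rw [hu u h, Nat.sub_zero, two_mul]⟩

/-! ### Evaluating hypotheses -/

/-- Evaluate the disjunction of all terms with few errors at the current example. -/
def evalHyp : Prog :=
  .seq (.const 12 0) <| .seq (.add 14 7 4) <|
  .seq (forDown 14 <| .seq (.load 13 3 14) <| .seq (.mul 13 13 11) <| .seq (.add 24 9 9) <|
    .seq (.sub 13 13 24) <| .ite 13 .skip <| .seq termProg <| .add 12 12 15) <|
  .add 0 12 4

/-- Truncated subtraction decides whether a term is kept: the difference is 0 exactly when its error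
frequency is at most 2/E. Register 12 counts the kept terms that hold, and register 0, which stores
the dimension, is overwritten only at the end. -/
theorem run_evalHyp {n : ℕ} {ω : Source n} {P : Params} {X : ℕ} {σ : State n}
    (hP : P.Bounded X) (hσ : P.Stored σ) (hS : ∀ v, σ.arr 2 v ≤ X)
    (h3 : ∀ u < P.N, σ.arr 3 u ≤ P.m) :
    Run ω evalHyp σ ((P.N * (13 * P.d + 13) + 4) * opCost X) fun τ =>
      (τ.reg 0 ≠ 0 ↔ ∃ u < P.N, σ.arr 3 u * P.E ≤ 2 * P.m ∧
        termVal (σ.arr 2) P.R P.d u σ.cur = 1) := by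
  have hPb := hP
  have s4 := hσ.zero
  have s7 := hσ.N
  obtain ⟨hnX, hd, hR, hN, hq, hm, hr, hEX, hEm, hqmm, hqm, hq1, h2⟩ := hP
  refine Run.le (Run.seq <| Run.const (X := X) (by omega) <| Run.seq <|
    Run.add (X := X) (by simp; omega) (by simp; omega) <|
    Run.seq (T₁ := P.N * (((13 * P.d + 4) * opCost X + 7 * opCost X) + 2 * opCost X) + opCost X)
      (T₂ := opCost X) ?_) (by apply le_of_eq; ring)
  refine Run.forDown (X := X) (fun j ρ => ρ.reg 12 ≤ P.N - j ∧
    (∀ r < 12, ρ.reg r = σ.reg r) ∧ ρ.cur = σ.cur ∧ ρ.arr = σ.arr ∧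
    (ρ.reg 12 ≠ 0 ↔ ∃ u, j ≤ u ∧ u < P.N ∧ σ.arr 3 u * P.E ≤ 2 * P.m ∧
        termVal (σ.arr 2) P.R P.d u σ.cur = 1)) P.N hN (by omega)
    ?_ (by simp [s7, s4]) ?_ ?_ ?_
  · refine ⟨by simp, fun r hr => ?_, rfl, rfl, ?_⟩
    · simp only [State.setReg_reg]
      grind
    · simp
      omega
  · rintro j - ρ ⟨-, h, -⟩
    rw [h 3 (by omega), hσ.one]
  · rintro j hj ρ ⟨h12, hr, hc, ha, hiff⟩ h14
    have r9 := hr 9 (by omega)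
    have r11 := hr 11 (by omega)
    have s9 := hσ.m
    have s11 := hσ.E
    have b3 := h3 j hj
    have b3' : σ.arr 3 j * P.E ≤ X := by
      refine le_trans ?_ hEm
      rw [mul_comm]
      exact Nat.mul_le_mul_left _ b3
    -- The update of the count for both branches: `v` is 0 for a rejected term and the value of the
    -- term for a kept one.
    have hstep : ∀ v : ℕ, (v = 0 ∨ v = 1) →
        (v = 1 ↔ σ.arr 3 j * P.E ≤ 2 * P.m ∧ termVal (σ.arr 2) P.R P.d j σ.cur = 1) →
        (ρ.reg 12 + v ≠ 0 ↔ ∃ u, j ≤ u ∧ u < P.N ∧ σ.arr 3 u * P.E ≤ 2 * P.m ∧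
          termVal (σ.arr 2) P.R P.d u σ.cur = 1) := by
      intro v hv hv1
      constructor
      · intro h
        rcases hv with rfl | rfl
        · obtain ⟨u, h1, h2⟩ := hiff.1 (by simpa using h)
          exact ⟨u, by omega, h2⟩
        · exact ⟨j, le_rfl, hj, hv1.1 rfl⟩
      · rintro ⟨u, h1, h2⟩
        rcases h1.eq_or_lt with rfl | h1
        · rw [hv1.2 h2.2]
          omega
        · have := hiff.2 ⟨u, h1, h2⟩
          omega
    clear hiff
    refine Run.le (Run.seq <| Run.load (X := X) (by simp; omega) (by simp [ha]; omega) <|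
      Run.seq <| Run.mul (X := X) (by simp [ha]; omega) (by simp; omega) <|
      Run.seq <| Run.add (X := X) (by simp; omega) (by simp; omega) <|
      Run.seq <| Run.sub (X := X) (by simp [ha, r11, s11]; omega) (by simp; omega) <|
      Run.ite (X := X) (by simp [ha, r11, s11]; omega) (fun g => Run.skip (X := X) ?_)
      fun g => Run.seq <| Run.imp (run_termProg hPb ?_ ?_ ?_) ?_)
      (by apply le_of_eq; ring :
        opCost X + (opCost X + (opCost X + (opCost X + (opCost X + (opCost X +
          ((13 * P.d + 4) * opCost X + opCost X)))))) ≤ (13 * P.d + 4) * opCost X + 7 * opCost X)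
    · simp [ha, r11, s11, r9, s9] at g
      refine ⟨⟨?_, fun r hr' => ?_, hc, ha, ?_⟩, by simp⟩
      · simp
        omega
      · rw [← hr r hr']
        simp only [State.setReg_reg]
        grind
      · simpa using hstep 0 (by simp) (by simp; omega)
    · refine hσ.congr fun r hr' => ?_
      rw [← hr r hr']
      simp only [State.setReg_reg]
      grind
    · simpa [ha] using hS
    · simp
      omega
    · rintro τ ⟨t1, t2⟩
      simp [ha, r11, s11, r9, s9] at g
      simp [ha, hc] at t2
      have hl := termVal_le_one (σ.arr 2) P.R P.d j σ.cur
      have r12 : τ.reg 12 = ρ.reg 12 := by rw [t1.reg 12 (by omega)]; simp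
      refine Run.add (X := X) (by omega) (by omega) ?_
      refine ⟨⟨?_, fun r hr' => ?_, ?_, ?_, ?_⟩, ?_⟩
      · simp
        omega
      · rw [← hr r hr', State.setReg_reg, if_neg (by omega), t1.reg r (by omega)]
        simp only [State.setReg_reg]
        grind
      · simp [t1.cur, hc]
      · simp [t1.arr, ha]
      · rw [State.setReg_reg, if_pos rfl, r12, t2]
        exact hstep _ (by omega) (by simp; omega)
      · simp [t1.reg 14]
  · rintro ρ ⟨h12, hr, hc, ha, hiff⟩
    refine Run.add (X := X) (by omega) (by rw [hr 4 (by omega)]; omega) ?_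
    simp [hr 4, s4, hiff]

/-! ### The parameters of the algorithm -/

/-- The parameters for dimension `n`, size `s` and accuracy `1 / k`, where `g` and `a` are
constants. -/
def mkParams (g a n s k : ℕ) : Params :=
  let L := (s * k).size
  -- r = s·g·J with J = 2^a(sL)² bounds the number of variables in `s` terms of fewer than gJ
  -- variables.
  let r := g * 2 ^ a * s * (s * L) * (s * L)
  -- At most `s` terms with at least d variables each are satisfied with total probability at most
  -- s·2^-(L+2) ≤ 1/(4k).
  let d := g * (L + 2)
  let N := (r + 1) ^ d
  -- A kept term errs with probability at most 3/E, so N of them contribute at most 3/(16k).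
  let E := 16 * N * k
  -- Fixing at most r variables whose covariance with the target is at most 1/q costs less than 5r/q
  -- = 1/E, including the loss from long terms.
  let q := 5 * r * E
  -- For accuracy η = 1/(12q) the Hoeffding exponent 2mη² becomes exactly d·n.size + 5. The base is
  -- r + 1 because of the extra digit for a missing literal.
  { n := n, d := d, R := r + 1, N := N, q := q, m := 72 * ((d * n.size + 5) * q * q), r := r, E := E }

/-- `R[25] :=` the binary length of `R[12]`, provided that `R[25] = 0` and `R[13] = 2`. -/
def sizeProg : Prog := .loop 12 (.seq (.div 12 12 13) (.add 25 25 3))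

theorem size_div_two {v : ℕ} (hv : v ≠ 0) : v.size = (v / 2).size + 1 := by
  conv_lhs => rw [← Nat.bit_bodd_div2 v]
  rw [Nat.size_bit (by rwa [Nat.bit_bodd_div2]), Nat.div2_val]

theorem run_sizeProg {n : ℕ} {ω : Source n} {X : ℕ} {σ : State n} (h12 : σ.reg 12 ≤ X)
    (h13 : σ.reg 13 = 2) (h3 : σ.reg 3 = 1) (h25 : σ.reg 25 = 0) (hX : 2 ≤ X) :
    Run ω sizeProg σ ((3 * (σ.reg 12).size + 1) * opCost X) fun τ =>
      (∀ r, r ≠ 12 → r ≠ 25 → τ.reg r = σ.reg r) ∧ τ.arr = σ.arr ∧ τ.nEx = σ.nEx ∧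
      τ.reg 25 = (σ.reg 12).size := by
  have hsX : (σ.reg 12).size ≤ X := le_trans (Nat.size_le.2 Nat.lt_two_pow_self) h12
  refine (Run.loop (X := X) (T := 2 * opCost X) (fun j ρ =>
    (∀ r, r ≠ 12 → r ≠ 25 → ρ.reg r = σ.reg r) ∧ ρ.arr = σ.arr ∧ ρ.nEx = σ.nEx ∧
    ρ.reg 12 ≤ X ∧ (ρ.reg 12).size = j ∧ ρ.reg 25 + j = (σ.reg 12).size) (σ.reg 12).size
    ⟨fun _ _ _ => rfl, rfl, rfl, h12, rfl, by omega⟩ ?_ ?_ ?_).le (by apply le_of_eq; ring)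
  · rintro j - ρ ⟨-, -, -, h1, rfl, -⟩
    exact ⟨h1, Nat.size_eq_zero.symm⟩
  · rintro j hj ρ ⟨hr, ha, hE, hX', hs, h⟩
    have h0 : ρ.reg 12 ≠ 0 := by
      intro h0
      simp [h0] at hs
    have r13 := hr 13 (by omega) (by omega)
    have r3 := hr 3 (by omega) (by omega)
    refine Run.le (Run.seq <| Run.div (X := X) hX' (by omega) <|
      Run.add (X := X) (by simp; omega) (by simp; omega) ?_) (by omega)
    have := size_div_two h0
    refine ⟨fun r h1 h2 => ?_, ha, hE, ?_, ?_, ?_⟩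
    · rw [← hr r h1 h2]
      simp [h1, h2]
    · simp
      exact (Nat.div_le_self _ _).trans hX'
    · simp [r13, h13]
      omega
    · simp [r3, h3]
      omega
  · rintro ρ ⟨hr, ha, hE, -, -, h⟩
    exact ⟨hr, ha, hE, h⟩

/-- The first part of the computation of the parameters, up to `R`. -/
def setupR (g a : ℕ) : Prog :=
  .seq (.const 3 1) <| .seq (.const 13 2) <| .seq (.mul 12 1 2) <| .seq sizeProg <|
  .seq (.mul 26 25 1) <| .seq (.add 5 25 13) <| .seq (.const 13 g) <| .seq (.mul 5 13 5) <|
  .seq (.const 13 (g * 2 ^ a)) <| .seq (.mul 10 13 1) <| .seq (.mul 10 10 26) <|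
  .seq (.mul 10 10 26) <| .add 6 10 3

/-- `R[7] := R[6] ^ R[5]`. -/
def setupN : Prog :=
  .seq (.const 7 1) <| .seq (.add 12 5 4) <| forDown 12 (.mul 7 7 6)

/-- The rest of the computation of the parameters. -/
def setupM : Prog :=
  .seq (.const 13 16) <| .seq (.mul 11 13 7) <| .seq (.mul 11 11 2) <|
  .seq (.const 13 5) <| .seq (.mul 8 13 10) <| .seq (.mul 8 8 11) <|
  .seq (.const 13 2) <| .seq (.add 12 0 4) <| .seq (.const 25 0) <| .seq sizeProg <|
  .seq (.mul 25 5 25) <| .seq (.const 13 5) <| .seq (.add 25 25 13) <|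
  .seq (.mul 25 25 8) <| .seq (.mul 25 25 8) <| .seq (.const 13 72) <| .mul 9 13 25

/-- A stock of inequalities between the parameters and their partial products. The range checks of
the setup programs treat these products as atoms and reduce to linear arithmetic. -/
theorem mkParams_facts {g a n s k : ℕ} (hg : 1 ≤ g) (hn : 1 ≤ n) (hs : 1 ≤ s) (hk : 1 ≤ k) :
    let P := mkParams g a n s k
    let X := 3 * P.q * P.m * P.m + n
    P.Bounded X ∧ 72 ≤ X ∧ s * k ≤ X ∧ k ≤ X ∧ s * (s * k).size ≤ P.r ∧ (s * k).size + 2 ≤ P.d ∧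
      g ≤ P.d ∧ g * 2 ^ a ≤ P.r ∧ g * 2 ^ a * s ≤ P.r ∧ g * 2 ^ a * s * (s * (s * k).size) ≤ P.r ∧
      16 * P.N ≤ P.E ∧ 5 * P.r ≤ P.q ∧ P.d * n.size + 5 ≤ P.m ∧ (P.d * n.size + 5) * P.q ≤ P.m ∧
      (P.d * n.size + 5) * P.q * P.q ≤ P.m ∧ 1 ≤ P.d ∧ 1 ≤ P.N ∧ 1 ≤ P.m ∧
      (s * k).size ≤ s * (s * k).size ∧ P.q ≤ X ∧ P.m ≤ X ∧ P.r ≤ X ∧ s ≤ P.r := by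
  intro P X
  have hL : 1 ≤ (s * k).size := Nat.size_pos.2 (Nat.mul_pos hs hk)
  have hl : 1 ≤ n.size := Nat.size_pos.2 hn
  obtain ⟨L, hLe⟩ : ∃ L, L = (s * k).size := ⟨_, rfl⟩
  obtain ⟨l, hle⟩ : ∃ l, l = n.size := ⟨_, rfl⟩
  obtain ⟨H, hHe⟩ : ∃ H, H = g * 2 ^ a := ⟨_, rfl⟩
  obtain ⟨Y, hYe⟩ : ∃ Y, Y = s * L := ⟨_, rfl⟩
  have en : P.n = n := rfl
  have er : P.r = H * s * Y * Y := by rw [hYe, hHe, hLe]; rfl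
  have eR : P.R = P.r + 1 := rfl
  have ed : P.d = g * (L + 2) := by rw [hLe]; rfl
  have eN : P.N = (P.r + 1) ^ P.d := rfl
  have eE : P.E = 16 * P.N * k := rfl
  have eq : P.q = 5 * P.r * P.E := rfl
  have em : P.m = 72 * ((P.d * l + 5) * P.q * P.q) := by rw [hle]; rfl
  have eX : X = 3 * P.q * P.m * P.m + n := rfl
  rw [← hLe, ← hle, ← hHe, ← hYe]
  rw [← hLe] at hL
  rw [← hle] at hl
  clear_value P X
  have hH : 1 ≤ H := by
    rw [hHe]; exact Nat.mul_pos hg (Nat.two_pow_pos a)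
  have hY : 1 ≤ Y := by
    rw [hYe]; exact Nat.mul_pos hs hL
  have hLY : L ≤ Y := by
    rw [hYe]; exact Nat.le_mul_of_pos_left _ hs
  have r1 : H ≤ H * s := Nat.le_mul_of_pos_right _ hs
  have r2 : H * s ≤ H * s * Y := Nat.le_mul_of_pos_right _ hY
  have r3 : H * s * Y ≤ P.r := by
    rw [er]; exact Nat.le_mul_of_pos_right _ hY
  have r4 : Y ≤ H * s * Y := Nat.le_mul_of_pos_left _ (by omega)
  have r5 : s ≤ H * s := Nat.le_mul_of_pos_left _ hH
  have d1 : L + 2 ≤ P.d := by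
    rw [ed]; exact Nat.le_mul_of_pos_left _ hg
  have d2 : g ≤ P.d := by
    rw [ed]; exact Nat.le_mul_of_pos_right _ (by omega)
  have hN : P.r + 1 ≤ P.N := by
    rw [eN]; exact Nat.le_self_pow (by omega) _
  have hE : 16 * P.N ≤ P.E := by
    rw [eE]; exact Nat.le_mul_of_pos_right _ hk
  have hkE : k ≤ P.E := by
    rw [eE]; exact Nat.le_mul_of_pos_left _ (by omega)
  have q1 : 5 * P.r ≤ P.q := by
    rw [eq]; exact Nat.le_mul_of_pos_right _ (by omega)
  have q2 : P.E ≤ P.q := by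
    rw [eq]; exact Nat.le_mul_of_pos_left _ (by omega)
  have hsk : s * k ≤ P.q := by
    rw [eq]; exact Nat.mul_le_mul (by omega) hkE
  have m0 : P.d ≤ P.d * l := Nat.le_mul_of_pos_right _ hl
  have m1 : P.d * l + 5 ≤ (P.d * l + 5) * P.q := Nat.le_mul_of_pos_right _ (by omega)
  have m2 : (P.d * l + 5) * P.q ≤ (P.d * l + 5) * P.q * P.q :=
    Nat.le_mul_of_pos_right _ (by omega)
  have m3 : P.q ≤ (P.d * l + 5) * P.q := Nat.le_mul_of_pos_left _ (by omega)
  have hEm : P.E * P.m ≤ P.q * P.m := Nat.mul_le_mul_right _ q2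
  have hqm : P.q * P.m ≤ P.q * P.m * P.m := Nat.le_mul_of_pos_right _ (by omega)
  have hqm' : P.m ≤ P.q * P.m := Nat.le_mul_of_pos_left _ (by omega)
  have e3 : 3 * P.q * P.m * P.m = 3 * (P.q * P.m * P.m) := by ring
  have e2 : 2 * P.q * P.m = 2 * (P.q * P.m) := by ring
  rw [e3] at eX
  refine ⟨⟨?_, ?_, ?_, ?_, ?_, ?_, ?_, ?_, ?_, ?_, ?_, ?_, ?_⟩, ?_, ?_, ?_, ?_, ?_, ?_, ?_, ?_,
    ?_, ?_, ?_, ?_, ?_, ?_, ?_, ?_, ?_, ?_, ?_, ?_, ?_, ?_⟩ <;> omega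

theorem run_setupR {n : ℕ} {ω : Source n} {g a s k X : ℕ} (hg : 1 ≤ g) (hn : 1 ≤ n)
    (hs : 1 ≤ s) (hk : 1 ≤ k) (hX : X = 3 * (mkParams g a n s k).q * (mkParams g a n s k).m *
      (mkParams g a n s k).m + n) :
    Run ω (setupR g a) (initState n s k) ((3 * (s * k).size + 13) * opCost X) fun τ =>
      (∀ r, r < 3 ∨ r = 4 ∨ r = 20 → τ.reg r = (initState n s k).reg r) ∧ τ.reg 3 = 1 ∧
      τ.reg 5 = (mkParams g a n s k).d ∧ τ.reg 6 = (mkParams g a n s k).R ∧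
      τ.reg 10 = (mkParams g a n s k).r ∧ τ.arr = (initState n s k).arr ∧ τ.nEx = 0 := by
  obtain ⟨⟨h1, h2, h3, h4, h5, h6, h7, h8, h9, h10, h11, h12, h13⟩, f1, f2, f3, f4, f5, f6, f7,
    f8, f9, f10, f11, f12, f13, f14, f15, f16, f17, f18, f19, f20, f21, f22⟩ :=
    mkParams_facts (a := a) hg hn hs hk
  rw [← hX] at *
  have i1 : (initState n s k).reg 1 = s := rfl
  have i2 : (initState n s k).reg 2 = k := rfl
  have i25 : (initState n s k).reg 25 = 0 := rfl
  refine Run.le (Run.seq <| Run.const (X := X) (by omega) <|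
    Run.seq <| Run.const (X := X) (by omega) <|
    Run.seq <| Run.mul (X := X) (by simp; omega) (by simp; omega) <|
    Run.seq <| Run.imp (run_sizeProg (X := X) (by simp [i1, i2]; omega) (by simp) (by simp)
      (by simp [i25]) (by omega)) ?_)
    (by apply le_of_eq; simp [i1, i2]; ring :
      _ + (_ + (_ + (_ + 9 * opCost X))) ≤ (3 * (s * k).size + 13) * opCost X)
  rintro τ ⟨t1, t2, t3, t4⟩
  simp [i1, i2] at t4
  have r1 : τ.reg 1 = s := by simp [t1, i1]
  have r3 : τ.reg 3 = 1 := by simp [t1]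
  have r13 : τ.reg 13 = 2 := by simp [t1]
  refine Run.le (Run.seq <| Run.mul (X := X) (by omega) (by omega) <|
    Run.seq <| Run.add (X := X) (by simp; omega) (by simp; omega) <|
    Run.seq <| Run.const (X := X) (by omega) <|
    Run.seq <| Run.mul (X := X) (by simp; omega) (by simp; omega) <|
    Run.seq <| Run.const (X := X) (by omega) <|
    Run.seq <| Run.mul (X := X) (by simp; omega) (by simp; omega) <|
    Run.seq <| Run.mul (X := X) (by simp [r1]; omega) (by simp [t4, r1, mul_comm _ s]; omega) <|
    Run.seq <| Run.mul (X := X) (by simp [t4, r1, mul_comm _ s] at f9 ⊢; omega)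
      (by simp [t4, r1, mul_comm _ s]; omega) <|
    Run.add (X := X) ?_ (by simp; omega) ?_) (by omega)
  · simp [t4, r1, mul_comm (s * k).size s]
    exact f21
  · refine ⟨fun r hr => ?_, ?_, ?_, ?_, ?_, ?_, ?_⟩
    · rcases hr with hr | rfl | rfl
      · have : τ.reg r = (initState n s k).reg r := by
          rw [t1 r (by omega) (by omega)]
          simp
          grind
        rw [← this]
        simp
        grind
      · simp [t1]
      · simp [t1]
    · simp [r3]
    · simp [t4, r13, mkParams]
    · simp [t4, r1, r3, mul_comm (s * k).size s, mkParams]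
    · simp [t4, r1, r3, mul_comm (s * k).size s, mkParams]
    · simp [t2]
    · simp [t3, initState]

theorem run_setupN {n : ℕ} {ω : Source n} {R d X : ℕ} {σ : State n} (h6 : σ.reg 6 = R)
    (h5 : σ.reg 5 = d) (h4 : σ.reg 4 = 0) (h3 : σ.reg 3 = 1) (hR : 1 ≤ R) (hRX : R ≤ X)
    (hX : 1 ≤ X) (hd : d ≤ X) (hN : R ^ d ≤ X) :
    Run ω setupN σ ((3 * d + 3) * opCost X) fun τ =>
      (∀ r, r ≠ 7 → r ≠ 12 → τ.reg r = σ.reg r) ∧ τ.arr = σ.arr ∧ τ.nEx = σ.nEx ∧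
      τ.reg 7 = R ^ d := by
  refine Run.le (Run.seq <| Run.const (X := X) (by omega) <|
    Run.seq (T₂ := d * (opCost X + 2 * opCost X) + opCost X) <|
    Run.add (X := X) (by simp; omega) (by simp; omega) ?_) (by apply le_of_eq; ring)
  refine Run.forDown (X := X) (fun j ρ =>
    (∀ r, r ≠ 7 → r ≠ 12 → ρ.reg r = σ.reg r) ∧ ρ.arr = σ.arr ∧ ρ.nEx = σ.nEx ∧
      ρ.reg 7 = R ^ (d - j)) d hd hX ⟨fun r h1 h2 => by simp [h1, h2], rfl, rfl, by simp⟩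
      (by simp [h4, h5]) (fun j _ ρ h => by rw [h.1 3 (by omega) (by omega), h3]) ?_
      (fun ρ h => by simpa using h)
  rintro j hj ρ ⟨hr, ha, hx, h7⟩ h12
  have e : d - j = d - (j + 1) + 1 := by omega
  have r6 := hr 6 (by omega) (by omega)
  have hp : R ^ (d - (j + 1)) ≤ X := (Nat.pow_le_pow_right hR (by omega)).trans hN
  refine Run.mul (X := X) (by simp; omega) (by simp; omega) ?_
  refine ⟨⟨fun r h1 h2 => ?_, ha, hx, ?_⟩, by simp⟩
  · rw [← hr r h1 h2]
    simp [h1, h2]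
  · simp [h7, r6, h6, e, pow_succ]

theorem run_setupM {n : ℕ} {ω : Source n} {g a s k X : ℕ} (hg : 1 ≤ g) (hn : 1 ≤ n)
    (hs : 1 ≤ s) (hk : 1 ≤ k) (hX : X = 3 * (mkParams g a n s k).q * (mkParams g a n s k).m *
      (mkParams g a n s k).m + n) {σ : State n} (h0 : σ.reg 0 = n) (h2' : σ.reg 2 = k)
    (h3' : σ.reg 3 = 1) (h4' : σ.reg 4 = 0) (h5' : σ.reg 5 = (mkParams g a n s k).d)
    (h6' : σ.reg 6 = (mkParams g a n s k).R) (h7' : σ.reg 7 = (mkParams g a n s k).N)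
    (h10' : σ.reg 10 = (mkParams g a n s k).r) :
    Run ω setupM σ ((3 * n.size + 17) * opCost X) fun τ =>
      (mkParams g a n s k).Stored τ ∧ τ.arr = σ.arr ∧ τ.nEx = σ.nEx ∧ τ.reg 20 = σ.reg 20 := by
  obtain ⟨⟨h1, h2, h3, h4, h5, h6, h7, h8, h9, h10, h11, h12, h13⟩, f1, f2, f3, f4, f5, f6, f7,
    f8, f9, f10, f11, f12, f13, f14, f15, f16, f17, f18, f19, f20, f21, f22⟩ :=
    mkParams_facts (a := a) hg hn hs hk
  rw [← hX] at *
  have eE : (mkParams g a n s k).E = 16 * (mkParams g a n s k).N * k := rfl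
  have eq : (mkParams g a n s k).q = 5 * (mkParams g a n s k).r * (mkParams g a n s k).E := rfl
  have em : (mkParams g a n s k).m = 72 * (((mkParams g a n s k).d * n.size + 5) *
    (mkParams g a n s k).q * (mkParams g a n s k).q) := rfl
  have en : (mkParams g a n s k).n = n := rfl
  generalize mkParams g a n s k = P at *
  have hsz : P.d * n.size ≤ X := by omega
  have hnsz : n.size ≤ P.d * n.size := Nat.le_mul_of_pos_left _ (by omega)
  refine Run.le (Run.seq <| Run.const (X := X) (by omega) <|
    Run.seq <| Run.mul (X := X) (by simp; omega) (by simp; omega) <|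
    Run.seq <| Run.mul (X := X) (by simp; omega) (by simp; omega) <|
    Run.seq <| Run.const (X := X) (by omega) <|
    Run.seq <| Run.mul (X := X) (by simp; omega) (by simp; omega) <|
    Run.seq <| Run.mul (X := X) (by simp; omega) (by simp [h7', h2', ← eE]; omega) <|
    Run.seq <| Run.const (X := X) (by omega) <|
    Run.seq <| Run.add (X := X) (by simp; omega) (by simp; omega) <|
    Run.seq <| Run.const (X := X) (by omega) <|
    Run.seq (T₂ := 7 * opCost X) <| Run.imp (run_sizeProg (X := X) (by simp; omega) (by simp) (by simpa using h3')
      (by simp) (by omega)) ?_)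
    (by apply le_of_eq; simp [h0, h4']; ring)
  rintro τ ⟨t1, t2, t3, t4⟩
  simp [h0, h4'] at t4
  have r8 : τ.reg 8 = P.q := by simp [t1, h10', h7', h2', ← eE, ← eq]
  have r5 : τ.reg 5 = P.d := by simp [t1, h5']
  have r3 : τ.reg 3 = 1 := by simp [t1, h3']
  refine Run.le (Run.seq <| Run.mul (X := X) (by omega) (by omega) <|
    Run.seq <| Run.const (X := X) (by omega) <|
    Run.seq <| Run.add (X := X) (by simp [r5, t4]; omega) (by simp; omega) <|
    Run.seq <| Run.mul (X := X) (by simp [r5, t4]; omega) (by simp; omega) <|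
    Run.seq <| Run.mul (X := X) (by simp [r5, t4, r8]; omega) (by simp; omega) <|
    Run.seq <| Run.const (X := X) (by omega) <|
    Run.mul (X := X) (by simp; omega) (by simp [r5, t4, r8]; omega) ?_) (by omega)
  refine ⟨?_, by simp [t2], by simp [t3], by simp [t1]⟩
  constructor
  · simp [t1, h0, en]
  · simp [r3]
  · simp [t1, h4']
  · simp [r5]
  · simp [t1, h6']
  · simp [t1, h7']
  · simp [r8]
  · simp [r5, t4, r8, em]
  · simp [t1, h10']
  · simp [t1, h7', h2', eE]

/-! ### The learner -/

/-- The learning algorithm; `g` and `a` are constants. -/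
def learner (g a : ℕ) : Learner where
  learn := .seq (setupR g a) <| .seq setupN <| .seq setupM <| .seq collect <| .seq select <|
    countErrors
  eval := evalHyp

/-- The hypothesis represented by the table `S` of literals and the numbers `C` of errors. -/
def hypothesis (P : Params) (n : ℕ) (S C : ℕ → ℕ) : Concept n := fun x =>
  decide (∃ u < P.N, C u * P.E ≤ 2 * P.m ∧ termVal S P.R P.d u x = 1)

/-- A bound for the numbers in the computation. -/
def Params.numBound (P : Params) : ℕ := 3 * P.q * P.m * P.m + P.n

/-- A bound for the running time. -/
def Params.time (P : Params) : ℕ := 150 * (P.m * P.n * P.N * P.d * opCost P.numBound)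

/-- The long sum collects the costs of the stages of the learner. All factors are at least 1, so
every monomial is below m·n·N·d·u, and the coefficients add up to less than 150. -/
theorem time_bounds {n m N d l L u : ℕ} (hn : 1 ≤ n) (hm : 1 ≤ m) (hN : 1 ≤ N) (hd : 1 ≤ d)
    (hu : 1 ≤ u) (hl : l ≤ n) (hL : L ≤ d) :
    (3 * L + 13) * u + ((3 * d + 3) * u + ((3 * l + 17) * u +
      ((m * (1 + n + (10 * n + 6) * u) + 2 * u) + ((20 * n + 3) * u +
      (m * (1 + n + (N * (13 * d + 9) + 7) * u) + 2 * u))))) ≤ 150 * (m * n * N * d * u) ∧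
    (N * (13 * d + 13) + 4) * u ≤ 150 * (m * n * N * d * u) := by
  have key : ∀ m' n' N' d' u', m' ≤ m → n' ≤ n → N' ≤ N → d' ≤ d → u' ≤ u →
      m' * n' * N' * d' * u' ≤ m * n * N * d * u := by
    intro m' n' N' d' u' h1 h2 h3 h4 h5
    gcongr
  have k1 := key 1 1 1 1 u hm hn hN hd le_rfl
  have k2 := key 1 1 1 d u hm hn hN le_rfl le_rfl
  have k3 := key 1 n 1 1 u hm le_rfl hN hd le_rfl
  have k4 := key m 1 1 1 1 le_rfl hn hN hd hu
  have k5 := key m n 1 1 1 le_rfl le_rfl hN hd hu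
  have k6 := key m n 1 1 u le_rfl le_rfl hN hd le_rfl
  have k7 := key m 1 1 1 u le_rfl hn hN hd le_rfl
  have k8 := key m 1 N 1 u le_rfl hn le_rfl hd le_rfl
  have k9 := key m 1 N d u le_rfl hn le_rfl le_rfl le_rfl
  have k10 := key 1 1 N d u hm hn le_rfl le_rfl le_rfl
  have k11 := key 1 1 N 1 u hm hn le_rfl hd le_rfl
  have h1 : L * u ≤ d * u := Nat.mul_le_mul_right _ hL
  have h2 : l * u ≤ n * u := Nat.mul_le_mul_right _ hl
  constructor <;> nlinarith

/-- This holds for every source, which gives unconditional halting. The order of the entries of `S`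
is irrelevant later, so only `Lists` is recorded. -/
theorem learner_outputs {n g a s k : ℕ} (hg : 1 ≤ g) (hn : 1 ≤ n) (hs : 1 ≤ s) (hk : 1 ≤ k)
    (ω : Source n) {T : ℝ} (hT : ((mkParams g a n s k).time : ℝ) ≤ T) :
    let P := mkParams g a n s k
    ∃ S : ℕ → ℕ, Lists S n P.r (fun i => CovTest P (countLabel ω 0 P.m) (countVar ω 0 P.m i)
        (countVarLabel ω 0 P.m i)) ∧
      (learner g a).Outputs s k ω T
        (hypothesis P n S fun u => errCount ω S P.R P.d P.m (2 * P.m) u) := by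
  intro P
  obtain ⟨hP, -, -, -, -, hL, -, -, -, -, -, -, -, -, -, hd, hN, hm, -, -, -, -⟩ :=
    mkParams_facts (a := a) hg hn hs hk
  set X := 3 * (mkParams g a n s k).q * (mkParams g a n s k).m * (mkParams g a n s k).m + n with hX
  have hRX := hP.R
  have hnX : n ≤ X := hP.n
  have hR : 1 ≤ P.R := Nat.succ_le_of_lt (Nat.zero_lt_of_lt hP.r)
  have h2X := hP.two
  have hu : 1 ≤ opCost X := one_le_opCost
  have hl : n.size ≤ n := Nat.size_le.2 Nat.lt_two_pow_self
  have htime := time_bounds (n := n) hn hm hN hd hu hl ((Nat.le_add_right _ 2).trans hL)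
  have hrun : Run ω (learner g a).learn (initState n s k) P.time fun τ =>
      P.Stored τ ∧ Lists (τ.arr 2) n P.r (fun i => CovTest P (countLabel ω 0 P.m)
        (countVar ω 0 P.m i) (countVarLabel ω 0 P.m i)) ∧
        ∀ u < P.N, τ.arr 3 u = errCount ω (τ.arr 2) P.R P.d P.m (2 * P.m) u := by
    refine Run.le (Run.seq <| Run.imp (run_setupR (a := a) hg hn hs hk hX) ?_) htime.1
    rintro σ₁ ⟨a1, a2, a3, a4, a5, a6, a7⟩
    have hr0 : σ₁.reg 0 = n := a1 0 (by omega)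
    have hr2 : σ₁.reg 2 = k := a1 2 (by omega)
    have hr4 : σ₁.reg 4 = 0 := a1 4 (by omega)
    have hr20 : σ₁.reg 20 = 0 := a1 20 (by omega)
    refine Run.seq <| Run.imp (run_setupN a4 a3 hr4 a2 hR hRX (by omega) hP.d hP.N) ?_
    rintro σ₂ ⟨b1, b2, b3, b4⟩
    refine Run.seq <| Run.imp (run_setupM (a := a) hg hn hs hk hX (by rw [b1 0, hr0] <;> omega)
      (by rw [b1 2, hr2] <;> omega) (by rw [b1 3, a2] <;> omega) (by rw [b1 4, hr4] <;> omega)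
      (by rw [b1 5, a3] <;> omega) (by rw [b1 6, a4] <;> omega) b4
      (by rw [b1 10, a5] <;> omega)) ?_
    rintro σ₃ ⟨c1, c2, c3, c4⟩
    have harr : ∀ A i, σ₃.arr A i = 0 := fun A i => by rw [c2, b2, a6]; rfl
    refine Run.seq <| Run.imp (run_collect hP rfl c1 harr (by rw [c4, b1 20, hr20] <;> omega)
      (by rw [c3, b3, a7])) ?_
    rintro σ₄ ⟨d1, d2, d3, d4, d5, d6⟩
    have hσ₄ := c1.congr d1
    refine Run.seq <| Run.imp (run_select hP hσ₄ (fun i => by rw [d4]; exact countVar_le _ _ _)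
      (fun i => by rw [d5]; exact countVarLabel_le _ _ _) (by rw [d3]; exact countLabel_le _ _)
      (d6 2 le_rfl)) ?_
    rintro σ₅ ⟨e1, e2, e3, e4⟩
    simp only [d3, d4, d5] at e4
    have hσ₅ := hσ₄.congr e1
    refine Run.imp (run_countErrors hP hσ₅ (fun v => ?_) (fun u => ?_) (by rw [e2, d2])) ?_
    · by_cases hv : σ₅.arr 2 v = 0
      · omega
      · have : σ₅.arr 2 v - 1 < n := (e4.sound v hv).2.1
        omega
    · rw [e3 3 (by omega), d6 3 (by omega)]
    · rintro τ ⟨f1, f2, f3⟩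
      rw [f2 2 (by omega)]
      exact ⟨hσ₅.congr f1, e4, f3⟩
  obtain ⟨t, τ, h1, h2, h3, h4, h5⟩ := hrun
  refine ⟨τ.arr 2, h4, τ, ⟨t, h1, le_trans (by exact_mod_cast h2) hT⟩, fun x => ?_⟩
  have hev := run_evalHyp (ω := blankSource n) (P := P) (X := X)
    (σ := { τ with cur := x, lab := false, nEx := 0, nCoin := 0 }) hP
    (h3.congr fun _ _ => rfl) (fun v => ?_) (fun u hu => ?_)
  · obtain ⟨t', ρ, g1, g2, g3⟩ := hev
    refine ⟨ρ, ⟨t', g1, le_trans (by exact_mod_cast g2.trans htime.2) hT⟩, ?_⟩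
    rw [g3]
    simp only [hypothesis, decide_eq_true_eq]
    refine exists_congr fun u => and_congr_right fun hu => ?_
    rw [h5 u hu]
  · change τ.arr 2 v ≤ X
    by_cases hv : τ.arr 2 v = 0
    · omega
    · have : τ.arr 2 v - 1 < n := (h4.sound v hv).2.1
      omega
  · change τ.arr 3 u ≤ P.m
    rw [h5 u hu]
    exact (errCount_le _ _ _ _ _ _ _).trans (by omega)

/-! ### Resampling a coordinate -/

/-- Under `ν` the coordinate `i` is independent of the others and true with probability `p i`. -/
def Resamples {n : ℕ} (ν : Measure (Cube n)) (p : Fin n → ℝ) : Prop :=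
  ∀ i (A : Set (Cube n)), ν.real A = p i * ν.real {x | Function.update x i true ∈ A} +
    (1 - p i) * ν.real {x | Function.update x i false ∈ A}

theorem biasedBit_apply (m : Set.Ioo (-1 : ℝ) 1) (s : Set Bool) :
    biasedBit m s = ENNReal.ofReal ((1 + (m : ℝ)) / 2) * s.indicator 1 true +
      ENNReal.ofReal ((1 - (m : ℝ)) / 2) * s.indicator 1 false := by
  simp [biasedBit]

/-- Conditioning on the coordinate `i`. It suffices to compare boxes: fixing that coordinate pulls a
box back to the box with its `i`-th side freed, or to the empty set. -/
theorem pi_biasedBit_eq {n : ℕ} (μ : Fin n → Set.Ioo (-1 : ℝ) 1) (i : Fin n) :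
    Measure.pi (fun i => biasedBit (μ i)) =
      ENNReal.ofReal ((1 + (μ i : ℝ)) / 2) •
        (Measure.pi fun i => biasedBit (μ i)).map (fun x => Function.update x i true) +
      ENNReal.ofReal ((1 - (μ i : ℝ)) / 2) •
        (Measure.pi fun i => biasedBit (μ i)).map (fun x => Function.update x i false) := by
  classical
  refine Measure.pi_eq fun s hs => ?_
  have hup : ∀ b, (fun x : Cube n => Function.update x i b) ⁻¹' (Set.univ.pi s) =
      if b ∈ s i then Set.univ.pi (Function.update s i Set.univ) else ∅ := by
    intro b
    ext x
    simp only [Set.mem_preimage, Set.mem_pi, Set.mem_univ, true_imp_iff]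
    split_ifs with hb
    · simp only [Set.mem_pi, Set.mem_univ, true_imp_iff]
      refine forall_congr' fun j => ?_
      by_cases hj : j = i
      · subst hj
        simp [hb]
      · simp [hj]
    · simp only [Set.mem_empty_iff_false, iff_false]
      intro h
      exact hb (by simpa using h i)
  have hprod : (Measure.pi fun i => biasedBit (μ i)) (Set.univ.pi (Function.update s i Set.univ)) =
      ∏ j ∈ Finset.univ.erase i, biasedBit (μ j) (s j) := by
    rw [Measure.pi_pi, ← Finset.mul_prod_erase _ _ (Finset.mem_univ i)]
    simp only [Function.update_self, measure_univ, one_mul]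
    refine Finset.prod_congr rfl fun j hj => ?_
    rw [Function.update_of_ne (Finset.ne_of_mem_erase hj)]
  rw [← Finset.mul_prod_erase _ _ (Finset.mem_univ i), biasedBit_apply, ← hprod]
  simp only [Measure.coe_add, Measure.coe_smul, Pi.add_apply, Pi.smul_apply, smul_eq_mul]
  rw [Measure.map_apply (.of_discrete) (.of_discrete),
    Measure.map_apply (.of_discrete) (.of_discrete), hup, hup, add_mul]
  congr 1
  · split_ifs with h <;> simp [h]
  · split_ifs with h <;> simp [h]

theorem resamples_productDist {n : ℕ} (μ : Fin n → Set.Ioo (-1 : ℝ) 1) :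
    Resamples (productDist μ : Measure (Cube n)) fun i => (1 + (μ i : ℝ)) / 2 := by
  intro i A
  have h1 := (μ i).2.1
  have h2 := (μ i).2.2
  change (Measure.pi fun i => biasedBit (μ i)).real A = _ * (Measure.pi fun i => biasedBit (μ i)).real _ +
    _ * (Measure.pi fun i => biasedBit (μ i)).real _
  conv_lhs => rw [pi_biasedBit_eq μ i]
  have hfin : ∀ (r : ℝ) (m : Measure (Cube n)) [IsFiniteMeasure m],
      (ENNReal.ofReal r • m) A ≠ ⊤ := fun r m _ =>
    (ENNReal.mul_lt_top ENNReal.ofReal_lt_top (measure_lt_top m A)).ne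
  rw [measureReal_add_apply (hfin _ _) (hfin _ _), measureReal_ennreal_smul_apply, measureReal_ennreal_smul_apply,
    map_measureReal_apply .of_discrete .of_discrete, map_measureReal_apply .of_discrete .of_discrete,
    ENNReal.toReal_ofReal (by linarith), ENNReal.toReal_ofReal (by linarith)]
  congr 2
  ring

/-! ### Monotone DNF expressions -/

/-- The points that satisfy a monotone term. -/
def termSet {n : ℕ} (t : Finset (Fin n)) : Set (Cube n) := {x | ∀ i ∈ t, x i = true}

/-- The points that satisfy a monotone DNF expression. -/
def dnfSet {n : ℕ} (T : Finset (Finset (Fin n))) : Set (Cube n) := {x | ∃ t ∈ T, x ∈ termSet t}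

/-- Substitute a truth value for a variable. -/
def restrict {n : ℕ} (T : Finset (Finset (Fin n))) (i : Fin n) (b : Bool) :
    Finset (Finset (Fin n)) :=
  if b then T.image fun t => t.erase i else T.filter fun t => i ∉ t

/-- The covariance of the variable `i` with (the indicator of) `A`. -/
def cov {n : ℕ} (ν : Measure (Cube n)) (p : Fin n → ℝ) (i : Fin n) (A : Set (Cube n)) : ℝ :=
  ν.real (A ∩ {x | x i = true}) - p i * ν.real A

theorem card_restrict_le {n : ℕ} (T : Finset (Finset (Fin n))) (i : Fin n) (b : Bool) :
    (restrict T i b).card ≤ T.card := by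
  cases b
  · exact Finset.card_filter_le _ _
  · exact Finset.card_image_le

theorem exists_of_mem_restrict {n : ℕ} {T : Finset (Finset (Fin n))} {i : Fin n} {b : Bool}
    {t : Finset (Fin n)} (h : t ∈ restrict T i b) : ∃ t' ∈ T, t ⊆ t'.erase i := by
  cases b
  · simp only [restrict, Bool.false_eq_true, if_false, Finset.mem_filter] at h
    exact ⟨t, h.1, by rw [Finset.erase_eq_of_notMem h.2]⟩
  · simp only [restrict, if_true, Finset.mem_image] at h
    obtain ⟨t', h1, rfl⟩ := h
    exact ⟨t', h1, subset_rfl⟩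

theorem update_mem_termSet_true {n : ℕ} {t : Finset (Fin n)} {i : Fin n} {x : Cube n} :
    Function.update x i true ∈ termSet t ↔ x ∈ termSet (t.erase i) := by
  simp only [termSet, Set.mem_ofPred_eq, Finset.mem_erase]
  grind [Function.update_apply]

theorem update_mem_termSet_false {n : ℕ} {t : Finset (Fin n)} {i : Fin n} {x : Cube n} :
    Function.update x i false ∈ termSet t ↔ i ∉ t ∧ x ∈ termSet t := by
  simp only [termSet, Set.mem_ofPred_eq]
  grind [Function.update_apply]

theorem update_mem_dnfSet {n : ℕ} {T : Finset (Finset (Fin n))} {i : Fin n} {b : Bool}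
    {x : Cube n} : Function.update x i b ∈ dnfSet T ↔ x ∈ dnfSet (restrict T i b) := by
  cases b
  · simp [dnfSet, restrict, update_mem_termSet_false, and_assoc]
  · simp [dnfSet, restrict, update_mem_termSet_true]

/-- Monotonicity enters here: the probability that the variable matters becomes a difference of two
probabilities, and is therefore visible in the covariance. -/
theorem dnfSet_restrict_subset {n : ℕ} (T : Finset (Finset (Fin n))) (i : Fin n) :
    dnfSet (restrict T i false) ⊆ dnfSet (restrict T i true) := by
  rintro x ⟨t, ht, hx⟩
  simp only [restrict, Bool.false_eq_true, if_false, Finset.mem_filter] at ht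
  refine ⟨t.erase i, by simp only [restrict, if_true]; exact Finset.mem_image_of_mem _ ht.1, ?_⟩
  exact fun j hj => hx j (Finset.mem_of_mem_erase hj)

/-! ### Covariances and restrictions under a product measure -/

section Measure

variable {n : ℕ} {ν : Measure (Cube n)} {p : Fin n → ℝ}

theorem cov_eq (hν : Resamples ν p) (i : Fin n) (A : Set (Cube n)) :
    cov ν p i A = p i * (1 - p i) * (ν.real {x | Function.update x i true ∈ A} -
      ν.real {x | Function.update x i false ∈ A}) := by
  rw [cov, hν i (A ∩ _), hν i A]
  simp
  ring

/-- Resampling `i` does not touch the event x_j = 1. This keeps the covariances of the remaining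
variables under control, on average, while variables are fixed one by one. -/
theorem cov_average (hν : Resamples ν p) {i j : Fin n} (hij : i ≠ j) (A : Set (Cube n)) :
    cov ν p j A = p i * cov ν p j {x | Function.update x i true ∈ A} +
      (1 - p i) * cov ν p j {x | Function.update x i false ∈ A} := by
  simp only [cov]
  rw [hν i (A ∩ _), hν i A]
  simp only [Set.mem_ofPred_eq, Function.update_of_ne hij.symm, Set.inter_def]
  ring

variable [IsProbabilityMeasure ν]

theorem measureReal_termSet_le (hν : Resamples ν p) {ρ : ℝ} (hρ : 0 ≤ ρ) (hp : ∀ i, p i ≤ ρ)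
    (t : Finset (Fin n)) : ν.real (termSet t) ≤ ρ ^ t.card := by
  induction t using Finset.induction_on with
  | empty => simp [measureReal_le_one]
  | insert i t hi ih =>
    rw [hν i, Finset.card_insert_of_notMem hi, pow_succ']
    have e1 : {x : Cube n | Function.update x i true ∈ termSet (insert i t)} = termSet t := by
      ext x
      rw [Set.mem_ofPred_eq, update_mem_termSet_true, Finset.erase_insert hi]
    have e2 : {x : Cube n | Function.update x i false ∈ termSet (insert i t)} = ∅ := by
      ext x
      simp [update_mem_termSet_false]
    rw [e1, e2, measureReal_empty, mul_zero, add_zero]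
    exact mul_le_mul (hp i) ih measureReal_nonneg hρ

/-- A union bound over the terms, each of probability at most ρ^(gJ) ≤ 2^-J. -/
theorem measureReal_dnfSet_filter_le (hν : Resamples ν p) {ρ : ℝ} (hρ : 0 ≤ ρ) (hρ1 : ρ ≤ 1)
    (hp : ∀ i, p i ≤ ρ) {g J s : ℕ} (hg : ρ ^ g ≤ 1 / 2) {T : Finset (Finset (Fin n))}
    (hT : T.card ≤ s) (hJ : ∀ t ∈ T, g * J ≤ t.card) : ν.real (dnfSet T) ≤ s * (1 / 2) ^ J := by
  have e : dnfSet T = ⋃ t ∈ T, termSet t := by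
    ext x
    simp [dnfSet]
  rw [e]
  refine (measureReal_biUnion_finset_le _ _).trans ?_
  calc ∑ t ∈ T, ν.real (termSet t) ≤ ∑ t ∈ T, (1 / 2 : ℝ) ^ J := by
        refine Finset.sum_le_sum fun t ht => (measureReal_termSet_le hν hρ hp t).trans ?_
        refine (pow_le_pow_of_le_one hρ hρ1 (hJ t ht)).trans ?_
        rw [pow_mul]
        exact pow_le_pow_left₀ (by positivity) hg _
    _ = T.card * (1 / 2) ^ J := by simp
    _ ≤ _ := by gcongr

/-- Variables with small covariances can be replaced by suitable constants. -/
theorem exists_restriction (hν : Resamples ν p) (hp0 : ∀ i, 0 ≤ p i) (hp1 : ∀ i, p i ≤ 1)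
    (U : Finset (Fin n)) : ∀ T : Finset (Finset (Fin n)), ∃ T' : Finset (Finset (Fin n)),
      T'.card ≤ T.card ∧ (∀ t' ∈ T', ∃ t ∈ T, t' ⊆ t \ U) ∧
      ν.real (symmDiff (dnfSet T) (dnfSet T')) ≤ ∑ i ∈ U, 2 * cov ν p i (dnfSet T) := by
  induction U using Finset.induction_on with
  | empty => exact fun T => ⟨T, le_rfl, fun t ht => ⟨t, ht, by simp⟩, by simp⟩
  | insert i U hi ih =>
    intro T
    have hA : ∀ b, {x | Function.update x i b ∈ dnfSet T} = dnfSet (restrict T i b) := by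
      intro b
      ext x
      exact update_mem_dnfSet
    set A := dnfSet T with hAdef
    set A₁ := dnfSet (restrict T i true) with hA1
    set A₀ := dnfSet (restrict T i false) with hA0
    have hsub : A₀ ⊆ A₁ := dnfSet_restrict_subset T i
    have hup : ∀ b c, {x | Function.update x i c ∈ dnfSet (restrict T i b)} =
        dnfSet (restrict T i b) := by
      intro b c
      rw [← hA b]
      ext x
      simp
    have hsymm : ν.real (symmDiff A₁ A₀) = ν.real A₁ - ν.real A₀ := by
      rw [symmDiff_of_ge hsub, measureReal_sdiff hsub .of_discrete]
    have h1 : ν.real (symmDiff A A₁) = (1 - p i) * ν.real (symmDiff A₁ A₀) := by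
      rw [hν i]
      have e1 : {x | Function.update x i true ∈ symmDiff A A₁} = symmDiff
        {x | Function.update x i true ∈ A} {x | Function.update x i true ∈ A₁} := rfl
      have e2 : {x | Function.update x i false ∈ symmDiff A A₁} = symmDiff
        {x | Function.update x i false ∈ A} {x | Function.update x i false ∈ A₁} := rfl
      rw [e1, e2, hA, hA, hup, hup, symmDiff_self, symmDiff_comm A₁ A₀]
      simp [hA1, hA0]
    have h0 : ν.real (symmDiff A A₀) = p i * ν.real (symmDiff A₁ A₀) := by
      rw [hν i]
      have e1 : {x | Function.update x i true ∈ symmDiff A A₀} = symmDiff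
        {x | Function.update x i true ∈ A} {x | Function.update x i true ∈ A₀} := rfl
      have e2 : {x | Function.update x i false ∈ symmDiff A A₀} = symmDiff
        {x | Function.update x i false ∈ A} {x | Function.update x i false ∈ A₀} := rfl
      rw [e1, e2, hA, hA, hup, hup, symmDiff_self]
      simp [hA1, hA0]
    -- By `h1` and `h0`, a constant drawn with bias p_i changes the function with average
    -- probability 2p_i(1-p_i)(ν(A₁) - ν(A₀)), twice the covariance.
    have hcov : 2 * cov ν p i A = p i * ν.real (symmDiff A A₁) +
        (1 - p i) * ν.real (symmDiff A A₀) := by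
      rw [cov_eq hν, hA, hA, h1, h0, hsymm]
      ring
    have hcovs : ∑ j ∈ U, 2 * cov ν p j A = p i * ∑ j ∈ U, 2 * cov ν p j A₁ +
        (1 - p i) * ∑ j ∈ U, 2 * cov ν p j A₀ := by
      rw [Finset.mul_sum, Finset.mul_sum, ← Finset.sum_add_distrib]
      refine Finset.sum_congr rfl fun j hj => ?_
      rw [cov_average hν (i := i) (j := j) (by rintro rfl; exact hi hj), hA, hA]
      ring
    -- Any constant whose cost plus the remaining covariances stays within the bound suffices, by
    -- induction and the triangle inequality.
    have hfin : ∀ b, ν.real (symmDiff A (dnfSet (restrict T i b))) +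
        ∑ j ∈ U, 2 * cov ν p j (dnfSet (restrict T i b)) ≤ ∑ j ∈ insert i U, 2 * cov ν p j A →
        ∃ T' : Finset (Finset (Fin n)), T'.card ≤ T.card ∧
          (∀ t' ∈ T', ∃ t ∈ T, t' ⊆ t \ insert i U) ∧
          ν.real (symmDiff A (dnfSet T')) ≤ ∑ j ∈ insert i U, 2 * cov ν p j A := by
      intro b hb
      obtain ⟨T', c1, c2, c3⟩ := ih (restrict T i b)
      refine ⟨T', c1.trans (card_restrict_le T i b), fun t' ht' => ?_, ?_⟩
      · obtain ⟨t, ht, htt⟩ := c2 t' ht'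
        obtain ⟨t₀, ht₀, htt₀⟩ := exists_of_mem_restrict ht
        refine ⟨t₀, ht₀, fun j hj => ?_⟩
        have h2 := htt hj
        rw [Finset.mem_sdiff] at h2
        have h3 := htt₀ h2.1
        rw [Finset.mem_erase] at h3
        simp [h3, h2.2]
      · refine le_trans (measureReal_mono (symmDiff_triangle _ (dnfSet (restrict T i b)) _))
          ((measureReal_union_le _ _).trans ?_)
        linarith
    rw [Finset.sum_insert hi] at hfin ⊢
    by_cases hb : ν.real (symmDiff A A₁) + ∑ j ∈ U, 2 * cov ν p j A₁ ≤
        2 * cov ν p i A + ∑ j ∈ U, 2 * cov ν p j A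
    · exact hfin true hb
    · refine hfin false ?_
      change ν.real (symmDiff A A₀) + ∑ j ∈ U, 2 * cov ν p j A₀ ≤ _
      have q0 := hp0 i
      have q1 := hp1 i
      -- The average of the two left-hand sides with weights p_i and 1 - p_i equals the right-hand
      -- side, so both cannot exceed it.
      by_contra hb'
      push Not at hb hb'
      rw [hcov, hcovs] at hb hb'
      -- For p_i = 0 the first inequality has weight 0 and the second alone is contradictory;
      -- otherwise the first keeps the weighted sum strict.
      rcases q0.eq_or_lt with h | h
      · rw [← h] at hb'
        simp at hb'
      · have := mul_lt_mul_of_pos_left hb h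
        have := mul_le_mul_of_nonneg_left hb'.le (sub_nonneg.2 q1)
        linarith

end Measure

/-! ### Approximation by short terms over the relevant variables -/

section Structure

variable {n : ℕ} {ν : Measure (Cube n)} {p : Fin n → ℝ}

theorem cov_dnfSet_of_notMem (hν : Resamples ν p) {i : Fin n} {T : Finset (Finset (Fin n))}
    (hi : ∀ t ∈ T, i ∉ t) : cov ν p i (dnfSet T) = 0 := by
  have h : ∀ b, {x | Function.update x i b ∈ dnfSet T} = dnfSet T := by
    intro b
    ext x
    simp only [dnfSet, termSet, Set.mem_ofPred_eq]
    refine exists_congr fun t => and_congr_right fun ht => forall₂_congr fun j hj => ?_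
    rw [Function.update_of_ne]
    rintro rfl
    exact hi t ht hj
  rw [cov_eq hν, h, h, sub_self, mul_zero]

variable [IsProbabilityMeasure ν]

/-- With D = A \ B the difference is ν(D ∩ {x_i = 1}) - p_i ν(D), and both terms lie between 0 and
ν(D). -/
theorem abs_cov_sub_cov_le (hp0 : ∀ i, 0 ≤ p i) (hp1 : ∀ i, p i ≤ 1) {A B : Set (Cube n)}
    (hBA : B ⊆ A) (i : Fin n) : |cov ν p i A - cov ν p i B| ≤ ν.real (A \ B) := by
  have h1 : ν.real A = ν.real B + ν.real (A \ B) := by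
    rw [measureReal_sdiff hBA .of_discrete]
    ring
  have h2 : ν.real (A ∩ {x | x i = true}) = ν.real (B ∩ {x | x i = true}) +
      ν.real ((A \ B) ∩ {x | x i = true}) := by
    rw [← measureReal_union _ .of_discrete]
    · rw [← Set.union_inter_distrib_right, Set.union_sdiff_cancel hBA]
    · exact Set.disjoint_sdiff_right.mono Set.inter_subset_left Set.inter_subset_left
  have h3 : ν.real ((A \ B) ∩ {x | x i = true}) ≤ ν.real (A \ B) :=
    measureReal_mono Set.inter_subset_left
  have h4 : 0 ≤ ν.real ((A \ B) ∩ {x | x i = true}) := measureReal_nonneg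
  have h5 : 0 ≤ ν.real (A \ B) := measureReal_nonneg
  have h6 := mul_le_mul_of_nonneg_right (hp1 i) h5
  have h7 := mul_nonneg (hp0 i) h5
  rw [cov, cov, h1, h2, abs_le]
  constructor <;> linarith

theorem dnfSet_filter_subset (T : Finset (Finset (Fin n))) (P : Finset (Fin n) → Prop)
    [DecidablePred P] : dnfSet (T.filter P) ⊆ dnfSet T := by
  rintro x ⟨t, ht, hx⟩
  exact ⟨t, (Finset.mem_filter.1 ht).1, hx⟩

theorem dnfSet_sdiff_filter_subset (T : Finset (Finset (Fin n))) (P : Finset (Fin n) → Prop)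
    [DecidablePred P] : dnfSet T \ dnfSet (T.filter P) ⊆ dnfSet (T.filter fun t => ¬ P t) := by
  rintro x ⟨⟨t, ht, hx⟩, h2⟩
  refine ⟨t, Finset.mem_filter.2 ⟨ht, fun hP => h2 ⟨t, Finset.mem_filter.2 ⟨ht, hP⟩, hx⟩⟩, hx⟩

/-- If `S` consists of the variables with large covariances with a monotone DNF expression, then
there are few such variables, and the expression can be approximated by short terms over `S`. -/
theorem exists_short_dnf (hν : Resamples ν p) {ρ : ℝ} (hρ : 0 ≤ ρ) (hρ1 : ρ ≤ 1)
    (hp0 : ∀ i, 0 ≤ p i) (hp : ∀ i, p i ≤ ρ) {g J L s k r q E : ℕ} (hg : ρ ^ g ≤ 1 / 2)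
    (hr : s * (g * J) ≤ r) (hr1 : 1 ≤ r) (hE : 1 ≤ E) (hq : q = 5 * r * E)
    (hJ : 4 * s * q < 2 ^ J) (hk : 1 ≤ k) (hL : s * k ≤ 2 ^ L)
    {T : Finset (Finset (Fin n))} (hT : T.card ≤ s) {S : Finset (Fin n)}
    (hS1 : ∀ i ∉ S, cov ν p i (dnfSet T) ≤ 1 / q)
    (hS2 : ∀ i ∈ S, 1 / (4 * q) ≤ cov ν p i (dnfSet T)) :
    S.card ≤ r ∧ ∃ T' : Finset (Finset (Fin n)),
      (∀ t ∈ T', t ⊆ S ∧ t.card ≤ g * (L + 2) ∧ ν.real (termSet t \ dnfSet T) ≤ 1 / E) ∧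
      ν.real (dnfSet T \ dnfSet T') ≤ 1 / E + 1 / (4 * k) := by
  have hp1 : ∀ i, p i ≤ 1 := fun i => (hp i).trans hρ1
  have hqpos : (0 : ℝ) < q := by
    rw [hq]; positivity
  have hrpos : (1 : ℝ) ≤ r := by exact_mod_cast hr1
  have hEpos : (0 : ℝ) < E := by exact_mod_cast hE
  have hkpos : (0 : ℝ) < k := by exact_mod_cast hk
  set A := dnfSet T with hA
  set T₁ := T.filter fun t => t.card < g * J with hT1
  set B := dnfSet T₁ with hB
  have hBA : B ⊆ A := dnfSet_filter_subset _ _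
  have hδ : ν.real (A \ B) ≤ s * (1 / 2) ^ J := by
    refine (measureReal_mono (dnfSet_sdiff_filter_subset T _)).trans ?_
    refine measureReal_dnfSet_filter_le hν hρ hρ1 hp hg
      ((Finset.card_filter_le _ _).trans hT) fun t ht => ?_
    simpa using (Finset.mem_filter.1 ht).2
  -- Dropping the terms with at least gJ variables moves each covariance by less than the lower
  -- threshold 1/(4q). A variable in no remaining term has covariance 0 with `B`, hence is not in
  -- `S`.
  have hδ' : ν.real (A \ B) < 1 / (4 * q) := by
    refine hδ.trans_lt ?_
    rw [one_div_pow, mul_one_div, div_lt_div_iff₀ (by positivity) (by positivity)]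
    have : ((4 * s * q : ℕ) : ℝ) < ((2 ^ J : ℕ) : ℝ) := by exact_mod_cast hJ
    push_cast at this
    linarith
  set V := T₁.biUnion id with hV
  have hVcard : V.card ≤ r := by
    refine le_trans (Finset.card_biUnion_le_card_mul T₁ id (g * J) fun t ht => ?_) (le_trans ?_ hr)
    · exact (Finset.mem_filter.1 ht).2.le
    · exact Nat.mul_le_mul_right _ ((Finset.card_filter_le _ _).trans hT)
  have hSV : S ⊆ V := by
    intro i hi
    by_contra hiV
    have h0 : cov ν p i B = 0 := cov_dnfSet_of_notMem hν fun t ht hit =>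
      hiV (Finset.mem_biUnion.2 ⟨t, ht, hit⟩)
    have h1 := abs_le.1 (abs_cov_sub_cov_le (ν := ν) hp0 hp1 hBA i)
    have h2 := hS2 i hi
    linarith [h1.2]
  refine ⟨(Finset.card_le_card hSV).trans hVcard, ?_⟩
  obtain ⟨T₂, hc, hsub, hdist⟩ := exists_restriction hν hp0 hp1 (V \ S) T₁
  have hq4 : 1 / (4 * (q : ℝ)) = 1 / q / 4 := by
    rw [div_div, mul_comm]
  have hdist' : ν.real (symmDiff B (dnfSet T₂)) ≤ r * (5 / 2 * (1 / q)) := by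
    refine hdist.trans ?_
    -- The covariance is at most 1/q with `A`, hence at most 1/q + 1/(4q) with `B`.
    have : ∀ i ∈ V \ S, 2 * cov ν p i B ≤ 5 / 2 * (1 / q) := by
      intro i hi
      have h1 := abs_le.1 (abs_cov_sub_cov_le (ν := ν) hp0 hp1 hBA i)
      have h2 := hS1 i (Finset.mem_sdiff.1 hi).2
      linarith [h1.1]
    refine (Finset.sum_le_card_nsmul _ _ _ this).trans ?_
    rw [nsmul_eq_mul]
    have : ((V \ S).card : ℝ) ≤ r := by
      exact_mod_cast (Finset.card_le_card Finset.sdiff_subset).trans hVcard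
    gcongr
  have hE' : 1 / (E : ℝ) = r * (5 * (1 / q)) := by
    rw [hq]
    push_cast
    field_simp
  have hq0 : 0 < 1 / (q : ℝ) := by positivity
  have hrq : 1 / (q : ℝ) ≤ r * (1 / q) := le_mul_of_one_le_left hq0.le hrpos
  have hAB : ν.real (symmDiff A (dnfSet T₂)) ≤ 1 / E := by
    refine le_trans (measureReal_mono (symmDiff_triangle _ B _)) ((measureReal_union_le _ _).trans ?_)
    rw [symmDiff_of_ge hBA]
    linarith
  refine ⟨T₂.filter fun t => t.card < g * (L + 2), fun t ht => ?_, ?_⟩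
  · obtain ⟨ht1, ht2⟩ := Finset.mem_filter.1 ht
    refine ⟨fun i hi => ?_, ht2.le, ?_⟩
    · obtain ⟨t', ht', htt'⟩ := hsub t ht1
      have h1 := htt' hi
      rw [Finset.mem_sdiff, Finset.mem_sdiff] at h1
      by_contra hiS
      exact h1.2 ⟨Finset.mem_biUnion.2 ⟨t', ht', h1.1⟩, hiS⟩
    -- A single term of an expression close to `A` is true outside `A` with at most the probability
    -- of the whole symmetric difference.
    · refine le_trans (measureReal_mono ?_) hAB
      rintro x ⟨hx, hxA⟩
      exact Or.inr ⟨⟨t, ht1, hx⟩, hxA⟩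
  · have h1 : A \ dnfSet (T₂.filter fun t => t.card < g * (L + 2)) ⊆
        symmDiff A (dnfSet T₂) ∪ dnfSet (T₂.filter fun t => ¬ t.card < g * (L + 2)) := by
      rintro x ⟨hxA, hx⟩
      by_cases hx2 : x ∈ dnfSet T₂
      · exact Or.inr (dnfSet_sdiff_filter_subset _ _ ⟨hx2, hx⟩)
      · exact Or.inl (Or.inl ⟨hxA, hx2⟩)
    refine (measureReal_mono h1).trans ((measureReal_union_le _ _).trans (add_le_add hAB ?_))
    refine (measureReal_dnfSet_filter_le hν hρ hρ1 hp hg (J := L + 2) (s := s)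
      ((Finset.card_filter_le _ _).trans (hc.trans ((Finset.card_filter_le _ _).trans hT)))
      fun t ht => by simpa using (Finset.mem_filter.1 ht).2).trans ?_
    rw [one_div_pow, mul_one_div, div_le_div_iff₀ (by positivity) (by positivity)]
    have : ((s * k : ℕ) : ℝ) ≤ ((2 ^ L : ℕ) : ℝ) := by exact_mod_cast hL
    push_cast at this
    rw [pow_add]
    linarith

end Structure

/-! ### Empirical frequencies -/

/-- The number of the points with indices in `[a, b)` that lie in `G`. -/
noncomputable def freq {n : ℕ} (xs : ℕ → Cube n) (a b : ℕ) (G : Set (Cube n)) : ℝ :=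
  ∑ t ∈ Finset.Ico a b, G.indicator 1 (xs t)

/-- A centred indicator is sub-Gaussian with parameter 1/4; apply the tail bound to both signs. The
window may start at any `a`, to serve both batches. -/
theorem hoeffding_freq {n : ℕ} (ν : Measure (Cube n)) [IsProbabilityMeasure ν] (G : Set (Cube n))
    {a m : ℕ} (hm : 0 < m) {η : ℝ} (hη : 0 ≤ η) :
    (Measure.infinitePi fun _ : ℕ => ν).real
      {xs | η * m ≤ |freq xs a (a + m) G - m * ν.real G|} ≤ 2 * Real.exp (-(2 * m * η ^ 2)) := by
  set P := Measure.infinitePi fun _ : ℕ => ν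
  set F : Cube n → ℝ := fun x => G.indicator 1 x - ν.real G with hF
  have hF' : ProbabilityTheory.HasSubgaussianMGF F ((‖(1 : ℝ) - 0‖₊ / 2) ^ 2) ν := by
    have h := ProbabilityTheory.hasSubgaussianMGF_of_mem_Icc (μ := ν) (X := G.indicator 1)
      (a := (0 : ℝ)) (b := 1) (Measurable.of_discrete.aemeasurable) (.of_forall fun x => by
        by_cases hx : x ∈ G <;> simp [hx])
    rwa [integral_indicator_one .of_discrete] at h
  have hmap : ∀ t, P.map (fun xs => xs t) = ν := fun t => Measure.infinitePi_map_eval _ t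
  have hsub : ∀ t, ProbabilityTheory.HasSubgaussianMGF (fun xs : ℕ → Cube n => F (xs t))
      ((‖(1 : ℝ) - 0‖₊ / 2) ^ 2) P := by
    intro t
    refine ProbabilityTheory.HasSubgaussianMGF.of_map (Y := fun xs : ℕ → Cube n => xs t)
      (X := F) (measurable_pi_apply t).aemeasurable ?_
    rw [hmap]
    exact hF'
  have hind : ProbabilityTheory.iIndepFun (fun t (xs : ℕ → Cube n) => F (xs t)) P :=
    ProbabilityTheory.iIndepFun_infinitePi (fun _ => .of_discrete)
  have hsub' : ∀ t, ProbabilityTheory.HasSubgaussianMGF (fun xs : ℕ → Cube n => -F (xs t))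
      ((‖(1 : ℝ) - 0‖₊ / 2) ^ 2) P := fun t => (hsub t).neg
  have hind' : ProbabilityTheory.iIndepFun (fun t (xs : ℕ → Cube n) => -F (xs t)) P :=
    ProbabilityTheory.iIndepFun_infinitePi (X := fun _ x => -F x) (fun _ => .of_discrete)
  have hηm : 0 ≤ η * m := by positivity
  have h1 := ProbabilityTheory.HasSubgaussianMGF.measure_sum_ge_le_of_iIndepFun hind
    (s := Finset.Ico a (a + m)) (fun t _ => hsub t) hηm
  have h2 := ProbabilityTheory.HasSubgaussianMGF.measure_sum_ge_le_of_iIndepFun hind'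
    (s := Finset.Ico a (a + m)) (fun t _ => hsub' t) hηm
  have hexp : -(η * m) ^ 2 / (2 * ((∑ t ∈ Finset.Ico a (a + m),
      (‖(1 : ℝ) - 0‖₊ / 2) ^ 2 : NNReal) : ℝ)) = -(2 * m * η ^ 2) := by
    have : (m : ℝ) ≠ 0 := by positivity
    simp
    field_simp
  rw [hexp] at h1 h2
  have hsum : ∀ xs : ℕ → Cube n, ∑ t ∈ Finset.Ico a (a + m), F (xs t) =
      freq xs a (a + m) G - m * ν.real G := by
    intro xs
    simp [hF, freq]
  refine le_trans (measureReal_mono (s₂ := {xs | η * m ≤ ∑ t ∈ Finset.Ico a (a + m), F (xs t)} ∪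
    {xs | η * m ≤ ∑ t ∈ Finset.Ico a (a + m), -F (xs t)}) ?_)
    ((measureReal_union_le _ _).trans (by linarith))
  intro xs hxs
  simp only [Set.mem_union, Set.mem_ofPred_eq, Finset.sum_neg_distrib, hsum] at hxs ⊢
  rcases le_abs.1 hxs with h | h
  · exact Or.inl h
  · exact Or.inr h

theorem hoeffding_freq_family {n : ℕ} (ν : Measure (Cube n)) [IsProbabilityMeasure ν]
    {ι : Type*} [Fintype ι] (G : ι → Set (Cube n)) {a m : ℕ} (hm : 0 < m) {η : ℝ} (hη : 0 ≤ η) :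
    (Measure.infinitePi fun _ : ℕ => ν).real
      {xs | ∃ j, η * m ≤ |freq xs a (a + m) (G j) - m * ν.real (G j)|} ≤
        Fintype.card ι * (2 * Real.exp (-(2 * m * η ^ 2))) := by
  have : {xs | ∃ j, η * m ≤ |freq xs a (a + m) (G j) - m * ν.real (G j)|} =
      ⋃ j ∈ (Finset.univ : Finset ι),
        {xs | η * m ≤ |freq xs a (a + m) (G j) - m * ν.real (G j)|} := by
    ext xs
    simp
  rw [this]
  refine (measureReal_biUnion_finset_le _ _).trans ?_
  refine (Finset.sum_le_card_nsmul _ _ _ fun j _ => hoeffding_freq ν (G j) hm hη).trans ?_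
  simp

/-- An event that contains all sequences of points outside two sets of probability at most `1 / 4`
has probability at least `1 / 2`. -/
theorem half_le_sampleMeasure {n : ℕ} (D : ProbabilityMeasure (Cube n)) {B₁ B₂ : Set (ℕ → Cube n)}
    (h1 : (Measure.infinitePi fun _ : ℕ => (D : Measure (Cube n))).real B₁ ≤ 1 / 4)
    (h2 : (Measure.infinitePi fun _ : ℕ => (D : Measure (Cube n))).real B₂ ≤ 1 / 4)
    {E : Set ((ℕ → Cube n) × (ℕ → Bool))} (hE : ∀ w, w.1 ∉ B₁ → w.1 ∉ B₂ → w ∈ E) :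
    1 / 2 ≤ sampleMeasure D E := by
  have hP : IsProbabilityMeasure (sampleMeasure D) := by
    unfold sampleMeasure
    infer_instance
  have hB : (sampleMeasure D).real ((B₁ ∪ B₂) ×ˢ Set.univ) ≤ 1 / 2 := by
    rw [sampleMeasure, measureReal_prod_prod]
    simp only [probReal_univ, mul_one]
    exact (measureReal_union_le _ _).trans (by linarith)
  -- `E` is not assumed measurable, so its measure is bounded below by subadditivity on a cover of
  -- the whole space instead of by complementation.
  have hU : (Set.univ : Set ((ℕ → Cube n) × (ℕ → Bool))) ⊆ E ∪ (B₁ ∪ B₂) ×ˢ Set.univ := by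
    intro w _
    by_cases hw : w.1 ∈ B₁ ∪ B₂
    · exact Or.inr ⟨hw, trivial⟩
    · exact Or.inl (hE w (fun h => hw (Or.inl h)) fun h => hw (Or.inr h))
  have h3 := (measureReal_mono (μ := sampleMeasure D) hU).trans (measureReal_union_le _ _)
  rw [probReal_univ] at h3
  have h4 : (1 / 2 : ℝ) ≤ (sampleMeasure D).real E := by linarith
  rw [Measure.real, ← ENNReal.ofReal_le_iff_le_toReal (measure_ne_top _ _)] at h4
  refine le_trans (le_of_eq ?_) h4
  rw [ENNReal.ofReal_div_of_pos two_pos, ENNReal.ofReal_one, ENNReal.ofReal_ofNat]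

/-! ### Correctness of the hypothesis on a good sample -/

theorem bitAt_fin {n : ℕ} (x : Cube n) (i : Fin n) : bitAt x i = (x i).toNat := by
  simp [bitAt]

theorem termVal_succ {n : ℕ} (S : ℕ → ℕ) {R : ℕ} (d : ℕ) {v : ℕ} (hv : v < R) (u : ℕ)
    (x : Cube n) : termVal S R (d + 1) (v + R * u) x = litVal x (S v) * termVal S R d u x := by
  have hR : 0 < R := by omega
  rw [termVal, Finset.prod_range_succ', mul_comm, termVal]
  congr 1
  · rw [pow_zero, Nat.div_one, Nat.add_mul_mod_self_left, Nat.mod_eq_of_lt hv]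
  · refine Finset.prod_congr rfl fun j _ => ?_
    rw [pow_succ', ← Nat.div_div_eq_div_mul, Nat.add_mul_div_left _ _ hR, Nat.div_eq_of_lt hv,
      zero_add]

/-- Each variable of the term is coded by one digit, and the digit r, whose cell is empty, pads
terms with fewer than `d` variables. -/
theorem exists_termVal {n : ℕ} {S : ℕ → ℕ} {r : ℕ} (hS : S r = 0) (d : ℕ) :
    ∀ t : Finset (Fin n), (∀ i ∈ t, ∃ v < r, S v = i + 1) → t.card ≤ d →
      ∃ u < (r + 1) ^ d, ∀ x : Cube n, termVal S (r + 1) d u x = 1 ↔ x ∈ termSet t := by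
  induction d with
  | zero =>
    intro t _ hc
    have : t = ∅ := by simpa using hc
    subst this
    exact ⟨0, by simp, fun x => by simp [termVal, termSet]⟩
  | succ d ih =>
    intro t ht hc
    have hlt : ∀ v u, v < r + 1 → u < (r + 1) ^ d → v + (r + 1) * u < (r + 1) ^ (d + 1) := by
      intro v u hv hu
      rw [pow_succ']
      calc v + (r + 1) * u < (r + 1) * 1 + (r + 1) * u := by omega
        _ = (r + 1) * (u + 1) := by ring
        _ ≤ _ := Nat.mul_le_mul_left _ hu
    rcases t.eq_empty_or_nonempty with rfl | ⟨i, hi⟩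
    · obtain ⟨u, hu, h⟩ := ih ∅ (by simp) (by simp)
      refine ⟨r + (r + 1) * u, hlt _ _ (by omega) hu, fun x => ?_⟩
      rw [termVal_succ S d (by omega), hS, ← h]
      simp [litVal]
    · obtain ⟨u, hu, h⟩ := ih (t.erase i) (fun j hj => ht j (Finset.mem_of_mem_erase hj)) (by
        rw [Finset.card_erase_of_mem hi]
        omega)
      obtain ⟨v, hv, hSv⟩ := ht i hi
      refine ⟨v + (r + 1) * u, hlt _ _ (by omega) hu, fun x => ?_⟩
      rw [termVal_succ S d (by omega), hSv, mul_eq_one, h]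
      simp only [litVal, Nat.add_one_ne_zero, if_false, Nat.add_sub_cancel, bitAt_fin, termSet,
        Set.mem_ofPred_eq, Bool.toNat_eq_one, Finset.mem_erase]
      constructor
      · rintro ⟨h1, h2⟩ j hj
        by_cases hji : j = i
        · rw [hji, h1]
        · exact h2 j ⟨hji, hj⟩
      · exact fun h => ⟨h i hi, fun j hj => h j hj.2⟩

theorem resamples_prob {n : ℕ} {ν : Measure (Cube n)} [IsProbabilityMeasure ν] {p : Fin n → ℝ}
    (hν : Resamples ν p) (i : Fin n) : ν.real {x | x i = true} = p i := by
  rw [hν i]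
  simp

/-- The events whose frequencies the algorithm estimates in order to select variables. -/
def selEvent {n : ℕ} (A : Set (Cube n)) : Option (Fin n) × Bool → Set (Cube n)
  | (none, false) => Set.univ
  | (none, true) => A
  | (some i, false) => {x | x i = true}
  | (some i, true) => A ∩ {x | x i = true}

/-- The errors of the term with a given sequence of codes of literals. -/
def errEvent {n d : ℕ} (A : Set (Cube n)) (w : Fin d → Fin (n + 1)) : Set (Cube n) :=
  {x | ∀ j, litVal x (w j) = 1} \ A

theorem countLabel_eq_freq {n : ℕ} (f : Concept n) (xs : ℕ → Cube n) (b : ℕ → Bool) (l m : ℕ) :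
    (countLabel (exampleSource f xs b) l m : ℝ) = freq xs l m {x | f x = true} := by
  rw [countLabel, freq]
  push_cast
  refine Finset.sum_congr rfl fun t _ => ?_
  by_cases h : f (xs t) = true <;> simp [exampleSource, h]

theorem countVar_eq_freq {n : ℕ} (f : Concept n) (xs : ℕ → Cube n) (b : ℕ → Bool) (l m : ℕ)
    (i : Fin n) :
    (countVar (exampleSource f xs b) l m i : ℝ) = freq xs l m {x | x i = true} := by
  rw [countVar, freq]
  push_cast
  refine Finset.sum_congr rfl fun t _ => ?_
  by_cases h : xs t i = true <;> simp [exampleSource, h, bitAt_fin]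

theorem countVarLabel_eq_freq {n : ℕ} (f : Concept n) (xs : ℕ → Cube n) (b : ℕ → Bool) (l m : ℕ)
    (i : Fin n) : (countVarLabel (exampleSource f xs b) l m i : ℝ) =
      freq xs l m ({x | f x = true} ∩ {x | x i = true}) := by
  rw [countVarLabel, freq]
  push_cast
  refine Finset.sum_congr rfl fun t _ => ?_
  by_cases h : xs t i = true <;> by_cases h' : f (xs t) = true <;>
    simp [exampleSource, h, h', bitAt_fin]

theorem errCount_eq_freq {n : ℕ} (f : Concept n) (xs : ℕ → Cube n) (b : ℕ → Bool) (S : ℕ → ℕ)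
    (R d l m u : ℕ) : (errCount (exampleSource f xs b) S R d l m u : ℝ) =
      freq xs l m ({x | termVal S R d u x = 1} \ {x | f x = true}) := by
  rw [errCount, freq]
  push_cast
  refine Finset.sum_congr rfl fun t _ => ?_
  have := termVal_le_one S R d u (xs t)
  by_cases h : termVal S R d u (xs t) = 1 <;> by_cases h' : f (xs t) = true
  · simp [exampleSource, h, h']
  · simp [exampleSource, h, h']
  · simp [exampleSource, h, h']
  · have h0 : termVal S R d u (xs t) = 0 := by omega
    simp [exampleSource, h0, h']

/-- Every error event of a term over a table is one of (n+1)^d events fixed in advance. The union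
bound over these needs no independence between the table and the second batch. -/
theorem errEvent_eq {n d : ℕ} {S : ℕ → ℕ} (hS : ∀ v, S v < n + 1) (R u : ℕ) (A : Set (Cube n)) :
    errEvent A (fun j : Fin d => (⟨S (u / R ^ (j : ℕ) % R), hS _⟩ : Fin (n + 1))) =
      {x | termVal S R d u x = 1} \ A := by
  unfold errEvent
  congr 1
  ext x
  simp only [Set.mem_ofPred_eq, termVal, Finset.prod_eq_one_iff, Finset.mem_range]
  exact ⟨fun h j hj => h ⟨j, hj⟩, fun h j => h j j.2⟩

/-- The test for the empirical covariance is reliable if the frequencies are accurate. -/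
theorem covTest_reliable {P : Params} {F A₀ A₁ : ℕ} {φ π κ : ℝ} (hq : 0 < P.q) (hm : 0 < P.m)
    (hφ0 : 0 ≤ φ) (hφ : φ ≤ 1) (hA : A₀ ≤ P.m)
    (hF : |(F : ℝ) - P.m * φ| < 1 / (12 * P.q) * P.m)
    (h0 : |(A₀ : ℝ) - P.m * π| < 1 / (12 * P.q) * P.m)
    (h1 : |(A₁ : ℝ) - P.m * κ| < 1 / (12 * P.q) * P.m) :
    (CovTest P F A₀ A₁ → 1 / (4 * P.q) ≤ κ - π * φ) ∧
      (¬ CovTest P F A₀ A₁ → κ - π * φ ≤ 1 / P.q) := by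
  have hm' : (0 : ℝ) < P.m := by exact_mod_cast hm
  have hq' : (0 : ℝ) < P.q := by exact_mod_cast hq
  obtain ⟨η, hη⟩ : ∃ η : ℝ, η = 1 / (12 * P.q) := ⟨_, rfl⟩
  have hη0 : 0 < η := by rw [hη]; positivity
  have e4 : 1 / (4 * (P.q : ℝ)) = 3 * η := by rw [hη]; field_simp; norm_num
  have e1 : 1 / (P.q : ℝ) = 12 * η := by rw [hη]; field_simp
  rw [← hη] at hF h0 h1
  have hA' : (A₀ : ℝ) ≤ P.m := by exact_mod_cast hA
  have hA0 : (0 : ℝ) ≤ A₀ := Nat.cast_nonneg _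
  have hqη : 2 * (P.q : ℝ) * (6 * η) = 1 := by rw [hη]; field_simp; norm_num
  -- In units of η the threshold 1/(2q) is 6η and the empirical covariance is off by at most 3η.
  -- Passing therefore forces at least 3η = 1/(4q), and failing at most 9η, below 12η = 1/q.
  have hiff : CovTest P F A₀ A₁ ↔ 6 * η * (P.m : ℝ) ^ 2 < P.m * A₁ - F * A₀ := by
    have h2q : (0 : ℝ) < 2 * P.q := by positivity
    have he : 2 * (P.q : ℝ) * (6 * η * P.m ^ 2) = P.m * P.m := by
      rw [← mul_assoc, hqη]
      ring
    have hc : CovTest P F A₀ A₁ ↔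
        2 * (P.q : ℝ) * F * A₀ + P.m * P.m < 2 * P.q * P.m * A₁ := by
      unfold CovTest
      exact_mod_cast Iff.rfl
    rw [hc]
    refine ⟨fun h => lt_of_mul_lt_mul_left ?_ h2q.le, fun h => ?_⟩
    · rw [he]
      linarith
    · have := mul_lt_mul_of_pos_left h h2q
      rw [he] at this
      linarith
  have hdiff : |(P.m * A₁ - F * A₀ : ℝ) - P.m ^ 2 * (κ - π * φ)| ≤ 3 * η * (P.m : ℝ) ^ 2 := by
    -- Telescoping the product F·A₀, so that each of the three frequencies contributes one error of
    -- at most ηm².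
    have e : (P.m * A₁ - F * A₀ : ℝ) - P.m ^ 2 * (κ - π * φ) =
        P.m * (A₁ - P.m * κ) - (F - P.m * φ) * A₀ - P.m * φ * (A₀ - P.m * π) := by ring
    have g1 : |P.m * (A₁ - P.m * κ)| ≤ P.m * (η * P.m) := by
      rw [abs_mul, abs_of_pos hm']
      gcongr
    have g2 : |(F - P.m * φ) * A₀| ≤ η * P.m * P.m := by
      rw [abs_mul, abs_of_nonneg hA0]
      gcongr
    have g3 : |P.m * φ * (A₀ - P.m * π)| ≤ P.m * 1 * (η * P.m) := by
      rw [abs_mul, abs_of_nonneg (by positivity : (0 : ℝ) ≤ P.m * φ)]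
      gcongr
    rw [e]
    have := abs_sub (P.m * (A₁ - P.m * κ) - (F - P.m * φ) * A₀) (P.m * φ * (A₀ - P.m * π))
    have := abs_sub (P.m * (A₁ - P.m * κ)) ((F - P.m * φ) * A₀)
    linarith
  have hd := abs_le.1 hdiff
  have hm2 : (0 : ℝ) < (P.m : ℝ) ^ 2 := by positivity
  rw [hiff, e4, e1]
  constructor
  · intro h
    have : 3 * η * (P.m : ℝ) ^ 2 ≤ (κ - π * φ) * (P.m : ℝ) ^ 2 := by linarith [hd.2]
    exact le_of_mul_le_mul_right this hm2
  · intro h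
    have : (κ - π * φ) * (P.m : ℝ) ^ 2 ≤ 12 * η * (P.m : ℝ) ^ 2 := by
      have : 0 ≤ η * (P.m : ℝ) ^ 2 := by positivity
      linarith [hd.1]
    exact le_of_mul_le_mul_right this hm2

/-- False negatives avoid the approximating expression and cost at most 1/E + 1/(4k). False
positives come from kept terms and cost at most N·3/E = 3/(16k). As 1/E ≤ 1/(16k), the sum is at
most 1/(2k). -/
theorem measureReal_ne_hypothesis_le {n g a s k : ℕ} {P : Params}
    (hPe : P = mkParams g a n s k) {ν : Measure (Cube n)}
    [IsProbabilityMeasure ν] {p : Fin n → ℝ} (hν : Resamples ν p) {ρ : ℝ} (hρ : 0 ≤ ρ)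
    (hρ1 : ρ ≤ 1) (hp0 : ∀ i, 0 ≤ p i) (hp : ∀ i, p i ≤ ρ) (hρg : ρ ^ g ≤ 1 / 2) (hg : 1 ≤ g)
    (hn : 1 ≤ n) (hs : 1 ≤ s) (hk : 1 ≤ k)
    (hJ : 4 * s * P.q < 2 ^ (2 ^ a * (s * (s * k).size) * (s * (s * k).size)))
    {f : Concept n} {T : Finset (Finset (Fin n))} (hT : T.card ≤ s)
    (hf : {x | f x = true} = dnfSet T) {xs : ℕ → Cube n} {b : ℕ → Bool} {S : ℕ → ℕ}
    (hS : Lists S n P.r (fun i => CovTest P (countLabel (exampleSource f xs b) 0 P.m)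
        (countVar (exampleSource f xs b) 0 P.m i) (countVarLabel (exampleSource f xs b) 0 P.m i)))
    (h1 : ∀ j, |freq xs 0 P.m (selEvent (dnfSet T) j) - P.m * ν.real (selEvent (dnfSet T) j)| <
        1 / (12 * P.q) * P.m)
    (h2 : ∀ w : Fin P.d → Fin (n + 1), |freq xs P.m (2 * P.m) (errEvent (dnfSet T) w) -
        P.m * ν.real (errEvent (dnfSet T) w)| < 1 / (12 * P.q) * P.m) :
    ν.real {x | f x ≠ hypothesis P n S
      (fun u => errCount (exampleSource f xs b) S P.R P.d P.m (2 * P.m) u) x} ≤ 1 / k := by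
  obtain ⟨hPB, -, -, -, -, -, -, -, -, -, f10, f11, -, -, -, f15, f16, f17, -, -, -, -, f22⟩ :=
    mkParams_facts (a := a) hg hn hs hk
  rw [← hPe] at hPB f10 f11 f15 f16 f17 f22
  have er : P.r = s * (g * (2 ^ a * (s * (s * k).size) * (s * (s * k).size))) := by
    rw [hPe]
    change g * 2 ^ a * s * (s * (s * k).size) * (s * (s * k).size) = _
    ring
  have ed : P.d = g * ((s * k).size + 2) := by rw [hPe]; rfl
  have eq : P.q = 5 * P.r * P.E := by rw [hPe]; rfl
  have eE : P.E = 16 * P.N * k := by rw [hPe]; rfl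
  have eR : P.R = P.r + 1 := by rw [hPe]; rfl
  have eN : P.N = (P.r + 1) ^ P.d := by rw [hPe]; rfl
  have hq1 : 1 ≤ P.q := hPB.q_pos
  have hr1 : 1 ≤ P.r := hs.trans f22
  have hE1 : 1 ≤ P.E := le_trans (by omega) f10
  set ω := exampleSource f xs b with hω
  set A := dnfSet T with hA
  have hrel : ∀ i : Fin n, _ := fun i : Fin n => covTest_reliable (P := P)
    (F := countLabel ω 0 P.m) (A₀ := countVar ω 0 P.m i) (A₁ := countVarLabel ω 0 P.m i)
    (φ := ν.real A) (π := ν.real {x | x i = true}) (κ := ν.real (A ∩ {x | x i = true})) hq1 f17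
    measureReal_nonneg measureReal_le_one (countVar_le _ _ _)
    (by rw [countLabel_eq_freq, hf]; exact h1 (none, true))
    (by rw [countVar_eq_freq]; exact h1 (some i, false))
    (by rw [countVarLabel_eq_freq, hf]; exact h1 (some i, true))
  simp only [resamples_prob hν] at hrel
  set sel : Finset (Fin n) := Finset.univ.filter fun i : Fin n => CovTest P
    (countLabel ω 0 P.m) (countVar ω 0 P.m i) (countVarLabel ω 0 P.m i) with hsel
  obtain ⟨hcard, T', hT', hAT'⟩ := exists_short_dnf hν hρ hρ1 hp0 hp hρg
    (J := 2 ^ a * (s * (s * k).size) * (s * (s * k).size)) (L := (s * k).size) (k := k)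
    (r := P.r) er.ge hr1 hE1 eq hJ hk (Nat.lt_size_self _).le hT (S := sel)
    (fun i hi => (hrel i).2 (by simpa [hsel] using hi))
    (fun i hi => (hrel i).1 (by simpa [hsel] using hi))
  have hcomplete : ∀ i ∈ sel, ∃ v < P.r, S v = i + 1 := by
    intro i hi
    -- The table has not overflowed, because at most r variables pass the test.
    refine hS.complete (le_trans (Finset.card_le_card ?_)
      ((Finset.card_map Fin.valEmbedding).trans_le hcard)) i i.2 (by simpa [hsel] using hi)
    intro j hj
    rw [Finset.mem_filter, Finset.mem_range] at hj
    exact Finset.mem_map.2 ⟨⟨j, hj.1⟩, by simpa [hsel] using hj.2, rfl⟩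
  have hSr : S P.r = 0 := by
    by_contra h
    exact lt_irrefl _ (hS.sound _ h).1
  have hSn : ∀ v, S v < n + 1 := by
    intro v
    by_cases h : S v = 0
    · omega
    · have := (hS.sound _ h).2.1
      omega
  obtain ⟨η, hη⟩ : ∃ η : ℝ, η = 1 / (12 * P.q) := ⟨_, rfl⟩
  have hmpos : (0 : ℝ) < P.m := by exact_mod_cast f17
  have hEpos : (0 : ℝ) < P.E := by exact_mod_cast hE1
  have hkpos : (0 : ℝ) < k := by exact_mod_cast hk
  have hNpos : (1 : ℝ) ≤ P.N := by exact_mod_cast f16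
  have hηE : η ≤ 1 / P.E := by
    rw [hη]
    have : (P.E : ℝ) ≤ P.q := by
      rw [eq]
      exact_mod_cast Nat.le_mul_of_pos_left _ (by omega)
    gcongr
    linarith
  have herr : ∀ u, |(errCount ω S P.R P.d P.m (2 * P.m) u : ℝ) -
      P.m * ν.real ({x | termVal S P.R P.d u x = 1} \ A)| < η * P.m := by
    intro u
    rw [errCount_eq_freq, hf, ← errEvent_eq hSn, hη]
    exact h2 _
  set C : ℕ → ℕ := fun u => errCount ω S P.R P.d P.m (2 * P.m) u with hC
  have hkept : ∀ u, C u * P.E ≤ 2 * P.m ↔ (C u : ℝ) ≤ 2 / P.E * P.m := by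
    intro u
    rw [div_mul_eq_mul_div, le_div_iff₀ hEpos]
    exact_mod_cast Iff.rfl
  have hsub : {x | f x ≠ hypothesis P n S C x} ⊆ (A \ dnfSet T') ∪
      ⋃ u ∈ (Finset.range P.N).filter (fun u => C u * P.E ≤ 2 * P.m),
        ({x | termVal S P.R P.d u x = 1} \ A) := by
    intro x hx
    by_cases hxA : x ∈ A
    · refine Or.inl ⟨hxA, ?_⟩
      rintro ⟨t, ht, hxt⟩
      obtain ⟨hts, htc, hte⟩ := hT' t ht
      obtain ⟨u, hu, hut⟩ := exists_termVal (S := S) hSr P.d t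
        (fun i hi => hcomplete i (hts hi)) (ed ▸ htc)
      apply hx
      have hfx : f x = true := by
        rw [← hf] at hxA
        exact hxA
      rw [hfx, eq_comm, hypothesis, decide_eq_true_eq]
      refine ⟨u, eN ▸ hu, ?_, by rw [eR]; exact (hut x).2 hxt⟩
      rw [hkept]
      have e := herr u
      have : {x : Cube n | termVal S P.R P.d u x = 1} = termSet t := by
        ext y
        rw [eR]
        exact hut y
      rw [this] at e
      -- The true error is at most 1/E and the deviation at most η ≤ 1/E, so the frequency stays
      -- within the limit 2/E for keeping a term.
      have e1 := (abs_lt.1 e).2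
      have e2 := mul_le_mul_of_nonneg_left hte hmpos.le
      have e3 := mul_le_mul_of_nonneg_left hηE hmpos.le
      have : 2 / (P.E : ℝ) * P.m = P.m * (1 / P.E) + P.m * (1 / P.E) := by ring
      rw [this]
      linarith
    · refine Or.inr ?_
      have hfx : f x = false := by
        by_contra h
        rw [← hf] at hxA
        exact hxA (by simpa using h)
      have hhx : hypothesis P n S C x = true := by
        by_contra h
        exact hx (by rw [hfx]; simpa using h)
      rw [hypothesis, decide_eq_true_eq] at hhx
      obtain ⟨u, hu, hC1, hC2⟩ := hhx
      exact Set.mem_biUnion (Finset.mem_filter.2 ⟨Finset.mem_range.2 hu, hC1⟩) ⟨hC2, hxA⟩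
  have hunion : ν.real (⋃ u ∈ (Finset.range P.N).filter (fun u => C u * P.E ≤ 2 * P.m),
        ({x | termVal S P.R P.d u x = 1} \ A)) ≤ P.N * (3 * (1 / P.E)) := by
    refine (measureReal_biUnion_finset_le _ _).trans ?_
    refine (Finset.sum_le_card_nsmul _ _ (3 * (1 / (P.E : ℝ))) fun u hu => ?_).trans ?_
    · have hu' := (hkept u).1 (Finset.mem_filter.1 hu).2
      have e := (abs_lt.1 (herr u)).1
      have e3 := mul_le_mul_of_nonneg_left hηE hmpos.le
      have : 2 / (P.E : ℝ) * P.m = 2 * (P.m * (1 / P.E)) := by ring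
      rw [this] at hu'
      refine le_of_mul_le_mul_left (a := (P.m : ℝ)) ?_ hmpos
      change (C u : ℝ) ≤ _ at hu'
      change -(η * P.m) < (C u : ℝ) - _ at e
      linarith
    · rw [nsmul_eq_mul]
      have : (((Finset.range P.N).filter fun u => C u * P.E ≤ 2 * P.m).card : ℝ) ≤ P.N := by
        exact_mod_cast (Finset.card_filter_le _ _).trans (by simp)
      gcongr
  refine (measureReal_mono hsub).trans ((measureReal_union_le _ _).trans
    ((add_le_add hAT' hunion).trans ?_))
  have e1 : (P.N : ℝ) * (3 * (1 / P.E)) = 3 / 16 * (1 / k) := by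
    rw [eE]
    push_cast
    field_simp
  have e2 : 1 / (P.E : ℝ) ≤ 1 / 16 * (1 / k) := by
    rw [eE]
    push_cast
    rw [← one_div_mul_one_div_rev]
    rw [mul_comm]
    gcongr
    linarith
  have e3 : 1 / (4 * (k : ℝ)) = 1 / 4 * (1 / k) := by field_simp
  have : 0 < 1 / (k : ℝ) := by positivity
  linarith

/-! ### Estimates for the parameters -/

/-- `a` reappears on the left because r contains the factor 2^a, whose logarithm enters the bound
for q; the exponential on the right wins. -/
theorem exists_const (g : ℕ) (hg : 1 ≤ g) : ∃ a : ℕ, 10 + 4 * g * (g + a + 3) ≤ 2 ^ a := by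
  refine ⟨4 * g + 8, ?_⟩
  have h1 : g < 2 ^ g := Nat.lt_two_pow_self
  have h2 : (2 : ℕ) ^ (4 * g + 8) = 256 * (2 ^ g) ^ 4 := by ring
  rw [h2]
  obtain ⟨z, hz⟩ : ∃ z, z = 2 ^ g := ⟨_, rfl⟩
  rw [← hz] at h1 ⊢
  have h3 : g * g ≤ z ^ 2 := by nlinarith
  have h4 : z ^ 2 ≤ z ^ 4 := Nat.pow_le_pow_right (by omega) (by omega)
  nlinarith


/-- The circular requirement on J. With Y = sL one has r + 1 ≤ 2^(g+a+3Y), and sq is at most a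
constant times sk·(r+1)^(d+1) with d + 1 ≤ 4gY. Its logarithm is quadratic in Y, as is J = 2^a Y²,
and `ha` makes the coefficient of J large enough. -/
theorem four_mul_q_lt {g a n s k : ℕ} (hg : 1 ≤ g) (hs : 1 ≤ s) (hk : 1 ≤ k)
    (ha : 10 + 4 * g * (g + a + 3) ≤ 2 ^ a) :
    4 * s * (mkParams g a n s k).q < 2 ^ (2 ^ a * (s * (s * k).size) * (s * (s * k).size)) := by
  have hL1 : 1 ≤ (s * k).size := Nat.size_pos.2 (Nat.mul_pos hs hk)
  have hsk : s * k < 2 ^ (s * k).size := Nat.lt_size_self _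
  obtain ⟨L, hL⟩ : ∃ L, L = (s * k).size := ⟨_, rfl⟩
  obtain ⟨Y, hY⟩ : ∃ Y, Y = s * L := ⟨_, rfl⟩
  obtain ⟨r, hr⟩ : ∃ r, r = g * 2 ^ a * s * Y * Y := ⟨_, rfl⟩
  have eq : (mkParams g a n s k).q = 5 * r * (16 * (r + 1) ^ (g * (L + 2)) * k) := by
    rw [hr, hY, hL]; rfl
  rw [eq, ← hL, ← hY]
  rw [← hL] at hL1 hsk
  have hLY : L ≤ Y := by rw [hY]; exact Nat.le_mul_of_pos_left _ hs
  have hsY : s ≤ Y := by rw [hY]; exact Nat.le_mul_of_pos_right _ hL1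
  have hr1 : r + 1 ≤ 2 ^ (g + a + 3 * Y) := by
    have h1 : g < 2 ^ g := Nat.lt_two_pow_self
    have h2 : Y < 2 ^ Y := Nat.lt_two_pow_self
    have h3 : g * 2 ^ a * s * Y * Y < 2 ^ g * 2 ^ a * 2 ^ Y * 2 ^ Y * 2 ^ Y := by
      have : s < 2 ^ Y := by omega
      have : 0 < 2 ^ a := Nat.two_pow_pos a
      gcongr
    calc r + 1 ≤ 2 ^ g * 2 ^ a * 2 ^ Y * 2 ^ Y * 2 ^ Y := by rw [hr]; exact h3
      _ = _ := by ring
  have hd : g * (L + 2) + 1 ≤ 4 * g * Y := by nlinarith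
  calc 4 * s * (5 * r * (16 * (r + 1) ^ (g * (L + 2)) * k))
      = 320 * (s * k) * (r * (r + 1) ^ (g * (L + 2))) := by ring
    _ ≤ 320 * (s * k) * ((r + 1) * (r + 1) ^ (g * (L + 2))) := by gcongr; omega
    _ = 320 * (s * k) * (r + 1) ^ (g * (L + 2) + 1) := by ring
    _ ≤ 320 * (s * k) * (2 ^ (g + a + 3 * Y)) ^ (4 * g * Y) := by
        refine Nat.mul_le_mul_left _ ((Nat.pow_le_pow_left hr1 _).trans
          (Nat.pow_le_pow_right (Nat.two_pow_pos _) hd))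
    _ < 2 ^ 9 * 2 ^ L * (2 ^ (g + a + 3 * Y)) ^ (4 * g * Y) := by
        refine Nat.mul_lt_mul_of_pos_right ?_ (Nat.pow_pos (Nat.two_pow_pos _))
        omega
    _ = 2 ^ (9 + L + (g + a + 3 * Y) * (4 * g * Y)) := by
        rw [← pow_mul, ← pow_add, ← pow_add]
    _ ≤ _ := by
        refine Nat.pow_le_pow_right two_pos ?_
        have hY1 : 1 ≤ Y := hL1.trans hLY
        have h1 : (10 + 4 * g * (g + a + 3)) * Y * Y ≤ 2 ^ a * Y * Y := by gcongr
        refine le_trans ?_ h1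
        have h2 : Y ≤ Y * Y := Nat.le_mul_of_pos_right _ hY1
        have h3 : (g + a) * (4 * g * Y) ≤ (g + a) * (4 * g * Y) * Y :=
          Nat.le_mul_of_pos_right _ hY1
        nlinarith

/-! ### Growth of the parameters and the running time -/

theorem mul_pow_lt_pow_three (g a : ℕ) {s Y : ℕ} (hsY : s ≤ Y) (hY1 : 1 ≤ Y) :
    g * 2 ^ a * s * Y * Y < (2 ^ (g + a + 1) * Y) ^ 3 := by
  have h1 : g < 2 ^ g := Nat.lt_two_pow_self
  have h2 : 1 ≤ 2 ^ a := Nat.two_pow_pos a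
  have h3 : 1 ≤ 2 ^ g := Nat.two_pow_pos g
  have h4 : 0 < 2 ^ g * 2 ^ a * Y * Y * Y := by positivity
  have h5 : 1 ≤ 2 ^ (g + a + 1) := Nat.two_pow_pos _
  calc g * 2 ^ a * s * Y * Y ≤ 2 ^ g * 2 ^ a * Y * Y * Y := by gcongr
    _ < 2 * (2 ^ g * 2 ^ a * Y * Y * Y) := by omega
    _ = 2 ^ (g + a + 1) * 1 * 1 * (Y * Y * Y) := by ring
    _ ≤ 2 ^ (g + a + 1) * 2 ^ (g + a + 1) * 2 ^ (g + a + 1) * (Y * Y * Y) := by gcongr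
    _ = _ := by ring

/-- Everything is compared with Z = b^(gL), where b = 2^(g+a+1)·sL. From r + 1 ≤ b³ and d ≤ 3gL
follow N ≤ Z^9 and d ≤ Z³; with 80 ≤ Z^7, r ≤ Z³ and k ≤ Z this gives q ≤ Z^20, and then m ≤
432·n.size·Z^43. -/
theorem mkParams_bounds {g a n s k : ℕ} (hg : 1 ≤ g) (hn : 1 ≤ n) (hs : 1 ≤ s) (hk : 1 ≤ k) :
    let P := mkParams g a n s k
    let Z := (2 ^ (g + a + 1) * (s * (s * k).size)) ^ (g * (s * k).size)
    P.m * P.n * P.N * P.d ≤ 432 * n * n.size * Z ^ 55 ∧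
      P.numBound < 2 ^ 20 * n ^ 2 * Z ^ 106 := by
  intro P Z
  have hL1 : 1 ≤ (s * k).size := Nat.size_pos.2 (Nat.mul_pos hs hk)
  have hsk : s * k < 2 ^ (s * k).size := Nat.lt_size_self _
  have hl1 : 1 ≤ n.size := Nat.size_pos.2 hn
  have hln : n.size ≤ n := Nat.size_le.2 Nat.lt_two_pow_self
  obtain ⟨L, hL⟩ : ∃ L, L = (s * k).size := ⟨_, rfl⟩
  obtain ⟨l, hl⟩ : ∃ l, l = n.size := ⟨_, rfl⟩
  obtain ⟨Y, hY⟩ : ∃ Y, Y = s * L := ⟨_, rfl⟩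
  obtain ⟨b, hb⟩ : ∃ b, b = 2 ^ (g + a + 1) * Y := ⟨_, rfl⟩
  have eZ : Z = b ^ (g * L) := by rw [hb, hY, hL]
  have en : P.n = n := rfl
  have er : P.r = g * 2 ^ a * s * Y * Y := by rw [hY, hL]; rfl
  have ed : P.d = g * (L + 2) := by rw [hL]; rfl
  have eN : P.N = (P.r + 1) ^ P.d := rfl
  have eE : P.E = 16 * P.N * k := rfl
  have eq : P.q = 5 * P.r * P.E := rfl
  have em : P.m = 72 * ((P.d * l + 5) * P.q * P.q) := by rw [hl]; rfl
  clear_value P Z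
  rw [← hL] at hL1 hsk
  rw [← hl] at hl1 hln ⊢
  have hLY : L ≤ Y := by rw [hY]; exact Nat.le_mul_of_pos_left _ hs
  have hsY : s ≤ Y := by rw [hY]; exact Nat.le_mul_of_pos_right _ hL1
  have hY1 : 1 ≤ Y := hL1.trans hLY
  have hb2 : 2 ≤ b := by
    rw [hb, pow_succ]
    have := Nat.two_pow_pos (g + a)
    nlinarith
  have hgL : 1 ≤ g * L := Nat.mul_pos hg hL1
  have hpow : ∀ i j, i ≤ j * (g * L) → b ^ i ≤ Z ^ j := by
    intro i j hij
    rw [eZ, ← pow_mul, mul_comm (g * L) j]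
    exact Nat.pow_le_pow_right (by omega) hij
  have hr : P.r + 1 ≤ b ^ 3 := by
    rw [er, hb]
    exact mul_pow_lt_pow_three g a hsY hY1
  have hdL : P.d ≤ 3 * (g * L) := by
    rw [ed]
    calc g * (L + 2) ≤ g * (3 * L) := Nat.mul_le_mul_left _ (by omega)
      _ = 3 * (g * L) := by ring
  have hN : P.N ≤ Z ^ 9 := by
    rw [eN]
    refine (Nat.pow_le_pow_left hr _).trans ?_
    rw [← pow_mul]
    exact hpow _ _ (by omega)
  have hd : P.d ≤ Z ^ 3 := by
    refine hdL.trans (le_trans ?_ (hpow (3 * (g * L)) 3 le_rfl))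
    exact (Nat.lt_pow_self (by omega)).le
  have hk' : k ≤ Z := by
    have h1 : k ≤ s * k := Nat.le_mul_of_pos_left _ hs
    have h2 : k ≤ b ^ L := (by omega : k ≤ 2 ^ L).trans (Nat.pow_le_pow_left hb2 _)
    refine h2.trans ?_
    simpa using hpow L 1 (by rw [one_mul]; exact Nat.le_mul_of_pos_left _ hg)
  have h16 : 80 ≤ Z ^ 7 := by
    refine le_trans (by norm_num) ((Nat.pow_le_pow_left hb2 7).trans (hpow 7 7 (by omega)))
  have hr' : P.r ≤ Z ^ 3 := by
    refine le_trans (by omega) (hr.trans (hpow 3 3 (by omega)))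
  have hq : P.q ≤ Z ^ 20 := by
    rw [eq, eE]
    calc 5 * P.r * (16 * P.N * k) = 80 * P.r * P.N * k := by ring
      _ ≤ Z ^ 7 * Z ^ 3 * Z ^ 9 * Z := by gcongr
      _ = Z ^ 20 := by ring
  have hd1 : 1 ≤ P.d := by rw [ed]; exact Nat.mul_pos hg (by omega)
  have hm : P.m ≤ 432 * l * Z ^ 43 := by
    have h1 : P.d * l + 5 ≤ 6 * (P.d * l) := by
      have : 1 ≤ P.d * l := Nat.mul_pos hd1 hl1
      omega
    rw [em]
    calc 72 * ((P.d * l + 5) * P.q * P.q) ≤ 72 * (6 * (Z ^ 3 * l) * Z ^ 20 * Z ^ 20) := by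
          refine Nat.mul_le_mul_left _ (Nat.mul_le_mul (Nat.mul_le_mul (h1.trans ?_) hq) hq)
          gcongr
      _ = 432 * l * Z ^ 43 := by ring
  have hZ1 : 1 ≤ Z := by rw [eZ]; exact Nat.one_le_pow _ _ (by omega)
  constructor
  · rw [en]
    calc P.m * n * P.N * P.d ≤ 432 * l * Z ^ 43 * n * Z ^ 9 * Z ^ 3 := by gcongr
      _ = 432 * n * l * Z ^ 55 := by ring
  · rw [Params.numBound, en]
    have h1 : n ≤ n ^ 2 * Z ^ 106 := by
      have h2 : n ≤ n ^ 2 := Nat.le_self_pow (by norm_num) _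
      have h3 : 1 ≤ Z ^ 106 := Nat.one_le_pow _ _ hZ1
      exact h2.trans (Nat.le_mul_of_pos_right _ h3)
    calc 3 * P.q * P.m * P.m + n
        ≤ 3 * Z ^ 20 * (432 * n * Z ^ 43) * (432 * n * Z ^ 43) + n ^ 2 * Z ^ 106 := by
          have hm' : P.m ≤ 432 * n * Z ^ 43 := hm.trans (by gcongr)
          gcongr
      _ = 559873 * (n ^ 2 * Z ^ 106) := by ring
      _ < 2 ^ 20 * (n ^ 2 * Z ^ 106) := by
          refine Nat.mul_lt_mul_of_pos_right (by norm_num) ?_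
          exact Nat.mul_pos (Nat.pow_pos hn) (Nat.pow_pos hZ1)
      _ = _ := by ring

theorem size_le_one_add_logb {x : ℕ} (hx : 1 ≤ x) : (x.size : ℝ) ≤ 1 + Real.logb 2 x := by
  have hs : 1 ≤ x.size := Nat.size_pos.2 hx
  have h : 2 ^ (x.size - 1) ≤ x := Nat.lt_size.1 (by omega)
  have h' : ((2 : ℝ) ^ (x.size - 1)) ≤ x := by exact_mod_cast h
  have := Real.logb_le_logb_of_le (b := 2) (by norm_num) (by positivity) h'
  rw [Real.logb_pow, Real.logb_self_eq_one (by norm_num), mul_one, Nat.cast_sub hs] at this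
  push_cast at this
  linarith

theorem one_le_logRatio (s : ℕ) (ε : ℝ) : 1 ≤ logRatio s ε := le_max_left _ _

/-- Rounding 1/ε up costs a factor of at most 2, so the length is at most 2 + log₂(s/ε), which is at
most 3ℓ because ℓ ≥ 1. -/
theorem size_le_three_mul_logRatio {s : ℕ} {ε : ℝ} (hs : 1 ≤ s) (hε : 0 < ε) (hε1 : ε < 1) :
    ((s * ⌈1 / ε⌉₊).size : ℝ) ≤ 3 * logRatio s ε := by
  have hs' : (1 : ℝ) ≤ s := by exact_mod_cast hs
  have hk : 1 ≤ ⌈1 / ε⌉₊ := Nat.ceil_pos.2 (by positivity)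
  have h1 := size_le_one_add_logb (Nat.mul_pos hs hk)
  have h2 : ((s * ⌈1 / ε⌉₊ : ℕ) : ℝ) ≤ 2 * (s / ε) := by
    push_cast
    have h3 : (⌈1 / ε⌉₊ : ℝ) < 1 / ε + 1 := Nat.ceil_lt_add_one (by positivity)
    have h4 : 1 ≤ 1 / ε := by rw [le_div_iff₀ hε]; linarith
    calc (s : ℝ) * ⌈1 / ε⌉₊ ≤ s * (2 * (1 / ε)) := by
          gcongr
          linarith
      _ = _ := by ring
  have h5 := Real.logb_le_logb_of_le (b := 2) (by norm_num)
    (by exact_mod_cast Nat.mul_pos hs hk) h2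
  rw [Real.logb_mul (by norm_num) (by positivity), Real.logb_self_eq_one (by norm_num)] at h5
  have h6 : Real.logb 2 (s / ε) ≤ logRatio s ε := le_max_right _ _
  have h7 := one_le_logRatio s ε
  push_cast at h1 h5
  linarith

/-- For sℓ ≥ 2 compare the bases; otherwise ℓ ≤ 2 and the factor 4 suffices. -/
theorem two_rpow_le {s : ℕ} {ℓ : ℝ} (hs : 1 ≤ s) (hℓ : 1 ≤ ℓ) :
    (2 : ℝ) ^ ℓ ≤ 4 * (s * ℓ) ^ ℓ := by
  have hs' : (1 : ℝ) ≤ s := by exact_mod_cast hs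
  have h1 : 1 ≤ (s : ℝ) * ℓ := one_le_mul_of_one_le_of_one_le hs' hℓ
  have h3 : 1 ≤ ((s : ℝ) * ℓ) ^ ℓ := Real.one_le_rpow h1 (by linarith)
  by_cases h2 : 2 ≤ (s : ℝ) * ℓ
  · have := Real.rpow_le_rpow (by norm_num) h2 (by linarith : 0 ≤ ℓ)
    linarith
  · have h4 : ℓ ≤ 2 := by nlinarith
    have := Real.rpow_le_rpow_of_exponent_le (by norm_num : (1 : ℝ) ≤ 2) h4
    norm_num at this
    linarith

/-- The base is at most 2^(e+2)·sℓ and the exponent at most 3gℓ. The resulting powers of 2^ℓ are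
absorbed into powers of (sℓ)^ℓ by `two_rpow_le`. -/
theorem pow_size_le {s e g L : ℕ} {ℓ : ℝ} (hs : 1 ≤ s) (hℓ : 1 ≤ ℓ) (hL1 : 1 ≤ L)
    (hL : (L : ℝ) ≤ 3 * ℓ) : (((2 ^ e * (s * L)) ^ (g * L) : ℕ) : ℝ) ≤
      2 ^ (6 * g * (e + 2)) * (((s : ℝ) * ℓ) ^ ℓ) ^ (3 * g * (e + 3)) := by
  have hs' : (1 : ℝ) ≤ s := by exact_mod_cast hs
  have hL1' : (1 : ℝ) ≤ L := by exact_mod_cast hL1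
  set v := ((s : ℝ) * ℓ) ^ ℓ with hv
  have hv0 : 0 ≤ v := by positivity
  have hb : (2 : ℝ) ^ e * (s * L) ≤ 2 ^ (e + 2) * (s * ℓ) := by
    rw [pow_add]
    have : (s : ℝ) * L ≤ s * (3 * ℓ) := by gcongr
    have h2 : (0 : ℝ) < 2 ^ e := by positivity
    have h3 : 0 ≤ (s : ℝ) * ℓ := by positivity
    calc (2 : ℝ) ^ e * (s * L) ≤ 2 ^ e * (s * (3 * ℓ)) := by gcongr
      _ ≤ 2 ^ e * (4 * (s * ℓ)) := by gcongr ?_ * ?_; linarith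
      _ = _ := by ring
  have hb1 : 1 ≤ (2 : ℝ) ^ (e + 2) * (s * ℓ) :=
    one_le_mul_of_one_le_of_one_le (one_le_pow₀ (by norm_num))
      (one_le_mul_of_one_le_of_one_le hs' hℓ)
  have h2e : ((2 : ℝ) ^ (e + 2)) ^ ℓ = (2 ^ ℓ) ^ (e + 2) := by
    rw [← Real.rpow_natCast, ← Real.rpow_natCast, ← Real.rpow_mul (by norm_num),
      ← Real.rpow_mul (by norm_num), mul_comm]
  push_cast
  calc ((2 : ℝ) ^ e * (s * L)) ^ (g * L) ≤ (2 ^ (e + 2) * (s * ℓ)) ^ (g * L) := by gcongr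
    _ = (2 ^ (e + 2) * (s * ℓ)) ^ ((g * L : ℕ) : ℝ) := (Real.rpow_natCast _ _).symm
    _ ≤ (2 ^ (e + 2) * (s * ℓ)) ^ (ℓ * (3 * g : ℕ)) := by
        refine Real.rpow_le_rpow_of_exponent_le hb1 ?_
        push_cast
        have : (0 : ℝ) ≤ g := Nat.cast_nonneg g
        nlinarith
    _ = ((2 ^ ℓ) ^ (e + 2) * v) ^ (3 * g) := by
        rw [Real.rpow_mul_natCast (by positivity), Real.mul_rpow (by positivity) (by positivity),
          h2e]
    _ ≤ ((4 * v) ^ (e + 2) * v) ^ (3 * g) := by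
        gcongr
        exact two_rpow_le hs hℓ
    _ = _ := by
        have h4 : (4 : ℝ) = 2 ^ 2 := by norm_num
        have h5 : (4 * v) ^ (e + 2) * v = 2 ^ (2 * (e + 2)) * v ^ (e + 3) := by
          rw [mul_pow, h4, ← pow_mul]
          ring
        rw [h5, mul_pow, ← pow_mul, ← pow_mul]
        congr 2 <;> ring

theorem time_le_timeBound {g a : ℕ} (hg : 1 ≤ g) : ∃ A K : ℕ, ∀ (n s : ℕ) (ε : ℝ), 1 ≤ n → 1 ≤ s →
    0 < ε → ε < 1 → ((mkParams g a n s ⌈1 / ε⌉₊).time : ℝ) ≤ timeBound A K 3 n s ε := by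
  obtain ⟨α, hα⟩ : ∃ α, α = 6 * g * (g + a + 1 + 2) := ⟨_, rfl⟩
  obtain ⟨κ, hκ⟩ : ∃ κ, κ = 3 * g * (g + a + 1 + 3) := ⟨_, rfl⟩
  -- 64800 = 150·432, and 55 is the power of Z in the bound for m·n·N·d. Of the three logarithmic
  -- factors one comes from n.size in m and two from `opCost`.
  refine ⟨64800 * 2 ^ (55 * α) * (24 + 106 * α) ^ 2, 55 * κ, fun n s ε hn hs hε hε1 => ?_⟩
  have hk : 1 ≤ ⌈1 / ε⌉₊ := Nat.ceil_pos.2 (by positivity)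
  have hL1 : 1 ≤ (s * ⌈1 / ε⌉₊).size := Nat.size_pos.2 (Nat.mul_pos hs hk)
  have hs' : (1 : ℝ) ≤ s := by exact_mod_cast hs
  have hn' : (1 : ℝ) ≤ n := by exact_mod_cast hn
  obtain ⟨hb1, hb2⟩ := mkParams_bounds (a := a) hg hn hs hk
  have hℓ := one_le_logRatio s ε
  have hZ := pow_size_le (e := g + a + 1) (g := g) hs hℓ hL1 (size_le_three_mul_logRatio hs hε hε1)
  rw [← hα, ← hκ] at hZ
  have hZ1 : 1 ≤ (2 ^ (g + a + 1) * (s * (s * ⌈1 / ε⌉₊).size)) ^ (g * (s * ⌈1 / ε⌉₊).size) :=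
    Nat.pow_pos (Nat.mul_pos (Nat.two_pow_pos _) (Nat.mul_pos hs hL1))
  generalize (2 ^ (g + a + 1) * (s * (s * ⌈1 / ε⌉₊).size)) ^ (g * (s * ⌈1 / ε⌉₊).size) = Z at *
  rw [Params.time]
  have hX1 : 1 ≤ (mkParams g a n s ⌈1 / ε⌉₊).numBound :=
    hn.trans (Nat.le_add_left _ _)
  generalize (mkParams g a n s ⌈1 / ε⌉₊).numBound = X at *
  generalize (mkParams g a n s ⌈1 / ε⌉₊) = P at *
  rw [timeBound, baseBound]
  generalize logRatio s ε = ℓ at *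
  have hv1 : 1 ≤ ((s : ℝ) * ℓ) ^ ℓ :=
    Real.one_le_rpow (one_le_mul_of_one_le_of_one_le hs' hℓ) (by linarith)
  have hV : ((s : ℝ) * ℓ) ^ (((55 * κ : ℕ) : ℝ) * ℓ) = ((((s : ℝ) * ℓ) ^ ℓ) ^ κ) ^ 55 := by
    rw [mul_comm ((55 * κ : ℕ) : ℝ) ℓ, Real.rpow_mul_natCast (by positivity), mul_comm 55 κ, pow_mul]
  rw [hV]
  have hw1 : 1 ≤ (((s : ℝ) * ℓ) ^ ℓ) ^ κ := one_le_pow₀ hv1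
  generalize (((s : ℝ) * ℓ) ^ ℓ) ^ κ = w at *
  have hZ1' : (1 : ℝ) ≤ Z := by exact_mod_cast hZ1
  have hlogn : 0 ≤ Real.logb 2 n := Real.logb_nonneg (by norm_num) hn'
  have hlogw : 0 ≤ Real.logb 2 w := Real.logb_nonneg (by norm_num) hw1
  have hlogZ : Real.logb 2 Z ≤ α + Real.logb 2 w := by
    refine (Real.logb_le_logb_of_le (by norm_num) (by positivity) hZ).trans (le_of_eq ?_)
    rw [Real.logb_mul (by positivity) (by positivity), Real.logb_pow,
      Real.logb_self_eq_one (by norm_num), mul_one]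
  have hlogB : Real.logb 2 (n * w ^ 55) = Real.logb 2 n + 55 * Real.logb 2 w := by
    rw [Real.logb_mul (by positivity) (by positivity), Real.logb_pow]
    norm_num
  rw [hlogB]
  have hl := size_le_one_add_logb hn
  have hX : (X.size : ℝ) ≤ 21 + 2 * Real.logb 2 n + 106 * Real.logb 2 Z := by
    have h1 := size_le_one_add_logb hX1
    have h2 : (X : ℝ) ≤ 2 ^ 20 * n ^ 2 * Z ^ 106 := by exact_mod_cast hb2.le
    have h3 := Real.logb_le_logb_of_le (b := 2) (by norm_num) (by exact_mod_cast hX1) h2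
    rw [Real.logb_mul (by positivity) (by positivity), Real.logb_mul (by positivity) (by positivity),
      Real.logb_pow, Real.logb_pow, Real.logb_pow, Real.logb_self_eq_one (by norm_num)] at h3
    push_cast at h3
    linarith
  have hX' : 1 + (X.size : ℝ) ≤
      (24 + 106 * α) * (1 + (Real.logb 2 n + 55 * Real.logb 2 w)) := by
    have hα0 : (0 : ℝ) ≤ α := Nat.cast_nonneg _
    have h1 : 0 ≤ (α : ℝ) * (Real.logb 2 n + 55 * Real.logb 2 w) := by positivity
    linarith
  have hb1' : (P.m * P.n * P.N * P.d : ℝ) ≤ 432 * n * n.size * Z ^ 55 := by exact_mod_cast hb1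
  rw [opCost]
  push_cast
  have hlB : (n.size : ℝ) ≤ 1 + (Real.logb 2 n + 55 * Real.logb 2 w) := by linarith
  have hB0 : 0 ≤ 1 + (Real.logb 2 n + 55 * Real.logb 2 w) := by positivity
  have hw0 : 0 ≤ w := by linarith
  generalize 1 + (Real.logb 2 n + 55 * Real.logb 2 w) = ΛB at *
  have hA : (P.m * P.n * P.N * P.d : ℝ) ≤ 432 * n * ΛB * (2 ^ α * w) ^ 55 :=
    hb1'.trans (by gcongr)
  calc 150 * (P.m * P.n * P.N * P.d * (1 + (X.size : ℝ)) ^ 2)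
      ≤ 150 * (432 * n * ΛB * (2 ^ α * w) ^ 55 * ((24 + 106 * α) * ΛB) ^ 2) := by
        refine mul_le_mul_of_nonneg_left (mul_le_mul hA ?_ (by positivity) (by positivity))
          (by norm_num)
        gcongr
    _ = _ := by ring

/-- The exponent is exactly dl + 5, and e ≥ 2 leaves 4·2^(dl)·2·2^-(dl+5) = 1/4. -/
theorem two_mul_exp_le {q m l d N : ℕ} (hq : 1 ≤ q) (hm : m = 72 * ((d * l + 5) * q * q))
    (hN : N ≤ 4 * 2 ^ (d * l)) :
    (N : ℝ) * (2 * Real.exp (-(2 * m * (1 / (12 * q)) ^ 2))) ≤ 1 / 4 := by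
  have hq' : (0 : ℝ) < q := by exact_mod_cast hq
  have h1 : 2 * (m : ℝ) * (1 / (12 * q)) ^ 2 = ((d * l + 5 : ℕ) : ℝ) := by
    rw [hm]
    push_cast
    field_simp
    ring
  have h2 : (2 : ℝ) ^ (d * l + 5) ≤ Real.exp ((d * l + 5 : ℕ) : ℝ) := by
    rw [← mul_one ((d * l + 5 : ℕ) : ℝ), Real.exp_nat_mul]
    have := Real.add_one_le_exp 1
    gcongr
    linarith
  have hN' : (N : ℝ) ≤ 4 * 2 ^ (d * l) := by exact_mod_cast hN
  rw [h1, Real.exp_neg]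
  have h3 := inv_anti₀ (by positivity) h2
  calc (N : ℝ) * (2 * (Real.exp ((d * l + 5 : ℕ) : ℝ))⁻¹)
      ≤ 4 * 2 ^ (d * l) * (2 * (2 ^ (d * l + 5))⁻¹) := by gcongr
    _ = 1 / 4 := by
      rw [pow_add]
      field_simp
      norm_num

end PACLearning

theorem mainTheorem6 (c : ℝ) (hc : 0 < c) (hc1 : c ≤ 1) :
    ∃ (L : PACLearning.Learner) (a K k : ℕ),
      L.PACLearns PACLearning.monotoneDNF (PACLearning.boundedProductDists c)
        (PACLearning.timeBound a K k) := by
  open PACLearning in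
  obtain ⟨g₀, hg₀⟩ := exists_pow_lt_of_lt_one (by norm_num : (0 : ℝ) < 1 / 2)
    (by linarith : 1 - c / 2 < 1)
  obtain ⟨g, hg, hρg⟩ : ∃ g : ℕ, 1 ≤ g ∧ (1 - c / 2) ^ g ≤ 1 / 2 :=
    ⟨g₀ + 1, by omega,
      (pow_le_pow_of_le_one (by linarith) (by linarith) (Nat.le_succ g₀)).trans hg₀.le⟩
  obtain ⟨a, ha⟩ := exists_const g hg
  obtain ⟨A, K, hAK⟩ := time_le_timeBound (g := g) (a := a) hg
  refine ⟨learner g a, A, K, 3, fun n s ε hn hs hε hε1 f hf => ⟨fun xs b => ?_, ?_⟩⟩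
  · have hk : 1 ≤ ⌈1 / ε⌉₊ := Nat.ceil_pos.2 (by positivity)
    obtain ⟨S, -, hS⟩ := learner_outputs hg hn hs hk (exampleSource f xs b)
      (hAK n s ε hn hs hε hε1)
    exact ⟨_, hS⟩
  · rintro D ⟨μ, hμ, rfl⟩
    obtain ⟨T, hT, hfT⟩ := hf
    have hk : 1 ≤ ⌈1 / ε⌉₊ := Nat.ceil_pos.2 (by positivity)
    obtain ⟨P, hP⟩ : ∃ P, P = mkParams g a n s ⌈1 / ε⌉₊ := ⟨_, rfl⟩
    have hfacts := mkParams_facts (a := a) hg hn hs hk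
    rw [← hP] at hfacts
    obtain ⟨hPB, -, -, -, -, -, -, -, -, -, -, -, -, -, -, hd1, -, hm1, -⟩ := hfacts
    have em : P.m = 72 * ((P.d * n.size + 5) * P.q * P.q) := by rw [hP]; rfl
    have hnl : n + 1 ≤ 2 ^ n.size := Nat.lt_size_self n
    have hη : (0 : ℝ) ≤ 1 / (12 * P.q) := by positivity
    -- First batch: 2(n+1) events, at most 4·2^(d·n.size).
    have hB1 := (hoeffding_freq_family (productDist μ : Measure (Cube n)) (selEvent (dnfSet T))
      (a := 0) hm1 hη).trans (two_mul_exp_le hPB.q_pos em (by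
        simp only [Fintype.card_prod, Fintype.card_option, Fintype.card_fin, Fintype.card_bool]
        have : 2 ^ n.size ≤ 2 ^ (P.d * n.size) :=
          Nat.pow_le_pow_right two_pos (Nat.le_mul_of_pos_left _ hd1)
        omega))
    -- Second batch: (n+1)^d sequences of literal codes, where n + 1 ≤ 2^n.size.
    have hB2 := (hoeffding_freq_family (productDist μ : Measure (Cube n))
      (errEvent (d := P.d) (dnfSet T)) (a := P.m) hm1 hη).trans
      (two_mul_exp_le hPB.q_pos em (by
        simp only [Fintype.card_pi, Fintype.card_fin, Finset.prod_const, Finset.card_univ]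
        have := Nat.pow_le_pow_left hnl P.d
        rw [← pow_mul, mul_comm n.size] at this
        omega))
    refine half_le_sampleMeasure _ hB1 hB2 fun w hw1 hw2 => ?_
    simp only [Set.mem_ofPred_eq, not_exists, not_le, zero_add, ← two_mul] at hw1 hw2
    obtain ⟨S, hS, hO⟩ := learner_outputs hg hn hs hk (exampleSource f w.1 w.2)
      (hAK n s ε hn hs hε hε1)
    rw [← hP] at hS hO
    refine ⟨_, hO, ?_⟩
    have hfT' : {x | f x = true} = dnfSet T := Set.ext hfT
    have hmain := measureReal_ne_hypothesis_le hP (resamples_productDist μ)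
      (ρ := 1 - c / 2) (by linarith) (by linarith) (fun i => by linarith [(μ i).2.1])
      (fun i => by linarith [(hμ i).2]) hρg hg hn hs hk
      (by rw [hP]; exact four_mul_q_lt hg hs hk ha) hT hfT' hS hw1 hw2
    set h := hypothesis P n S _ with hh
    have hε' : 1 / (⌈1 / ε⌉₊ : ℝ) ≤ ε := by
      rw [one_div_le (by exact_mod_cast hk) hε]
      exact Nat.le_ceil _
    have hcompl : {x | f x = h x} = {x | f x ≠ h x}ᶜ := by
      ext x
      simp
    rw [IsClose, ENNReal.ofReal_le_iff_le_toReal (measure_ne_top _ _)]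
    change _ ≤ (productDist μ : Measure (Cube n)).real _
    rw [hcompl, probReal_compl_eq_one_sub .of_discrete]
    linarith
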